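/- Let $(\Omega,\mathscr A,\mathbb P)$ be a probability space, $\nu>0$, and let $\mathcal M_\nu$ be a Poisson random measure on $\mathbb R$ of rate $\nu$ (for pairwise disjoint Borel sets $B_1,\dots,B_n$ the random variables $\mathcal M_\nu(B_1),\dots,\mathcal M_\nu(B_n)$ are independent, and for every bounded Borel set $B$ the random variable $\mathcal M_\nu(B)$ is Poisson distributed with parameter $\nu\lambda(B)$, $\lambda$ being the Lebesgue measure). Let $u:\mathbb R\to[0,\infty)$ be a bounded measurable function with compact support that is not almost everywhere zero, and let $(\mathcal S_N)_{N\in\mathbb N}\subset(0,\infty)$ be monotonically increasing with $\mathcal S_N\to\infty$. For $N\in\mathbb N$ let $$V_N(\omega,x)=\int_{\mathbb R}\mathcal S_N\,u(x-y)\,\mathcal M_\nu^\omega(\mathrm dy),$$ the Poisson random potential with a strength that converges to infinity. Fix a particle density $\rho>0$, put $L_N=N/\rho$ and $\Lambda_N=(-L_N/2,L_N/2)$, and let $E_N^{1,\omega}\le E_N^{2,\omega}\le\dots$ be the eigenvalues, in ascending order and repeated according to their multiplicities, of the operator $-\frac{\mathrm d^2}{\mathrm dx^2}+V_N(\omega,\cdot)$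 on $L^2(\Lambda_N)$ with Dirichlet boundary conditions (which $\mathbb P$-almost surely is self-adjoint with purely discrete spectrum). Then for all $0<\zeta_2<\zeta_1<1$, $$\lim_{N\to\infty}\mathbb P\left(E_N^{2,\omega}-E_N^{1,\omega}\ge N^{-1+\zeta_1}\ \text{ and }\ E_N^{1,\omega}\le\Big[(1+\zeta_2)\frac{\nu\pi}{\ln L_N}\Big]^2\right)=1 .$$ -/

import Mathlib

open MeasureTheory ProbabilityTheory Filter Topology Set

noncomputable section

namespace KacLuttinger

/-! ### Poisson random measures and potentials -/

/-- `M` is a Poisson random measure on `ℝ` of rate `ν` under `P`: a random measure whose values on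
pairwise disjoint Borel sets are independent and whose value on a bounded Borel set `B` is Poisson
distributed with parameter `ν * λ(B)`. Measurability is with respect to the σ-algebra on
`Measure ℝ` generated by the evaluations `μ ↦ μ B`, `B` Borel. -/
structure IsPoissonRandomMeasure {Ω : Type*} [MeasurableSpace Ω] (P : Measure Ω) (ν : ℝ)
    (M : Ω → Measure ℝ) : Prop where
  measurable : Measurable M
  indep : ∀ (n : ℕ) (B : Fin n → Set ℝ), (∀ i, MeasurableSet (B i)) →
    Pairwise (fun i k => Disjoint (B i) (B k)) → iIndepFun (fun i ω => M ω (B i)) P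
  law : ∀ B : Set ℝ, MeasurableSet B → Bornology.IsBounded B → ∀ m : ℕ,
    P {ω | M ω B = (m : ENNReal)} =
      ENNReal.ofReal (Real.exp (-(ν * volume.real B)) * (ν * volume.real B) ^ m / (m.factorial : ℝ))

/-- The Poisson random potential `V(ω, x) = ∫ u(x - y) M^ω(dy)` with single-site potential `u`. -/
def potential {Ω : Type*} (u : ℝ → ℝ) (M : Ω → Measure ℝ) (ω : Ω) (x : ℝ) : ℝ :=
  ∫ y, u (x - y) ∂(M ω)

/-! ### The Dirichlet Schrödinger operator on `Λ = (-L/2, L/2)` -/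

/-- The interval `Λ = (-L/2, L/2)`. -/
def box (L : ℝ) : Set ℝ := Ioo (-L / 2) (L / 2)

/-- The complex Hilbert space `L²(Λ)`. -/
abbrev L2 (L : ℝ) : Type := Lp ℂ 2 (volume.restrict (box L))

/-- `φ ∈ C_c^∞(Λ)`. -/
def IsTest (L : ℝ) (φ : ℝ → ℂ) : Prop :=
  ContDiff ℝ ((⊤ : ℕ∞) : WithTop ℕ∞) φ ∧ HasCompactSupport φ ∧ tsupport φ ⊆ box L

/-- The graph `{(φ, φ') : φ ∈ C_c^∞(Λ)}` of the derivative on test functions, in `L²(Λ) × L²(Λ)`. -/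
def testGraph (L : ℝ) : Submodule ℂ (L2 L × L2 L) where
  carrier := {p | ∃ φ : ℝ → ℂ, IsTest L φ ∧ p.1 =ᵐ[volume.restrict (box L)] φ ∧
    p.2 =ᵐ[volume.restrict (box L)] deriv φ}
  zero_mem' := by
    refine ⟨0, ⟨contDiff_const, HasCompactSupport.zero, by simp [tsupport]⟩, ?_, ?_⟩
    · exact Lp.coeFn_zero _ _ _
    · have h : deriv (0 : ℝ → ℂ) = 0 := by
        funext x
        exact deriv_const x 0
      rw [h]
      exact Lp.coeFn_zero _ _ _
  add_mem' := by
    rintro p q ⟨φ, hφ, h1, h2⟩ ⟨χ, hχ, k1, k2⟩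
    refine ⟨φ + χ, ⟨hφ.1.add hχ.1, hφ.2.1.add hχ.2.1,
      (tsupport_add φ χ).trans (union_subset hφ.2.2 hχ.2.2)⟩, ?_, ?_⟩
    · exact (Lp.coeFn_add p.1 q.1).trans (h1.add k1)
    · have h : deriv (φ + χ) = deriv φ + deriv χ := by
        funext x
        exact deriv_add (hφ.1.differentiable (by simp) x) (hχ.1.differentiable (by simp) x)
      rw [h]
      exact (Lp.coeFn_add p.2 q.2).trans (h2.add k2)
  smul_mem' := by
    rintro c p ⟨φ, hφ, h1, h2⟩
    refine ⟨c • φ, ⟨hφ.1.const_smul c, hφ.2.1.smul_left (f := fun _ => c),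
      (closure_mono (Function.support_const_smul_subset c φ)).trans hφ.2.2⟩, ?_, ?_⟩
    · exact (Lp.coeFn_smul c p.1).trans (h1.const_smul c)
    · have h : deriv (c • φ) = c • deriv φ := by
        funext x
        exact deriv_const_smul c (hφ.1.differentiable (by simp) x)
      rw [h]
      exact (Lp.coeFn_smul c p.2).trans (h2.const_smul c)

/-- The Sobolev space `H¹₀(Λ)`, the `H¹`-closure of `C_c^∞(Λ)`, as the set of all pairs `(ψ, ψ')`
with `ψ ∈ H¹₀(Λ)` and `ψ'` its weak derivative. -/
def H10 (L : ℝ) : Submodule ℂ (L2 L × L2 L) := (testGraph L).topologicalClosure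

/-- The Schrödinger operator `H = (-Δ + V)` on `L²(Λ)` with Dirichlet boundary conditions, given by
its graph: `(ψ, f)` belongs to it, i.e. `ψ` is in the domain of `H` and `H ψ = f`, if and only if
`ψ ∈ H¹₀(Λ)`, `w := V ψ ∈ L²(Λ)`, and `-ψ'' = f - w` weakly, that is
`∫ conj φ' * ψ' = ∫ conj φ * (f - w)` for all `φ ∈ C_c^∞(Λ)`. For `V` bounded on `Λ` this is the
self-adjoint operator of the closed form `∫ |ψ'|² + ∫ V |ψ|²` on `H¹₀(Λ)`. -/
def schrodinger (L : ℝ) (V : ℝ → ℝ) : Submodule ℂ (L2 L × L2 L) where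
  carrier := {p | ∃ g w : L2 L, (p.1, g) ∈ H10 L ∧
    w =ᵐ[volume.restrict (box L)] (fun x => (V x : ℂ) * p.1 x) ∧
    ∀ q ∈ testGraph L, inner ℂ q.2 g = inner ℂ q.1 (p.2 - w)}
  zero_mem' := by
    refine ⟨0, 0, (H10 L).zero_mem, ?_, fun q _ => by simp⟩
    filter_upwards [Lp.coeFn_zero ℂ 2 (volume.restrict (box L))] with x hx
    have hx' : (0 : L2 L) x = 0 := hx
    change (0 : L2 L) x = (V x : ℂ) * (0 : L2 L) x
    rw [hx', mul_zero]
  add_mem' := by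
    rintro p p' ⟨g, w, hg, hw, h⟩ ⟨g', w', hg', hw', h'⟩
    refine ⟨g + g', w + w', (H10 L).add_mem hg hg', ?_, fun q hq => ?_⟩
    · filter_upwards [hw, hw', Lp.coeFn_add w w', Lp.coeFn_add p.1 p'.1] with x a b c d
      simp only [Prod.fst_add, c, d, Pi.add_apply, a, b]
      ring
    · rw [inner_add_right, h q hq, h' q hq, ← inner_add_right, Prod.snd_add]
      congr 1
      abel
  smul_mem' := by
    rintro c p ⟨g, w, hg, hw, h⟩
    refine ⟨c • g, c • w, (H10 L).smul_mem c hg, ?_, fun q hq => ?_⟩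
    · filter_upwards [hw, Lp.coeFn_smul c w, Lp.coeFn_smul c p.1] with x a b d
      simp only [Prod.smul_fst, b, d, Pi.smul_apply, a, smul_eq_mul]
      ring
    · rw [inner_smul_right, h q hq, ← inner_smul_right, Prod.smul_snd, smul_sub]

/-- The eigenspace `{ψ ∈ D(H) : H ψ = E ψ}`. -/
def eigenspace (L : ℝ) (V : ℝ → ℝ) (E : ℝ) : Submodule ℂ (L2 L) :=
  (schrodinger L V).comap (LinearMap.id.prod ((E : ℂ) • LinearMap.id))

/-- The number of eigenvalues of `H` that are at most `E`, each counted with its multiplicity: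
the dimension of the sum of the corresponding (linearly independent) eigenspaces. -/
def eigenCount (L : ℝ) (V : ℝ → ℝ) (E : ℝ) : Cardinal :=
  Module.rank ℂ (⨆ e : Iic E, eigenspace L V (e : ℝ) : Submodule ℂ (L2 L))

/-- The `j`-th eigenvalue (`j = 1, 2, …`) of `H` in ascending order, each eigenvalue repeated
according to its multiplicity. -/
def eigenvalue (L : ℝ) (V : ℝ → ℝ) (j : ℕ) : ℝ :=
  sInf {E : ℝ | (j : Cardinal) ≤ eigenCount L V E}

/-! ### The gap event -/

/-- The eigenvalue `E_N^j` for `L_N = N / ρ` and the potential `V_N` with single-site potential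
`u_N = S_N u`. -/
def energy {Ω : Type*} (M : Ω → Measure ℝ) (u : ℝ → ℝ) (S : ℕ → ℝ) (ρ : ℝ) (N j : ℕ) (ω : Ω) : ℝ :=
  eigenvalue ((N : ℝ) / ρ) (potential (fun x => S N * u x) M ω) j

/-- The event that `E_N^j - E_N^1 ≥ N^(-1 + ζ₁)` and `E_N^1 ≤ [(1 + ζ₂) ν π / ln L_N]²`. -/
def gapEvent {Ω : Type*} (M : Ω → Measure ℝ) (ν : ℝ) (u : ℝ → ℝ) (S : ℕ → ℝ) (ρ ζ₁ ζ₂ : ℝ)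
    (N j : ℕ) : Set Ω :=
  {ω | (N : ℝ) ^ (-1 + ζ₁) ≤ energy M u S ρ N j ω - energy M u S ρ N 1 ω ∧
    energy M u S ρ N 1 ω ≤ ((1 + ζ₂) * (ν * Real.pi / Real.log ((N : ℝ) / ρ))) ^ 2}

end KacLuttinger

end

/-!
The proof is variational. For a real trial function `f` on `(a, b)` let `groundEnergy a b V` be the
infimum of `∫ f'² + ∫ V f²` over `∫ f² = 1`. Only two facts about the spectrum are needed: the first
eigenvalue is at most the ground state energy (`eigenvalue_one_le`), and for every `y` in the
interval the second eigenvalue is at least the smaller of the ground state energies of the two parts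
into which `y` divides it (`min_groundEnergy_le_eigenvalue_two`), since some combination of the first
two eigenfunctions vanishes at `y`. Hence if the gap is smaller than `δ`, then for every `y` one of
the two parts has nearly the ground state energy of the whole interval.

The interval is divided into blocks of bounded length. A block with a point of the configuration in
its core carries potential of mass at least `c₀`, so by a Robin-type bound the form dominates `k²`
times the mass of `f` off the runs of at least `m` unoccupied blocks, where `k (m + 1) r` is slightly
less than `π` (`sq_mul_integral_le_formEnergy`). With `m r` slightly shorter than the length
`(log L) / ν` of the longest empty intervals, `k²` exceeds the ground state energy while long runs
are rare; so a nearly minimizing `f` has an amplitude at the midpoint `c` of some unoccupied block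
that is not small (`exists_le_sq_of_formEnergy_le`). A smooth cutoff lets `f` be taken to vanish near
the right end of the interval (`exists_localization_const`), and so the configuration can be
stretched at `c`: inserting a gap of length `t` there keeps `∫ f'² + ∫ V f²` but increases the mass by
`t f(c)²`, and lowers the ground state energy by a controlled amount. A small gap thus forces the
resonance `IsResonant` at `c` (`exists_isResonant`): inserting gaps of lengths `h, 2h, …, Kh` at `c`
lowers the energy by at least `2δ`, and for each `c + j h` one of the two parts nearly reaches the
ground state energy of the original configuration.

Resonances are improbable (`IsPoissonRandomMeasure.measure_resonantSet_le`). Inserting a gap into a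
Poisson random measure yields the law of the measure with an interval erased, which does not make an
event less probable that forces this interval to be empty
(`IsPoissonRandomMeasure.measure_le_insertGap`). On the other hand the configurations obtained by
inserting gaps of lengths `0, h, …, Kh` cannot be resonant for two different lengths: inserting the
gap on one side of a point leaves the part on its other side unchanged
(`IsResonant.eq_of_insertGap`). So a resonance at `c` has at most `1 / (K + 1)` times the probability
of a run. Summed over the at most `n m` possible positions this is small, because `h` is of the order
`δ` up to small powers of `L`, and `δ` is smaller than `L` to a negative power. The bounds are uniform
in the single-site potential as long as its mass is at least `c₀`
(`IsPoissonRandomMeasure.eventually_measure_gap_compl_le`), which the growing strength guarantees.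
-/

namespace KacLuttinger

/-! ### Trial functions and the variational ground state energy -/

/-- A real trial function of the Dirichlet form on `(a, b)`, together with its weak derivative:
`g` is square integrable, `f` and `g` vanish off `(a, b)`, and `f` is a primitive of `g` on the
whole line. Extension by zero makes the inclusion of a smaller interval literal. -/
structure IsTrial (a b : ℝ) (f g : ℝ → ℝ) : Prop where
  memLp : MemLp g 2 volume
  f_zero : ∀ x, x ∉ Ioo a b → f x = 0
  g_zero : ∀ x, x ∉ Ioo a b → g x = 0
  ftc : ∀ x y, f y - f x = ∫ t in x..y, g t

/-- A nonnegative measurable potential that is bounded on bounded sets. -/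
structure IsPot (V : ℝ → ℝ) : Prop where
  meas : Measurable V
  nonneg : ∀ x, 0 ≤ V x
  bdd : ∀ R : ℝ, ∃ C, ∀ x ∈ Icc (-R) R, V x ≤ C

/-- The quadratic form `∫ |f'|² + ∫ V |f|²`. -/
noncomputable def formEnergy (V f g : ℝ → ℝ) : ℝ := (∫ x, g x ^ 2) + ∫ x, V x * f x ^ 2

/-- The ground state energy of `-Δ + V` on `(a, b)` with Dirichlet boundary conditions, as the
infimum of the quadratic form over normalized trial functions. -/
noncomputable def groundEnergy (a b : ℝ) (V : ℝ → ℝ) : ℝ :=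
  sInf {e | ∃ f g, IsTrial a b f g ∧ ∫ x, f x ^ 2 = 1 ∧ formEnergy V f g = e}

/-- The product rule for primitives of locally integrable functions. -/
theorem primitive_mul {F G φ γ : ℝ → ℝ} (hφ : LocallyIntegrable φ volume)
    (hγ : LocallyIntegrable γ volume)
    (hF : ∀ x y, F y - F x = ∫ t in x..y, φ t) (hG : ∀ x y, G y - G x = ∫ t in x..y, γ t)
    (x y : ℝ) : F y * G y - F x * G x = ∫ t in x..y, (φ t * G t + F t * γ t) := by
  have key : ∀ {H η : ℝ → ℝ}, LocallyIntegrable η volume →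
      (∀ x y, H y - H x = ∫ t in x..y, η t) →
      AbsolutelyContinuousOnInterval H x y ∧ ∀ᵐ t, deriv H t = η t := by
    intro H η hη hH
    have e : H = fun z => (∫ t in x..z, η t) + H x := by
      funext z
      have := hH x z
      linarith
    constructor
    · have h1 : AbsolutelyContinuousOnInterval (fun z => ∫ t in x..z, η t) x y :=
        (intervalIntegrable_iff.mpr <| (hη.integrableOn_isCompact isCompact_uIcc).mono_set
          uIoc_subset_uIcc).absolutelyContinuousOnInterval_intervalIntegral (by simp)
      have h2 : AbsolutelyContinuousOnInterval (fun _ : ℝ => H x) x y :=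
        (contDiff_const.contDiffOn (s := uIcc x y) (n := 1)).absolutelyContinuousOnInterval
      rw [e]
      exact h1.add h2
    · filter_upwards [LocallyIntegrable.ae_hasDerivAt_integral hη] with t ht
      have h3 := (ht x).add_const (H x)
      rw [← e] at h3
      exact h3.deriv
  obtain ⟨a1, a2⟩ := key hφ hF
  obtain ⟨b1, b2⟩ := key hγ hG
  rw [← a1.integral_deriv_mul_eq_sub b1]
  apply intervalIntegral.integral_congr_ae
  filter_upwards [a2, b2] with t h1 h2 _
  rw [h1, h2]

/-- The Cauchy-Schwarz inequality for the increment of a primitive. -/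
theorem sq_intervalIntegral_le {g : ℝ → ℝ} {x y : ℝ} (hxy : x ≤ y)
    (hg : IntervalIntegrable g volume x y)
    (hg2 : IntervalIntegrable (fun t => g t ^ 2) volume x y) :
    (∫ t in x..y, g t) ^ 2 ≤ (y - x) * ∫ t in x..y, g t ^ 2 := by
  rcases hxy.eq_or_lt with rfl | hlt
  · simp
  set A := (∫ t in x..y, g t) / (y - x) with hA
  have hpos : 0 < y - x := sub_pos.2 hlt
  have h0 : 0 ≤ ∫ t in x..y, (g t - A) ^ 2 :=
    intervalIntegral.integral_nonneg hxy fun t _ => sq_nonneg _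
  have h1 : ∫ t in x..y, (g t - A) ^ 2
      = (∫ t in x..y, g t ^ 2) - 2 * A * (∫ t in x..y, g t) + A ^ 2 * (y - x) := by
    have : (fun t => (g t - A) ^ 2) = fun t => (g t ^ 2 - 2 * A * g t) + A ^ 2 := by
      funext t; ring
    rw [this, intervalIntegral.integral_add (hg2.sub (hg.const_mul _)) (by simp),
      intervalIntegral.integral_sub hg2 (hg.const_mul _), intervalIntegral.integral_const_mul]
    simp
    ring
  rw [h1] at h0
  have hI : ∫ t in x..y, g t = A * (y - x) := by rw [hA]; field_simp
  rw [hI] at h0 ⊢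
  nlinarith [mul_le_mul_of_nonneg_left h0 hpos.le]

namespace IsTrial

variable {a b : ℝ} {f g : ℝ → ℝ}

theorem integrable_sq (h : IsTrial a b f g) : Integrable (fun x => g x ^ 2) := h.memLp.integrable_sq

theorem integrable (h : IsTrial a b f g) : Integrable g := by
  have h1 : IntegrableOn g (Ioo a b) :=
    (h.memLp.restrict (Ioo a b)).integrable (by norm_num)
  exact h1.integrable_of_forall_notMem_eq_zero fun x hx => h.g_zero x hx

theorem continuous (h : IsTrial a b f g) : Continuous f := by
  have e : f = fun z => (∫ t in (0 : ℝ)..z, g t) + f 0 := by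
    funext z
    have := h.ftc 0 z
    linarith
  rw [e]
  exact (intervalIntegral.continuous_primitive
    (fun _ _ => h.integrable.intervalIntegrable) 0).add continuous_const

theorem hasCompactSupport (h : IsTrial a b f g) : HasCompactSupport f :=
  HasCompactSupport.intro (isCompact_Icc (a := a) (b := b)) fun x hx =>
    h.f_zero x fun h' => hx (Ioo_subset_Icc_self h')

theorem integrable_f_sq (h : IsTrial a b f g) : Integrable (fun x => f x ^ 2) :=
  (h.continuous.pow 2).integrable_of_hasCompactSupport <| by
    have := h.hasCompactSupport.mul_left (f := f)
    simpa [sq] using this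

theorem mono {a' b' : ℝ} (h : IsTrial a b f g) (ha : a' ≤ a) (hb : b ≤ b') :
    IsTrial a' b' f g where
  memLp := h.memLp
  f_zero x hx := h.f_zero x fun h' => hx ⟨ha.trans_lt h'.1, h'.2.trans_le hb⟩
  g_zero x hx := h.g_zero x fun h' => hx ⟨ha.trans_lt h'.1, h'.2.trans_le hb⟩
  ftc := h.ftc

theorem const_mul (h : IsTrial a b f g) (c : ℝ) :
    IsTrial a b (fun x => c * f x) (fun x => c * g x) where
  memLp := h.memLp.const_mul c
  f_zero x hx := by simp [h.f_zero x hx]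
  g_zero x hx := by simp [h.g_zero x hx]
  ftc x y := by rw [intervalIntegral.integral_const_mul, ← h.ftc]; ring

theorem add {f' g' : ℝ → ℝ} (h : IsTrial a b f g) (h' : IsTrial a b f' g') :
    IsTrial a b (fun x => f x + f' x) (fun x => g x + g' x) where
  memLp := h.memLp.add h'.memLp
  f_zero x hx := by simp [h.f_zero x hx, h'.f_zero x hx]
  g_zero x hx := by simp [h.g_zero x hx, h'.g_zero x hx]
  ftc x y := by
    rw [intervalIntegral.integral_add h.integrable.intervalIntegrable
      h'.integrable.intervalIntegrable, ← h.ftc, ← h'.ftc]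
    ring

theorem sq_sub_le (h : IsTrial a b f g) {x y : ℝ} (hxy : x ≤ y) :
    (f y - f x) ^ 2 ≤ (y - x) * ∫ t in x..y, g t ^ 2 := by
  rw [h.ftc]
  exact sq_intervalIntegral_le hxy h.integrable.intervalIntegrable
    h.integrable_sq.intervalIntegrable

/-- Multiplication by a continuously differentiable function. -/
theorem mul_contDiff (h : IsTrial a b f g) {χ χ' : ℝ → ℝ} (hχ : ∀ x, HasDerivAt χ (χ' x) x)
    (hc : Continuous χ') :
    IsTrial a b (fun x => χ x * f x) (fun x => χ' x * f x + χ x * g x) where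
  memLp := by
    have c1 : Continuous χ := continuous_iff_continuousAt.2 fun x => (hχ x).continuousAt
    refine MemLp.add ?_ ?_
    · exact (hc.mul h.continuous).memLp_of_hasCompactSupport h.hasCompactSupport.mul_left
    · obtain ⟨C, hC⟩ := (isCompact_Icc (a := a) (b := b)).exists_bound_of_continuousOn
        c1.continuousOn
      refine (h.memLp.const_mul C).mono
        (c1.aestronglyMeasurable.mul h.memLp.aestronglyMeasurable) ?_
      filter_upwards with x
      by_cases hx : x ∈ Ioo a b
      · rw [norm_mul, norm_mul]
        gcongr
        exact (hC x (Ioo_subset_Icc_self hx)).trans (le_abs_self C)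
      · simp [h.g_zero x hx]
  f_zero x hx := by simp [h.f_zero x hx]
  g_zero x hx := by simp [h.f_zero x hx, h.g_zero x hx]
  ftc x y := by
    refine primitive_mul (φ := χ') (γ := g) hc.locallyIntegrable h.integrable.locallyIntegrable
      (fun x y => ?_) h.ftc x y
    exact (intervalIntegral.integral_eq_sub_of_hasDerivAt (fun t _ => hχ t)
      (hc.intervalIntegrable _ _)).symm

theorem translate (h : IsTrial a b f g) (t : ℝ) :
    IsTrial (a + t) (b + t) (fun x => f (x - t)) (fun x => g (x - t)) where
  memLp := h.memLp.comp_measurePreserving (measurePreserving_sub_right volume t)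
  f_zero x hx := h.f_zero _ fun h' => hx ⟨by linarith [h'.1], by linarith [h'.2]⟩
  g_zero x hx := h.g_zero _ fun h' => hx ⟨by linarith [h'.1], by linarith [h'.2]⟩
  ftc x y := by
    rw [intervalIntegral.integral_comp_sub_right, h.ftc]

/-- A trial function that vanishes at `y` may be cut off to the left of `y`. -/
theorem restrict_right (h : IsTrial a b f g) {y : ℝ} (hy : f y = 0) :
    IsTrial y b ((Ioi y).indicator f) ((Ioi y).indicator g) where
  memLp := h.memLp.indicator measurableSet_Ioi
  f_zero x hx := by
    by_cases hxy : x ∈ Ioi y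
    · rw [indicator_of_mem hxy]
      exact h.f_zero x fun h' => hx ⟨hxy, h'.2⟩
    · exact indicator_of_notMem hxy _
  g_zero x hx := by
    by_cases hxy : x ∈ Ioi y
    · rw [indicator_of_mem hxy]
      exact h.g_zero x fun h' => hx ⟨hxy, h'.2⟩
    · exact indicator_of_notMem hxy _
  ftc := by
    have hi : Integrable ((Ioi y).indicator g) := h.integrable.indicator measurableSet_Ioi
    have key : ∀ x, (Ioi y).indicator f x = ∫ t in y..x, (Ioi y).indicator g t := by
      intro x
      rcases le_or_gt x y with hx | hx
      · rw [indicator_of_notMem (by simpa using hx), intervalIntegral.integral_symm,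
          intervalIntegral.integral_congr_ae (g := fun _ => (0 : ℝ))]
        · simp
        · filter_upwards with t ht
          rw [uIoc_of_le hx] at ht
          exact indicator_of_notMem (by simpa using ht.2) _
      · rw [indicator_of_mem (show x ∈ Ioi y from hx)]
        have := h.ftc y x
        rw [hy, sub_zero] at this
        rw [this]
        apply intervalIntegral.integral_congr_ae
        filter_upwards with t ht
        rw [uIoc_of_le hx.le] at ht
        rw [indicator_of_mem (show t ∈ Ioi y from ht.1)]
    intro x z
    rw [key, key, intervalIntegral.integral_interval_sub_left hi.intervalIntegrable
      hi.intervalIntegrable]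

/-- A trial function that vanishes at `y` may be cut off to the right of `y`. -/
theorem restrict_left (h : IsTrial a b f g) {y : ℝ} (hy : f y = 0) :
    IsTrial a y ((Iio y).indicator f) ((Iio y).indicator g) where
  memLp := h.memLp.indicator measurableSet_Iio
  f_zero x hx := by
    by_cases hxy : x ∈ Iio y
    · rw [indicator_of_mem hxy]
      exact h.f_zero x fun h' => hx ⟨h'.1, hxy⟩
    · exact indicator_of_notMem hxy _
  g_zero x hx := by
    by_cases hxy : x ∈ Iio y
    · rw [indicator_of_mem hxy]
      exact h.g_zero x fun h' => hx ⟨h'.1, hxy⟩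
    · exact indicator_of_notMem hxy _
  ftc := by
    have hR := (h.restrict_right hy).ftc
    have hi : Integrable ((Ioi y).indicator g) := h.integrable.indicator measurableSet_Ioi
    have e : (Iio y).indicator f = fun x => f x - (Ioi y).indicator f x := by
      funext x
      rcases lt_trichotomy x y with hx | rfl | hx
      · rw [indicator_of_mem (show x ∈ Iio y from hx),
          indicator_of_notMem (show x ∉ Ioi y from not_lt.2 hx.le), sub_zero]
      · simp [hy]
      · rw [indicator_of_mem (show x ∈ Ioi y from hx),
          indicator_of_notMem (show x ∉ Iio y from not_lt.2 hx.le), sub_self]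
    have e' : (Iio y).indicator g =ᵐ[volume] fun x => g x - (Ioi y).indicator g x := by
      have : ∀ᵐ x : ℝ, x ≠ y := by simp [ae_iff, measure_singleton]
      filter_upwards [this] with x hx'
      rcases lt_or_gt_of_ne hx' with hx | hx
      · rw [indicator_of_mem (show x ∈ Iio y from hx),
          indicator_of_notMem (show x ∉ Ioi y from not_lt.2 hx.le), sub_zero]
      · rw [indicator_of_mem (show x ∈ Ioi y from hx),
          indicator_of_notMem (show x ∉ Iio y from not_lt.2 hx.le), sub_self]
    intro x z
    rw [intervalIntegral.integral_congr_ae (e'.mono fun t ht _ => ht),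
      intervalIntegral.integral_sub h.integrable.intervalIntegrable hi.intervalIntegrable,
      ← h.ftc, ← hR, e]
    ring

theorem integrable_pot (h : IsTrial a b f g) {V : ℝ → ℝ} (hV : IsPot V) :
    Integrable (fun x => V x * f x ^ 2) := by
  obtain ⟨C, hC⟩ := hV.bdd (max |a| |b|)
  refine (h.integrable_f_sq.const_mul C).mono
    (hV.meas.aestronglyMeasurable.mul h.integrable_f_sq.aestronglyMeasurable) ?_
  filter_upwards with x
  by_cases hx : x ∈ Ioo a b
  · have hx' : x ∈ Icc (-max |a| |b|) (max |a| |b|) :=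
      ⟨by linarith [hx.1, neg_abs_le a, le_max_left |a| |b|],
       by linarith [hx.2, le_abs_self b, le_max_right |a| |b|]⟩
    rw [norm_mul, norm_mul]
    gcongr
    rw [Real.norm_eq_abs, abs_of_nonneg (hV.nonneg x)]
    exact (hC x hx').trans (le_abs_self C)
  · simp [h.f_zero x hx]

end IsTrial

theorem formEnergy_nonneg {V : ℝ → ℝ} (hV : IsPot V) (f g : ℝ → ℝ) : 0 ≤ formEnergy V f g :=
  add_nonneg (integral_nonneg fun _ => sq_nonneg _)
    (integral_nonneg fun x => mul_nonneg (hV.nonneg x) (sq_nonneg _))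

theorem formEnergy_const_mul (V f g : ℝ → ℝ) (c : ℝ) :
    formEnergy V (fun x => c * f x) (fun x => c * g x) = c ^ 2 * formEnergy V f g := by
  unfold formEnergy
  rw [mul_add, ← integral_const_mul, ← integral_const_mul]
  congr 1 <;> congr 1 <;> funext x <;> ring

theorem groundEnergy_bddBelow (a b : ℝ) {V : ℝ → ℝ} (hV : IsPot V) :
    BddBelow {e | ∃ f g, IsTrial a b f g ∧ ∫ x, f x ^ 2 = 1 ∧ formEnergy V f g = e} := by
  refine ⟨0, ?_⟩
  rintro e ⟨f, g, -, -, rfl⟩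
  exact formEnergy_nonneg hV f g

theorem groundEnergy_nonneg (a b : ℝ) {V : ℝ → ℝ} (hV : IsPot V) : 0 ≤ groundEnergy a b V := by
  refine Real.sInf_nonneg ?_
  rintro e ⟨f, g, -, -, rfl⟩
  exact formEnergy_nonneg hV f g

theorem groundEnergy_mul_le {a b : ℝ} {V f g : ℝ → ℝ} (hV : IsPot V) (h : IsTrial a b f g) :
    groundEnergy a b V * ∫ x, f x ^ 2 ≤ formEnergy V f g := by
  have h0 : 0 ≤ ∫ x, f x ^ 2 := integral_nonneg fun x => sq_nonneg _
  rcases h0.eq_or_lt with h1 | h1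
  · rw [← h1, mul_zero]
    exact formEnergy_nonneg hV f g
  set m := ∫ x, f x ^ 2
  have hc : (Real.sqrt m)⁻¹ ^ 2 = m⁻¹ := by rw [inv_pow, Real.sq_sqrt h0]
  have h2 : groundEnergy a b V ≤ m⁻¹ * formEnergy V f g := by
    refine csInf_le (groundEnergy_bddBelow a b hV)
      ⟨_, _, h.const_mul (Real.sqrt m)⁻¹, ?_, by rw [formEnergy_const_mul, hc]⟩
    simp_rw [mul_pow, hc]
    rw [integral_const_mul]
    exact inv_mul_cancel₀ h1.ne'
  calc groundEnergy a b V * m ≤ m⁻¹ * formEnergy V f g * m := by gcongr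
    _ = formEnergy V f g := by field_simp

/-! ### Existence, monotonicity and stretching of trial functions -/

theorem exists_isTrial {a b : ℝ} (hab : a < b) :
    ∃ f g, IsTrial a b f g ∧ ∫ x, f x ^ 2 = 1 := by
  -- a tent: the primitive of `1` on the left half and `-1` on the right half
  set c := (a + b) / 2 with hc
  have hac : a < c := by linarith
  have hcb : c < b := by linarith
  set f : ℝ → ℝ := fun x => max 0 (min (x - a) (b - x)) with hf
  set g : ℝ → ℝ := fun x => (Ioc a c).indicator 1 x - (Ioo c b).indicator 1 x with hg
  have hi1 : Integrable ((Ioc a c).indicator (1 : ℝ → ℝ)) :=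
    (integrable_indicator_iff measurableSet_Ioc).2 (integrableOn_const (by simp))
  have hi2 : Integrable ((Ioo c b).indicator (1 : ℝ → ℝ)) :=
    (integrable_indicator_iff measurableSet_Ioo).2 (integrableOn_const (by simp))
  have hcont : Continuous f := by fun_prop
  have hgI : Integrable g := hi1.sub hi2
  have hT : IsTrial a b f g := by
    refine ⟨?_, ?_, ?_, ?_⟩
    · exact (memLp_indicator_const 2 measurableSet_Ioc 1 (by simp)).sub
        (memLp_indicator_const 2 measurableSet_Ioo 1 (by simp))
    · intro x hx
      rw [hf]
      refine max_eq_left ?_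
      by_contra! h
      rw [lt_min_iff] at h
      exact hx ⟨by linarith [h.1], by linarith [h.2]⟩
    · intro x hx
      rw [hg]
      simp only
      rw [indicator_of_notMem, indicator_of_notMem, sub_zero]
      · exact fun h => hx ⟨hac.trans h.1, h.2⟩
      · exact fun h => hx ⟨h.1, h.2.trans_lt hcb⟩
    · intro x y
      refine (integral_eq_of_hasDerivAt_off_countable f g (s := {a, c, b})
        (by simp) hcont.continuousOn ?_ hgI.intervalIntegrable).symm
      rintro z ⟨-, hz⟩
      simp only [mem_insert_iff, mem_singleton_iff, not_or] at hz
      obtain ⟨hza, hzc, hzb⟩ := hz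
      rcases lt_or_gt_of_ne hza with h1 | h1
      · have : g z = 0 := by
          rw [hg]; simp only
          rw [indicator_of_notMem (fun h => by linarith [h.1]),
            indicator_of_notMem (fun h => by linarith [h.1]), sub_zero]
        rw [this]
        refine (hasDerivAt_const z (0 : ℝ)).congr_of_eventuallyEq ?_
        filter_upwards [gt_mem_nhds h1] with w hw
        exact max_eq_left ((min_le_left _ _).trans (by linarith))
      rcases lt_or_gt_of_ne hzb with h2 | h2
      swap
      · have : g z = 0 := by
          rw [hg]; simp only
          rw [indicator_of_notMem (fun h => by linarith [h.2]),
            indicator_of_notMem (fun h => by linarith [h.2]), sub_zero]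
        rw [this]
        refine (hasDerivAt_const z (0 : ℝ)).congr_of_eventuallyEq ?_
        filter_upwards [lt_mem_nhds h2] with w hw
        exact max_eq_left ((min_le_right _ _).trans (by linarith))
      rcases lt_or_gt_of_ne hzc with h3 | h3
      · have : g z = 1 := by
          rw [hg]; simp only
          rw [indicator_of_mem (show z ∈ Ioc a c from ⟨h1, h3.le⟩),
            indicator_of_notMem (fun h => by linarith [h.1]), sub_zero, Pi.one_apply]
        rw [this]
        refine ((hasDerivAt_id z).sub_const a).congr_of_eventuallyEq ?_
        filter_upwards [gt_mem_nhds h3, lt_mem_nhds h1] with w hw hw'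
        simp only [hf, id]
        rw [min_eq_left (by linarith), max_eq_right (by linarith)]
      · have : g z = -1 := by
          rw [hg]; simp only
          rw [indicator_of_notMem (fun h => by linarith [h.2]),
            indicator_of_mem (show z ∈ Ioo c b from ⟨h3, h2⟩), Pi.one_apply, zero_sub]
        rw [this]
        refine ((hasDerivAt_id z).const_sub b).congr_of_eventuallyEq ?_
        filter_upwards [gt_mem_nhds h2, lt_mem_nhds h3] with w hw hw'
        simp only [hf, id]
        rw [min_eq_right (by linarith), max_eq_right (by linarith)]
  have hpos : 0 < ∫ x, f x ^ 2 := by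
    refine (hcont.pow 2).integral_pos_of_hasCompactSupport_nonneg_nonzero ?_ ?_ (x := c) ?_
    · have := hT.hasCompactSupport.mul_left (f := f)
      simpa [sq, Pi.pow_def, Pi.mul_def] using this
    · exact fun x => sq_nonneg _
    · have : 0 < f c := lt_max_of_lt_right (lt_min (by linarith) (by linarith))
      simpa using this.ne'
  refine ⟨_, _, hT.const_mul (Real.sqrt (∫ x, f x ^ 2))⁻¹, ?_⟩
  simp_rw [mul_pow]
  rw [integral_const_mul, inv_pow, Real.sq_sqrt hpos.le, inv_mul_cancel₀ hpos.ne']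

theorem exists_formEnergy_lt {a b c : ℝ} (hab : a < b) {V : ℝ → ℝ}
    (hc : groundEnergy a b V < c) :
    ∃ f g, IsTrial a b f g ∧ ∫ x, f x ^ 2 = 1 ∧ formEnergy V f g < c := by
  obtain ⟨f₀, g₀, h₀, h₁⟩ := exists_isTrial hab
  have hne : {e | ∃ f g, IsTrial a b f g ∧ ∫ x, f x ^ 2 = 1 ∧ formEnergy V f g = e}.Nonempty :=
    ⟨_, f₀, g₀, h₀, h₁, rfl⟩
  obtain ⟨e, ⟨f, g, h, h1, rfl⟩, he⟩ := exists_lt_of_csInf_lt hne hc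
  exact ⟨f, g, h, h1, he⟩

theorem le_groundEnergy {a b c : ℝ} (hab : a < b) {V : ℝ → ℝ}
    (h : ∀ f g, IsTrial a b f g → ∫ x, f x ^ 2 = 1 → c ≤ formEnergy V f g) :
    c ≤ groundEnergy a b V := by
  obtain ⟨f₀, g₀, h₀, h₁⟩ := exists_isTrial hab
  refine le_csInf ⟨_, f₀, g₀, h₀, h₁, rfl⟩ ?_
  rintro e ⟨f, g, h2, h3, rfl⟩
  exact h f g h2 h3

theorem groundEnergy_anti {a b a' b' : ℝ} (hab : a < b) (ha : a' ≤ a) (hb : b ≤ b') {V : ℝ → ℝ}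
    (hV : IsPot V) : groundEnergy a' b' V ≤ groundEnergy a b V := by
  refine le_groundEnergy hab fun f g h h1 => ?_
  have := groundEnergy_mul_le hV (h.mono ha hb)
  rwa [h1, mul_one] at this

theorem formEnergy_congr {a b : ℝ} {V V' f g : ℝ → ℝ} (h : IsTrial a b f g)
    (hV : ∀ x ∈ Ioo a b, V x = V' x) : formEnergy V f g = formEnergy V' f g := by
  unfold formEnergy
  congr 2
  funext x
  by_cases hx : x ∈ Ioo a b
  · rw [hV x hx]
  · simp [h.f_zero x hx]

theorem groundEnergy_congr {a b : ℝ} {V V' : ℝ → ℝ} (hV : ∀ x ∈ Ioo a b, V x = V' x) :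
    groundEnergy a b V = groundEnergy a b V' := by
  unfold groundEnergy
  congr 1
  ext e
  constructor
  · rintro ⟨f, g, h, h1, rfl⟩
    exact ⟨f, g, h, h1, (formEnergy_congr h hV).symm⟩
  · rintro ⟨f, g, h, h1, rfl⟩
    exact ⟨f, g, h, h1, formEnergy_congr h hV⟩

theorem groundEnergy_translate_le {a b : ℝ} (V : ℝ → ℝ) (t : ℝ) :
    {e | ∃ f g, IsTrial a b f g ∧ ∫ x, f x ^ 2 = 1 ∧ formEnergy V f g = e} ⊆
    {e | ∃ f g, IsTrial (a + t) (b + t) f g ∧ ∫ x, f x ^ 2 = 1 ∧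
      formEnergy (fun x => V (x - t)) f g = e} := by
  rintro e ⟨f, g, h, h1, rfl⟩
  refine ⟨_, _, h.translate t, ?_, ?_⟩
  · rw [integral_sub_right_eq_self (fun x => f x ^ 2) t, h1]
  · unfold formEnergy
    rw [integral_sub_right_eq_self (fun x => g x ^ 2) t,
      integral_sub_right_eq_self (fun x => V x * f x ^ 2) t]

theorem groundEnergy_translate (a b : ℝ) (V : ℝ → ℝ) (t : ℝ) :
    groundEnergy (a + t) (b + t) (fun x => V (x - t)) = groundEnergy a b V := by
  unfold groundEnergy
  congr 1
  refine Subset.antisymm ?_ (groundEnergy_translate_le V t)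
  have := groundEnergy_translate_le (a := a + t) (b := b + t) (fun x => V (x - t)) (-t)
  simpa using this

/-- The stretching `f ↦ f̃` of a trial function by an interval of length `t` inserted at `x₀`, on
which `f̃` is constant. It changes neither `∫ |f'|²` nor, if the potential is stretched alike and
vanishes on the inserted interval, `∫ V |f|²`, but it raises `∫ |f|²` by `t f(x₀)²`. -/
theorem IsTrial.stretch {a b : ℝ} {f g V W : ℝ → ℝ} (h : IsTrial a b f g) {x₀ t : ℝ}
    (ht : 0 ≤ t) (hV : IsPot V) (hl : ∀ x ≤ x₀, W x = V x)
    (hm : ∀ x ∈ Ioc x₀ (x₀ + t), W x = 0) (hr : ∀ x, x₀ + t < x → W x = V (x - t)) :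
    ∃ f' g', IsTrial a (b + t) f' g' ∧ (∫ x, f' x ^ 2) = (∫ x, f x ^ 2) + t * f x₀ ^ 2 ∧
      formEnergy W f' g' = formEnergy V f g := by
  -- `glue p c` is `p` to the left of `x₀`, `c` on the inserted interval, and `p` shifted after it
  set glue : (ℝ → ℝ) → ℝ → ℝ → ℝ := fun p c x =>
    (Iic x₀).indicator p x + (Ioc x₀ (x₀ + t)).indicator (fun _ => c) x +
      (Ioi x₀).indicator p (x - t) with hglue
  have hgl : ∀ p c x, x ≤ x₀ → glue p c x = p x := by
    intro p c x hx
    simp only [hglue]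
    rw [indicator_of_mem (show x ∈ Iic x₀ from hx), indicator_of_notMem (fun h' => by
      linarith [h'.1]), indicator_of_notMem (fun h' => by have : x₀ < x - t := h'; linarith)]
    ring
  have hgm : ∀ p c x, x ∈ Ioc x₀ (x₀ + t) → glue p c x = c := by
    intro p c x hx
    simp only [hglue]
    rw [indicator_of_notMem (fun h' => by have : x ≤ x₀ := h'; linarith [hx.1]),
      indicator_of_mem hx, indicator_of_notMem (fun h' => by
        have : x₀ < x - t := h'; linarith [hx.2])]
    ring
  have hgr : ∀ p c x, x₀ + t < x → glue p c x = p (x - t) := by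
    intro p c x hx
    simp only [hglue]
    rw [indicator_of_notMem (fun h' => by have : x ≤ x₀ := h'; linarith),
      indicator_of_notMem (fun h' => by linarith [h'.2]),
      indicator_of_mem (show x - t ∈ Ioi x₀ by show x₀ < x - t; linarith)]
    ring
  have cases : ∀ x, x ≤ x₀ ∨ x ∈ Ioc x₀ (x₀ + t) ∨ x₀ + t < x := by
    intro x
    rcases le_or_gt x x₀ with h1 | h1
    · exact Or.inl h1
    rcases le_or_gt x (x₀ + t) with h2 | h2
    · exact Or.inr (Or.inl ⟨h1, h2⟩)
    · exact Or.inr (Or.inr h2)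
  have hint : ∀ p c, Integrable p → ∫ x, glue p c x = (∫ x, p x) + t * c := by
    intro p c hp
    have i1 : Integrable ((Iic x₀).indicator p) := hp.indicator measurableSet_Iic
    have i2 : Integrable ((Ioc x₀ (x₀ + t)).indicator (fun _ => c)) :=
      (integrable_indicator_iff measurableSet_Ioc).2 (integrableOn_const (by simp))
    have i3 : Integrable (fun x => (Ioi x₀).indicator p (x - t)) :=
      (hp.indicator measurableSet_Ioi).comp_sub_right t
    simp only [hglue]
    have e1 := integral_add (i1.add i2) i3
    simp only [Pi.add_apply] at e1
    rw [e1, integral_add i1 i2,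
      integral_sub_right_eq_self ((Ioi x₀).indicator p) t, integral_indicator measurableSet_Iic,
      integral_indicator measurableSet_Ioi, integral_indicator measurableSet_Ioc,
      setIntegral_const, ← intervalIntegral.integral_Iic_add_Ioi hp.integrableOn hp.integrableOn]
    simp only [Measure.real, Real.volume_Ioc, smul_eq_mul]
    rw [ENNReal.toReal_ofReal (by linarith)]
    ring
  have hintg : ∀ p c, Integrable p → Integrable (glue p c) := by
    intro p c hp
    exact ((hp.indicator measurableSet_Iic).add
      ((integrable_indicator_iff measurableSet_Ioc).2 (integrableOn_const (by simp)))).add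
      ((hp.indicator measurableSet_Ioi).comp_sub_right t)
  refine ⟨glue f (f x₀), glue g 0, ⟨?_, ?_, ?_, ?_⟩, ?_, ?_⟩
  · refine ((h.memLp.indicator measurableSet_Iic).add
      (memLp_indicator_const 2 measurableSet_Ioc 0 (by simp))).add ?_
    exact (h.memLp.indicator measurableSet_Ioi).comp_measurePreserving
      (measurePreserving_sub_right volume t)
  · intro x hx
    rcases cases x with h1 | h1 | h1
    · rw [hgl _ _ _ h1]
      exact h.f_zero x fun h' => hx ⟨h'.1, h'.2.trans_le (by linarith)⟩
    · rw [hgm _ _ _ h1]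
      refine h.f_zero x₀ fun h' => hx ⟨h'.1.trans h1.1, ?_⟩
      linarith [h1.2, h'.2]
    · rw [hgr _ _ _ h1]
      exact h.f_zero _ fun h' => hx ⟨by linarith [h'.1], by linarith [h'.2]⟩
  · intro x hx
    rcases cases x with h1 | h1 | h1
    · rw [hgl _ _ _ h1]
      exact h.g_zero x fun h' => hx ⟨h'.1, h'.2.trans_le (by linarith)⟩
    · rw [hgm _ _ _ h1]
    · rw [hgr _ _ _ h1]
      exact h.g_zero _ fun h' => hx ⟨by linarith [h'.1], by linarith [h'.2]⟩
  · have hG := hintg g 0 h.integrable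
    have hl' : ∀ x ≤ x₀, ∫ s in x₀..x, glue g 0 s = ∫ s in x₀..x, g s := by
      intro x hx
      apply intervalIntegral.integral_congr_ae
      filter_upwards with s hs
      rw [uIoc_of_ge hx] at hs
      exact hgl _ _ _ hs.2
    have hm' : ∀ x ∈ Icc x₀ (x₀ + t), ∫ s in x₀..x, glue g 0 s = 0 := by
      intro x hx
      rw [intervalIntegral.integral_congr_ae (g := fun _ => (0 : ℝ)), intervalIntegral.integral_zero]
      filter_upwards with s hs
      rw [uIoc_of_le hx.1] at hs
      exact hgm _ _ _ ⟨hs.1, hs.2.trans hx.2⟩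
    have key : ∀ x, glue f (f x₀) x = f x₀ + ∫ s in x₀..x, glue g 0 s := by
      intro x
      rcases cases x with h1 | h1 | h1
      · rw [hgl _ _ _ h1, hl' _ h1, ← h.ftc]; ring
      · rw [hgm _ _ _ h1, hm' _ ⟨h1.1.le, h1.2⟩, add_zero]
      · rw [hgr _ _ _ h1, ← intervalIntegral.integral_add_adjacent_intervals
          (b := x₀ + t) hG.intervalIntegrable hG.intervalIntegrable,
          hm' _ ⟨by linarith, le_rfl⟩, zero_add,
          intervalIntegral.integral_congr_ae (g := fun s => g (s - t))]
        · rw [intervalIntegral.integral_comp_sub_right, ← h.ftc]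
          simp
        · filter_upwards with s hs
          rw [uIoc_of_le h1.le] at hs
          exact hgr _ _ _ hs.1
    intro x y
    rw [key, key, add_sub_add_left_eq_sub, intervalIntegral.integral_interval_sub_left
      hG.intervalIntegrable hG.intervalIntegrable]
  · rw [← hint _ _ h.integrable_f_sq]
    congr 1
    funext x
    rcases cases x with h1 | h1 | h1
    · rw [hgl _ _ _ h1, hgl _ _ _ h1]
    · rw [hgm _ _ _ h1, hgm _ _ _ h1]
    · rw [hgr _ _ _ h1, hgr _ _ _ h1]
  · unfold formEnergy
    congr 1
    · rw [← add_zero (∫ x, g x ^ 2), ← mul_zero t, ← hint _ _ h.integrable_sq]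
      congr 1
      funext x
      rcases cases x with h1 | h1 | h1
      · rw [hgl _ _ _ h1, hgl _ _ _ h1]
      · rw [hgm _ _ _ h1, hgm _ _ _ h1]; ring
      · rw [hgr _ _ _ h1, hgr _ _ _ h1]
    · rw [← add_zero (∫ x, V x * f x ^ 2), ← mul_zero t, ← hint _ _ (h.integrable_pot hV)]
      congr 1
      funext x
      rcases cases x with h1 | h1 | h1
      · rw [hgl _ _ _ h1, hgl _ _ _ h1, hl x h1]
      · rw [hgm _ _ _ h1, hgm _ _ _ h1, hm x h1]; ring
      · rw [hgr _ _ _ h1, hgr _ _ _ h1, hr x h1]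

/-! ### The Sobolev space as a space of primitives -/

theorem measurableSet_box (L : ℝ) : MeasurableSet (box L) := measurableSet_Ioo

instance isFiniteMeasure_box (L : ℝ) : IsFiniteMeasure (volume.restrict (box L)) :=
  ⟨by rw [Measure.restrict_apply_univ]; exact measure_Ioo_lt_top⟩

theorem Lp_coeFn_finset_sum {α : Type*} [MeasurableSpace α] {μ : Measure α} {ι : Type*}
    (s : Finset ι) (F : ι → Lp ℂ 2 μ) :
    (∑ i ∈ s, F i : Lp ℂ 2 μ) =ᵐ[μ] fun x => ∑ i ∈ s, F i x := by
  classical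
  induction s using Finset.induction_on with
  | empty =>
    simp only [Finset.sum_empty]
    exact Lp.coeFn_zero _ _ _
  | insert i s hi ih =>
    rw [Finset.sum_insert hi]
    filter_upwards [Lp.coeFn_add (F i) (∑ i ∈ s, F i), ih] with x h1 h2
    rw [h1, Pi.add_apply, h2, Finset.sum_insert hi]

/-- The integral of an element of `L²(Λ)` over an interval `(y, z]`. -/
noncomputable def intOver (L y z : ℝ) : L2 L →L[ℂ] ℂ :=
  innerSL ℂ (indicatorConstLp 2 (measurableSet_Ioc (a := y) (b := z))
    (measure_ne_top (volume.restrict (box L)) _) (1 : ℂ) : L2 L)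

theorem intOver_apply (L y z : ℝ) (G : L2 L) :
    intOver L y z G = ∫ x in Ioc y z, G x ∂(volume.restrict (box L)) :=
  L2.inner_indicatorConstLp_one _ _ _

theorem norm_intOver_le (L : ℝ) {y z : ℝ} (h : y ≤ z) (G : L2 L) :
    ‖intOver L y z G‖ ≤ Real.sqrt (z - y) * ‖G‖ := by
  refine (norm_inner_le_norm (𝕜 := ℂ) (E := L2 L) _ _).trans ?_
  gcongr
  rw [norm_indicatorConstLp (by norm_num) (by norm_num), norm_one, one_mul, Real.sqrt_eq_rpow]
  simp only [ENNReal.toReal_ofNat]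
  refine Real.rpow_le_rpow measureReal_nonneg ?_ (by norm_num)
  rw [← Real.volume_real_Ioc_of_le h]
  exact ENNReal.toReal_mono (by simp) (Measure.restrict_apply_le _ _)

theorem intOver_add (L : ℝ) {x y z : ℝ} (h : x ≤ y) (h' : y ≤ z) (G : L2 L) :
    intOver L x y G + intOver L y z G = intOver L x z G := by
  have hG : Integrable G (volume.restrict (box L)) := (Lp.memLp G).integrable (by norm_num)
  rw [intOver_apply, intOver_apply, intOver_apply, ← Ioc_union_Ioc_eq_Ioc h h',
    setIntegral_union (Set.disjoint_left.2 fun t ht ht' => not_lt.2 ht.2 ht'.1) measurableSet_Ioc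
      hG.integrableOn hG.integrableOn]

theorem continuous_intOver (L : ℝ) (G : L2 L) :
    Continuous fun z => ∫ t in (-L / 2)..z, G t ∂(volume.restrict (box L)) :=
  intervalIntegral.continuous_primitive
    (fun _ _ => ((Lp.memLp G).integrable (by norm_num)).intervalIntegrable) _

theorem intOver_eq_interval (L : ℝ) {z : ℝ} (hz : -L / 2 ≤ z) (G : L2 L) :
    intOver L (-L / 2) z G = ∫ t in (-L / 2)..z, G t ∂(volume.restrict (box L)) := by
  rw [intOver_apply, intervalIntegral.integral_of_le hz]

theorem memLp_intOver (L : ℝ) (G : L2 L) :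
    MemLp (fun z => intOver L (-L / 2) z G) 2 (volume.restrict (box L)) := by
  refine MemLp.of_bound ?_ (Real.sqrt L * ‖G‖) ?_
  · refine (continuous_intOver L G).aestronglyMeasurable.congr ?_
    filter_upwards [ae_restrict_mem (measurableSet_box L)] with z hz
    exact (intOver_eq_interval L hz.1.le G).symm
  · filter_upwards [ae_restrict_mem (measurableSet_box L)] with z hz
    refine (norm_intOver_le L hz.1.le G).trans ?_
    gcongr
    linarith [hz.2]

/-- The Volterra operator `G ↦ ∫_{-L/2}^x G` on `L²(Λ)`. -/
noncomputable def primOp (L : ℝ) : L2 L →L[ℂ] L2 L :=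
  LinearMap.mkContinuous
    { toFun := fun G => (memLp_intOver L G).toLp _
      map_add' := fun G G' => by
        rw [← MemLp.toLp_add]
        refine MemLp.toLp_congr _ _ (ae_of_all _ fun z => ?_)
        simp
      map_smul' := fun c G => by
        rw [RingHom.id_apply, ← MemLp.toLp_const_smul]
        refine MemLp.toLp_congr _ _ (ae_of_all _ fun z => ?_)
        simp }
    ((measureUnivNNReal (volume.restrict (box L)) : ℝ) ^ (2 : ENNReal).toReal⁻¹ * Real.sqrt L)
    fun G => by
      rw [mul_assoc]
      refine Lp.norm_le_of_ae_bound (by positivity) ?_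
      filter_upwards [MemLp.coeFn_toLp (memLp_intOver L G),
        ae_restrict_mem (measurableSet_box L)] with z h hz
      simp only [LinearMap.coe_mk, AddHom.coe_mk]
      rw [h]
      refine (norm_intOver_le L hz.1.le G).trans ?_
      gcongr
      linarith [hz.2]

theorem primOp_coe (L : ℝ) (G : L2 L) :
    primOp L G =ᵐ[volume.restrict (box L)] fun z => intOver L (-L / 2) z G :=
  MemLp.coeFn_toLp (memLp_intOver L G)

/-- The Volterra operator is a norm limit of operators of finite rank. -/
theorem isCompactOperator_primOp {L : ℝ} (hL : 0 < L) : IsCompactOperator (primOp L) := by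
  set x : ℕ → ℕ → ℝ := fun n i => -L / 2 + i * (L / n) with hx
  set F : ℕ → L2 L →L[ℂ] L2 L := fun n => ∑ i ∈ Finset.range n,
    (intOver L (-L / 2) (x n i)).smulRight (indicatorConstLp 2
      (measurableSet_Ico (a := x n i) (b := x n (i + 1)))
      (measure_ne_top (volume.restrict (box L)) _) (1 : ℂ)) with hF
  refine isCompactOperator_of_tendsto (l := atTop) (F := F) ?_ (Eventually.of_forall fun n => ?_)
  · rw [tendsto_iff_norm_sub_tendsto_zero]
    set K := (measureUnivNNReal (volume.restrict (box L)) : ℝ) ^ (2 : ENNReal).toReal⁻¹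
    have hlim : Tendsto (fun n : ℕ => K * Real.sqrt (L / n)) atTop (𝓝 0) := by
      have h1 : Tendsto (fun n : ℕ => L / (n : ℝ)) atTop (𝓝 0) :=
        tendsto_const_div_atTop_nhds_zero_nat L
      have := (Real.continuous_sqrt.tendsto 0).comp h1
      rw [Real.sqrt_zero] at this
      simpa using this.const_mul K
    refine squeeze_zero' (Eventually.of_forall fun n => norm_nonneg _) ?_ hlim
    filter_upwards [eventually_gt_atTop 0] with n hn
    have hn' : (0 : ℝ) < n := by exact_mod_cast hn
    have hr : 0 < L / n := by positivity
    refine ContinuousLinearMap.opNorm_le_bound _ (by positivity) fun G => ?_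
    rw [mul_assoc, sub_apply]
    refine Lp.norm_le_of_ae_bound (by positivity) ?_
    have hsum : (F n G : L2 L) =ᵐ[volume.restrict (box L)] fun z => ∑ i ∈ Finset.range n,
        intOver L (-L / 2) (x n i) G * (Ico (x n i) (x n (i + 1))).indicator (fun _ => (1 : ℂ)) z := by
      have e : F n G = ∑ i ∈ Finset.range n, intOver L (-L / 2) (x n i) G •
          (indicatorConstLp 2 (measurableSet_Ico (a := x n i) (b := x n (i + 1)))
          (measure_ne_top (volume.restrict (box L)) _) (1 : ℂ)) := by
        simp only [hF, sum_apply, ContinuousLinearMap.smulRight_apply]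
      rw [e]
      have h2 : ∀ i ∈ Finset.range n, ∀ᵐ z ∂(volume.restrict (box L)),
          (intOver L (-L / 2) (x n i) G • (indicatorConstLp 2
            (measurableSet_Ico (a := x n i) (b := x n (i + 1)))
            (measure_ne_top (volume.restrict (box L)) _) (1 : ℂ)) : L2 L) z =
          intOver L (-L / 2) (x n i) G *
            (Ico (x n i) (x n (i + 1))).indicator (fun _ => (1 : ℂ)) z := by
        intro i _
        filter_upwards [Lp.coeFn_smul (intOver L (-L / 2) (x n i) G) (indicatorConstLp 2
            (measurableSet_Ico (a := x n i) (b := x n (i + 1)))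
            (measure_ne_top (volume.restrict (box L)) _) (1 : ℂ)),
          indicatorConstLp_coeFn (p := 2)
            (hs := measurableSet_Ico (a := x n i) (b := x n (i + 1)))
            (hμs := measure_ne_top (volume.restrict (box L)) _) (c := (1 : ℂ))] with z h3 h4
        rw [h3, Pi.smul_apply, h4, smul_eq_mul]
      have h5 := (ae_ball_iff (Finset.range n).countable_toSet).2 h2
      filter_upwards [Lp_coeFn_finset_sum (Finset.range n) _, h5] with z h6 h7
      rw [h6]
      exact Finset.sum_congr rfl fun i hi => h7 i hi
    filter_upwards [Lp.coeFn_sub (F n G) (primOp L G), hsum, primOp_coe L G,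
      ae_restrict_mem (measurableSet_box L)] with z h1 h2 h3 hz
    rw [h1, Pi.sub_apply, h2, h3]
    -- the node to the left of `z`
    set j := ⌊(z + L / 2) / (L / n)⌋₊ with hj
    have hz0 : 0 ≤ (z + L / 2) / (L / n) := div_nonneg (by linarith [hz.1]) hr.le
    have hj1 : (j : ℝ) * (L / n) ≤ z + L / 2 := by
      have := Nat.floor_le hz0
      rwa [← hj, le_div_iff₀ hr] at this
    have hj2 : z + L / 2 < (j + 1 : ℝ) * (L / n) := by
      have := Nat.lt_floor_add_one ((z + L / 2) / (L / n))
      rwa [← hj, div_lt_iff₀ hr] at this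
    have hjn : j < n := by
      have : (j : ℝ) * (L / n) < n * (L / n) := by
        have : (n : ℝ) * (L / n) = L := by field_simp
        linarith [hz.2]
      exact_mod_cast lt_of_mul_lt_mul_right this hr.le
    have hmem : z ∈ Ico (x n j) (x n (j + 1)) := by
      simp only [hx, mem_Ico]; push_cast; constructor <;> linarith
    rw [Finset.sum_eq_single j]
    · rw [indicator_of_mem hmem, mul_one,
        ← intOver_add L (y := x n j) (by simp only [hx]; nlinarith [mul_nonneg j.cast_nonneg hr.le])
          hmem.1, sub_add_cancel_left, norm_neg]
      refine (norm_intOver_le L hmem.1 G).trans ?_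
      gcongr
      have := hmem.2
      simp only [hx] at this ⊢
      push_cast at this
      linarith
    · intro i _ hij
      rw [indicator_of_notMem, mul_zero]
      intro hi
      simp only [hx, mem_Ico] at hi
      push_cast at hi
      apply hij
      have a1 : (i : ℝ) < j + 1 := lt_of_mul_lt_mul_right
        (show (i : ℝ) * (L / n) < (j + 1) * (L / n) by linarith [hi.1]) hr.le
      have a2 : (j : ℝ) < i + 1 := lt_of_mul_lt_mul_right
        (show (j : ℝ) * (L / n) < (i + 1) * (L / n) by linarith [hi.2]) hr.le
      have a3 : i < j + 1 := by exact_mod_cast a1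
      have a4 : j < i + 1 := by exact_mod_cast a2
      omega
    · intro h
      exact absurd (Finset.mem_range.2 hjn) h
  · have h : ∀ i, IsCompactOperator ((intOver L (-L / 2) (x n i)).smulRight (indicatorConstLp 2
        (measurableSet_Ico (a := x n i) (b := x n (i + 1)))
        (measure_ne_top (volume.restrict (box L)) _) (1 : ℂ)) : L2 L →L[ℂ] L2 L) := fun i =>
      (isCompactOperator_of_locallyCompactSpace_rng (ContinuousLinearMap.toSpanSingleton ℂ
        (indicatorConstLp 2 (measurableSet_Ico (a := x n i) (b := x n (i + 1)))
        (measure_ne_top (volume.restrict (box L)) _) (1 : ℂ)))).comp_clm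
        (intOver L (-L / 2) (x n i))
    simp only [hF]
    exact Submodule.sum_mem (compactOperator (RingHom.id ℂ) (L2 L) (L2 L)) fun i _ => h i

/-! ### Density of the test functions -/

/-- The classes of test functions in `L²(Λ)`. -/
noncomputable def testSpace (L : ℝ) : Submodule ℂ (L2 L) := (testGraph L).map (LinearMap.fst ℂ _ _)

theorem IsTest.memLp {L : ℝ} {φ : ℝ → ℂ} (h : IsTest L φ) :
    MemLp φ 2 (volume.restrict (box L)) :=
  (h.1.continuous.memLp_of_hasCompactSupport h.2.1).restrict _

theorem IsTest.isTest_deriv {L : ℝ} {φ : ℝ → ℂ} (h : IsTest L φ) : IsTest L (deriv φ) :=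
  ⟨(contDiff_infty_iff_deriv.1 h.1).2, h.2.1.deriv,
    (closure_minimal support_deriv_subset (isClosed_tsupport φ)).trans h.2.2⟩

theorem IsTest.mem_testGraph {L : ℝ} {φ : ℝ → ℂ} (h : IsTest L φ) :
    ((h.memLp.toLp φ, h.isTest_deriv.memLp.toLp (deriv φ)) : L2 L × L2 L) ∈ testGraph L :=
  ⟨φ, h, MemLp.coeFn_toLp h.memLp, MemLp.coeFn_toLp h.isTest_deriv.memLp⟩

theorem IsTest.eq_zero {L : ℝ} {φ : ℝ → ℂ} (h : IsTest L φ) {x : ℝ} (hx : x ∉ box L) :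
    φ x = 0 := image_eq_zero_of_notMem_tsupport fun h' => hx (h.2.2 h')

theorem testSpace_closure (L : ℝ) : (testSpace L).topologicalClosure = ⊤ := by
  rw [Submodule.topologicalClosure_eq_top_iff, Submodule.eq_bot_iff]
  intro h hh
  rw [Submodule.mem_orthogonal] at hh
  have hint : LocallyIntegrableOn h (box L) volume :=
    IntegrableOn.locallyIntegrableOn ((Lp.memLp h).integrable (by norm_num))
  have := isOpen_Ioo.ae_eq_zero_of_integral_contDiff_smul_eq_zero (U := box L) hint ?_
  · rw [Lp.eq_zero_iff_ae_eq_zero]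
    exact (ae_restrict_iff' (measurableSet_box L)).2 this
  · intro η h1 h2 h3
    have ht : IsTest L fun x => ((η x : ℝ) : ℂ) := by
      refine ⟨Complex.ofRealCLM.contDiff.comp h1, h2.comp_left (g := Complex.ofReal) rfl, ?_⟩
      refine (closure_mono ?_).trans h3
      intro x hx
      simpa using hx
    have h4 := hh _ ⟨_, ht.mem_testGraph, rfl⟩
    rw [L2.inner_def] at h4
    rw [← setIntegral_eq_integral_of_forall_compl_eq_zero (s := box L), ← h4]
    · apply integral_congr_ae
      filter_upwards [MemLp.coeFn_toLp ht.memLp] with x hx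
      simp only [LinearMap.fst_apply]
      rw [hx]
      simp [mul_comm]
    · intro x hx
      rw [image_eq_zero_of_notMem_tsupport (fun h' => hx (h3 h')), zero_smul]

theorem exists_Icc_of_isCompact_subset_Ioo {a b : ℝ} (hab : a < b) {K : Set ℝ} (hK : IsCompact K)
    (h : K ⊆ Ioo a b) : ∃ α β, a < α ∧ β < b ∧ K ⊆ Icc α β := by
  rcases K.eq_empty_or_nonempty with rfl | hne
  · exact ⟨b, a, hab, hab, by simp⟩
  · obtain ⟨α, hα⟩ := hK.exists_isLeast hne
    obtain ⟨β, hβ⟩ := hK.exists_isGreatest hne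
    exact ⟨α, β, (h hα.1).1, (h hβ.1).2, fun x hx => ⟨hα.2 hx, hβ.2 hx⟩⟩

theorem IsTest.intOver_toLp {L : ℝ} {φ : ℝ → ℂ} (h : IsTest L φ) :
    intOver L (-L / 2) (L / 2) (h.memLp.toLp φ) = ∫ x, φ x := by
  rw [intOver_apply, Measure.restrict_restrict measurableSet_Ioc,
    ← setIntegral_eq_integral_of_forall_compl_eq_zero (s := box L) fun x hx => h.eq_zero hx,
    inter_eq_right.2 (show box L ⊆ Ioc (-L / 2) (L / 2) from Ioo_subset_Ioc_self)]
  exact integral_congr_ae (MemLp.coeFn_toLp h.memLp)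

/-- The primitive of a test function of mean zero is a test function. -/
theorem IsTest.primOp_mem {L : ℝ} {ψ : ℝ → ℂ} (h : IsTest L ψ) (hL : 0 < L)
    (h0 : intOver L (-L / 2) (L / 2) (h.memLp.toLp ψ) = 0) :
    (primOp L (h.memLp.toLp ψ), h.memLp.toLp ψ) ∈ testGraph L := by
  set Ψ : ℝ → ℂ := fun x => ∫ t in (-L / 2)..x, ψ t with hΨ
  have hc : Continuous ψ := h.1.continuous
  have hd : ∀ x, HasDerivAt Ψ (ψ x) x := fun x =>
    intervalIntegral.integral_hasDerivAt_right (hc.intervalIntegrable _ _)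
      (hc.stronglyMeasurableAtFilter _ _) hc.continuousAt
  have hderiv : deriv Ψ = ψ := funext fun x => (hd x).deriv
  obtain ⟨α, β, hα, hβ, hs⟩ := exists_Icc_of_isCompact_subset_Ioo (by linarith) h.2.1 h.2.2
  have hout : ∀ x, x ∉ Icc α β → ψ x = 0 := fun x hx =>
    image_eq_zero_of_notMem_tsupport fun h' => hx (hs h')
  have hzero : ∀ x y, (∀ t ∈ uIoc x y, t ∉ Icc α β) → ∫ t in x..y, ψ t = 0 := by
    intro x y hxy
    rw [intervalIntegral.integral_congr_ae (g := fun _ => (0 : ℂ)), intervalIntegral.integral_zero]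
    exact ae_of_all _ fun t ht => hout t (hxy t ht)
  have htot : ∫ t in (-L / 2)..(L / 2), ψ t = 0 := by
    rw [h.intOver_toLp] at h0
    rw [← h0, intervalIntegral.integral_of_le (by linarith)]
    exact setIntegral_eq_integral_of_forall_compl_eq_zero fun x hx =>
      h.eq_zero fun h' => hx (Ioo_subset_Ioc_self h')
  have hsupp : ∀ x, x ∉ Icc α β → Ψ x = 0 := by
    intro x hx
    rw [mem_Icc, not_and_or, not_le, not_le] at hx
    rcases hx with hx | hx
    · refine hzero _ _ fun t ht h' => ?_
      have : t ≤ max (-L / 2) x := ht.2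
      rcases le_max_iff.1 this with h1 | h1 <;> linarith [h'.1]
    · have e : Ψ x = (∫ t in (-L / 2)..(L / 2), ψ t) + ∫ t in (L / 2)..x, ψ t :=
        (intervalIntegral.integral_add_adjacent_intervals (hc.intervalIntegrable _ _)
          (hc.intervalIntegrable _ _)).symm
      rw [e, htot, zero_add]
      refine hzero _ _ fun t ht h' => ?_
      have : min (L / 2) x < t := ht.1
      rcases min_lt_iff.1 this with h1 | h1 <;> linarith [h'.2]
  have hts : tsupport Ψ ⊆ Icc α β :=
    closure_minimal (fun x hx => by_contra fun h' => hx (hsupp x h')) isClosed_Icc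
  have hΨt : IsTest L Ψ := by
    refine ⟨contDiff_infty_iff_deriv.2 ⟨fun x => (hd x).differentiableAt, by rw [hderiv]; exact h.1⟩,
      isCompact_Icc.of_isClosed_subset (isClosed_tsupport _) hts, hts.trans fun x hx => ?_⟩
    exact ⟨hα.trans_le hx.1, hx.2.trans_lt hβ⟩
  refine ⟨Ψ, hΨt, ?_, by rw [hderiv]; exact MemLp.coeFn_toLp h.memLp⟩
  filter_upwards [primOp_coe L (h.memLp.toLp ψ), ae_restrict_mem (measurableSet_box L)] with x hx hxb
  rw [hx, intOver_apply, Measure.restrict_restrict measurableSet_Ioc, hΨ]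
  simp only
  have hsub : Ioc (-L / 2) x ⊆ box L := fun t ht => ⟨ht.1, ht.2.trans_lt hxb.2⟩
  rw [intervalIntegral.integral_of_le hxb.1.le, inter_eq_left.2 hsub]
  exact integral_congr_ae (ae_restrict_of_ae_restrict_of_subset hsub (MemLp.coeFn_toLp h.memLp))

/-- The weak derivatives of elements of `H¹₀(Λ)` are the elements of `L²(Λ)` of mean zero. -/
theorem primOp_mem_H10 {L : ℝ} (hL : 0 < L) {G : L2 L} (hG : intOver L (-L / 2) (L / 2) G = 0) :
    (primOp L G, G) ∈ H10 L := by
  -- a normalized bump, used to correct the mean of a test function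
  let β : ContDiffBump (0 : ℝ) := ⟨L / 8, L / 4, by positivity, by linarith⟩
  set η : ℝ → ℂ := fun x => ((β.normed volume x : ℝ) : ℂ) with hη
  have hηsupp : tsupport η ⊆ Metric.closedBall 0 (L / 4) := by
    have : tsupport (β.normed volume) = Metric.closedBall 0 (L / 4) := β.tsupport_normed_eq
    rw [← this]
    refine closure_mono fun x hx => ?_
    simpa [hη] using hx
  have hηt : IsTest L η := by
    refine ⟨Complex.ofRealCLM.contDiff.comp β.contDiff_normed,
      (isCompact_closedBall (0 : ℝ) (L / 4)).of_isClosed_subset (isClosed_tsupport η) hηsupp,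
      hηsupp.trans ?_⟩
    intro x hx
    rw [Metric.mem_closedBall, Real.dist_eq, sub_zero, abs_le] at hx
    exact ⟨by linarith [hx.1], by linarith [hx.2]⟩
  have hη1 : intOver L (-L / 2) (L / 2) (hηt.memLp.toLp η) = 1 := by
    rw [hηt.intOver_toLp]
    have : ∫ x, η x = ((∫ x, β.normed volume x : ℝ) : ℂ) := integral_ofReal
    rw [this, β.integral_normed, Complex.ofReal_one]
  set K : L2 L → L2 L := fun G' => G' - intOver L (-L / 2) (L / 2) G' • hηt.memLp.toLp η with hK
  have hKc : Continuous K := by fun_prop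
  have hcont : Continuous fun G' => (primOp L (K G'), K G') :=
    ((primOp L).continuous.comp hKc).prodMk hKc
  have hG' : G ∈ closure (testSpace L : Set (L2 L)) := by
    rw [← Submodule.topologicalClosure_coe, testSpace_closure]; trivial
  have hmaps : MapsTo (fun G' => (primOp L (K G'), K G')) (testSpace L) (testGraph L) := by
    rintro _ ⟨p, ⟨φ, hφ, h1, -⟩, rfl⟩
    have e : (LinearMap.fst ℂ (L2 L) (L2 L)) p = hφ.memLp.toLp φ := by
      refine Lp.ext (h1.trans (MemLp.coeFn_toLp _).symm)
    rw [e]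
    set c := intOver L (-L / 2) (L / 2) (hφ.memLp.toLp φ) with hc
    have hψ : IsTest L (fun x => φ x - c * η x) := by
      refine ⟨hφ.1.sub (contDiff_const.mul hηt.1), hφ.2.1.sub hηt.2.1.mul_left, ?_⟩
      refine (tsupport_sub φ _).trans (union_subset hφ.2.2 ?_)
      exact (tsupport_mul_subset_right (f := fun _ => c) (g := η)).trans hηt.2.2
    have e2 : K (hφ.memLp.toLp φ) = hψ.memLp.toLp _ := by
      refine Lp.ext ?_
      filter_upwards [Lp.coeFn_sub (hφ.memLp.toLp φ) (c • hηt.memLp.toLp η),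
        Lp.coeFn_smul c (hηt.memLp.toLp η), MemLp.coeFn_toLp hφ.memLp,
        MemLp.coeFn_toLp hηt.memLp, MemLp.coeFn_toLp hψ.memLp] with x a1 a2 a3 a4 a5
      simp only [hK]
      rw [a1, Pi.sub_apply, a2, Pi.smul_apply, a3, a4, a5, smul_eq_mul]
    have h0 : intOver L (-L / 2) (L / 2) (K (hφ.memLp.toLp φ)) = 0 := by
      simp only [hK]
      rw [map_sub, map_smul, hη1, smul_eq_mul, mul_one, sub_self]
    simp only
    rw [e2] at h0 ⊢
    exact hψ.primOp_mem hL h0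
  have := map_mem_closure hcont hG' hmaps
  have hKG : K G = G := by simp only [hK]; rw [hG, zero_smul, sub_zero]
  simp only [hKG] at this
  exact this

/-- `H¹₀(Λ)` consists of the primitives of the elements of `L²(Λ)` of mean zero, so that membership needs
no approximation by test functions. -/
theorem mem_H10_iff_primOp {L : ℝ} (hL : 0 < L) {p : L2 L × L2 L} :
    p ∈ H10 L ↔ p.1 = primOp L p.2 ∧ intOver L (-L / 2) (L / 2) p.2 = 0 := by
  constructor
  · have hcl : IsClosed {p : L2 L × L2 L |
        p.1 = primOp L p.2 ∧ intOver L (-L / 2) (L / 2) p.2 = 0} :=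
      (isClosed_eq continuous_fst ((primOp L).continuous.comp continuous_snd)).inter
        (isClosed_eq ((intOver L _ _).continuous.comp continuous_snd) continuous_const)
    refine fun hp => closure_minimal (s := (testGraph L : Set (L2 L × L2 L))) ?_ hcl hp
    rintro q ⟨φ, hφ, h1, h2⟩
    have key : ∀ z ∈ Ioc (-L / 2) (L / 2), intOver L (-L / 2) z q.2 = φ z := by
      intro z hz
      have hd : ∀ x, HasDerivAt φ (deriv φ x) x := fun x =>
        (hφ.1.differentiable (by simp) x).hasDerivAt
      have := intervalIntegral.integral_eq_sub_of_hasDerivAt (a := -L / 2) (b := z)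
        (fun x _ => hd x) (hφ.isTest_deriv.1.continuous.intervalIntegrable _ _)
      rw [hφ.eq_zero (x := -L / 2) (fun h => lt_irrefl _ h.1), sub_zero] at this
      rw [← this, intervalIntegral.integral_of_le hz.1.le, intOver_apply,
        setIntegral_congr_ae (g := deriv φ) measurableSet_Ioc (h2.mono fun _ h _ => h),
        Measure.restrict_restrict measurableSet_Ioc]
      refine (setIntegral_eq_of_subset_of_forall_sdiff_eq_zero measurableSet_Ioc inter_subset_left
        ?_).symm
      intro x hx
      exact hφ.isTest_deriv.eq_zero fun h' => hx.2 ⟨hx.1, h'⟩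
    refine ⟨Lp.ext ?_, ?_⟩
    · filter_upwards [h1, primOp_coe L q.2, ae_restrict_mem (measurableSet_box L)] with z a1 a2 hz
      rw [a1, a2, key z ⟨hz.1, hz.2.le⟩]
    · rw [key _ ⟨by linarith, le_rfl⟩]
      exact hφ.eq_zero fun h => lt_irrefl _ h.2
  · rintro ⟨h1, h2⟩
    have : p = (primOp L p.2, p.2) := Prod.ext h1 rfl
    rw [this]
    exact primOp_mem_H10 hL h2

theorem isTrial_primitive {a b : ℝ} {g : ℝ → ℝ} (hg : MemLp g 2 volume)
    (h0 : ∀ x, x ∉ Ioo a b → g x = 0) (h1 : ∫ t in a..b, g t = 0) :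
    IsTrial a b (fun x => ∫ t in a..x, g t) g := by
  have hi : Integrable g := by
    have h1 : IntegrableOn g (Ioo a b) := (hg.restrict (Ioo a b)).integrable (by norm_num)
    exact h1.integrable_of_forall_notMem_eq_zero fun x hx => h0 x hx
  have hzero : ∀ x y, (∀ t ∈ uIoc x y, t ∉ Ioo a b) → ∫ t in x..y, g t = 0 := by
    intro x y hxy
    rw [intervalIntegral.integral_congr_ae (g := fun _ => (0 : ℝ)), intervalIntegral.integral_zero]
    exact ae_of_all _ fun t ht => h0 t (hxy t ht)
  refine ⟨hg, fun x hx => ?_, h0, fun x y => ?_⟩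
  · rw [mem_Ioo, not_and_or, not_lt, not_lt] at hx
    rcases hx with hx | hx
    · refine hzero _ _ fun t ht h' => ?_
      rw [uIoc_of_ge hx] at ht
      linarith [ht.2, h'.1]
    · rw [← intervalIntegral.integral_add_adjacent_intervals (b := b) hi.intervalIntegrable
        hi.intervalIntegrable, h1, zero_add]
      refine hzero _ _ fun t ht h' => ?_
      rw [uIoc_of_le hx] at ht
      linarith [ht.1, h'.2]
  · exact intervalIntegral.integral_interval_sub_left hi.intervalIntegrable hi.intervalIntegrable

/-- The real and imaginary parts of an element of `H¹₀(Λ)` are trial functions. -/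
theorem exists_isTrial_of_mem_H10 {L : ℝ} (hL : 0 < L) {p : L2 L × L2 L} (hp : p ∈ H10 L) :
    ∃ f₁ g₁ f₂ g₂, IsTrial (-L / 2) (L / 2) f₁ g₁ ∧ IsTrial (-L / 2) (L / 2) f₂ g₂ ∧
      (p.1 =ᵐ[volume.restrict (box L)] fun x => (f₁ x : ℂ) + f₂ x * Complex.I) ∧
      (p.2 =ᵐ[volume.restrict (box L)] fun x => (g₁ x : ℂ) + g₂ x * Complex.I) ∧
      ∀ y ∈ box L, (f₁ y : ℂ) + f₂ y * Complex.I = intOver L (-L / 2) y p.2 := by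
  obtain ⟨h1, h2⟩ := (mem_H10_iff_primOp hL).1 hp
  set G : ℝ → ℂ := (box L).indicator p.2 with hG
  have hGm : MemLp G 2 volume := (memLp_indicator_iff_restrict (measurableSet_box L)).2 (Lp.memLp _)
  have hGi : Integrable G := (integrable_indicator_iff (measurableSet_box L)).2
    ((Lp.memLp p.2).integrable (by norm_num))
  have hint : ∀ z, -L / 2 ≤ z → intOver L (-L / 2) z p.2 = ∫ t in (-L / 2)..z, G t := by
    intro z hz
    rw [intOver_apply, intervalIntegral.integral_of_le hz, hG,
      setIntegral_indicator (measurableSet_box L), Measure.restrict_restrict measurableSet_Ioc]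
  have hre : ∀ z, ∫ t in (-L / 2)..z, (G t).re = (∫ t in (-L / 2)..z, G t).re := fun z =>
    (Complex.reCLM.intervalIntegral_comp_comm hGi.intervalIntegrable)
  have him : ∀ z, ∫ t in (-L / 2)..z, (G t).im = (∫ t in (-L / 2)..z, G t).im := fun z =>
    (Complex.imCLM.intervalIntegral_comp_comm hGi.intervalIntegrable)
  have hG0 : ∀ x, x ∉ Ioo (-L / 2) (L / 2) → G x = 0 := fun x hx => indicator_of_notMem hx _
  have hval : ∀ z, -L / 2 ≤ z → ((∫ t in (-L / 2)..z, (G t).re : ℝ) : ℂ) +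
      (∫ t in (-L / 2)..z, (G t).im : ℝ) * Complex.I = intOver L (-L / 2) z p.2 := by
    intro z hz
    rw [hre, him, hint z hz, Complex.re_add_im]
  refine ⟨_, fun x => (G x).re, _, fun x => (G x).im,
    isTrial_primitive hGm.re (fun x hx => by simp [hG0 x hx]) ?_,
    isTrial_primitive hGm.im (fun x hx => by simp [hG0 x hx]) ?_, ?_, ?_, ?_⟩
  · rw [hre, ← hint _ (by linarith), h2, Complex.zero_re]
  · rw [him, ← hint _ (by linarith), h2, Complex.zero_im]
  · rw [h1]
    filter_upwards [primOp_coe L p.2, ae_restrict_mem (measurableSet_box L)] with z hz hzb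
    rw [hz, hval z hzb.1.le]
  · filter_upwards [ae_restrict_mem (measurableSet_box L)] with z hzb
    rw [Complex.re_add_im, hG, indicator_of_mem hzb]
  · exact fun y hy => hval y hy.1.le

theorem memLp_ofReal {f : ℝ → ℝ} (hf : MemLp f 2 volume) (L : ℝ) :
    MemLp (fun x => (f x : ℂ)) 2 (volume.restrict (box L)) :=
  (hf.ofReal (K := ℂ)).restrict _

theorem IsTrial.memLp_self {a b : ℝ} {f g : ℝ → ℝ} (h : IsTrial a b f g) : MemLp f 2 volume :=
  h.continuous.memLp_of_hasCompactSupport h.hasCompactSupport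

/-- A real trial function, with its weak derivative, belongs to `H¹₀(Λ)`. -/
theorem IsTrial.mem_H10 {L : ℝ} (hL : 0 < L) {f g : ℝ → ℝ} (h : IsTrial (-L / 2) (L / 2) f g) :
    (((memLp_ofReal h.memLp_self L).toLp _, (memLp_ofReal h.memLp L).toLp _) : L2 L × L2 L)
      ∈ H10 L := by
  have key : ∀ z ∈ Ioc (-L / 2) (L / 2),
      intOver L (-L / 2) z ((memLp_ofReal h.memLp L).toLp _) = (f z : ℂ) := by
    intro z hz
    have h0 := h.ftc (-L / 2) z
    rw [h.f_zero (-L / 2) (fun h => lt_irrefl _ h.1), sub_zero] at h0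
    rw [h0, ← intervalIntegral.integral_ofReal, intervalIntegral.integral_of_le hz.1.le,
      intOver_apply,
      setIntegral_congr_ae (g := fun x => (g x : ℂ)) measurableSet_Ioc
        ((MemLp.coeFn_toLp (memLp_ofReal h.memLp L)).mono fun _ h _ => h),
      Measure.restrict_restrict measurableSet_Ioc]
    refine (setIntegral_eq_of_subset_of_forall_sdiff_eq_zero measurableSet_Ioc inter_subset_left
      ?_).symm
    intro x hx
    rw [h.g_zero x fun h' => hx.2 ⟨hx.1, h'⟩, Complex.ofReal_zero]
  refine (mem_H10_iff_primOp hL).2 ⟨Lp.ext ?_, ?_⟩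
  · filter_upwards [MemLp.coeFn_toLp (memLp_ofReal h.memLp_self L),
      primOp_coe L ((memLp_ofReal h.memLp L).toLp _), ae_restrict_mem (measurableSet_box L)]
      with z a1 a2 hz
    rw [a1, a2, key z ⟨hz.1, hz.2.le⟩]
  · rw [key _ ⟨by linarith, le_rfl⟩, h.f_zero _ (fun h => lt_irrefl _ h.2), Complex.ofReal_zero]

/-- The norm of `a + i b` in `L²(Λ)`. -/
theorem norm_sq_eq_integral {L : ℝ} {ψ : L2 L} {a b : ℝ → ℝ}
    (ha : Integrable fun x => a x ^ 2) (hb : Integrable fun x => b x ^ 2)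
    (ha0 : ∀ x, x ∉ box L → a x = 0) (hb0 : ∀ x, x ∉ box L → b x = 0)
    (h : ψ =ᵐ[volume.restrict (box L)] fun x => (a x : ℂ) + b x * Complex.I) :
    ‖ψ‖ ^ 2 = (∫ x, a x ^ 2) + ∫ x, b x ^ 2 := by
  have h1 : ((‖ψ‖ ^ 2 : ℝ) : ℂ) = inner ℂ ψ ψ := by
    rw [inner_self_eq_norm_sq_to_K]; norm_cast
  have h2 : inner ℂ ψ ψ = ((∫ x in box L, (a x ^ 2 + b x ^ 2) : ℝ) : ℂ) := by
    rw [L2.inner_def, ← integral_complex_ofReal]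
    apply integral_congr_ae
    filter_upwards [h] with x hx
    rw [hx]
    simp only [RCLike.inner_apply, map_add, map_mul, Complex.conj_ofReal, Complex.conj_I]
    push_cast
    ring_nf
    rw [Complex.I_sq]
    ring
  have h3 : ‖ψ‖ ^ 2 = ∫ x in box L, (a x ^ 2 + b x ^ 2) := by
    exact_mod_cast h1.trans h2
  rw [h3, ← integral_add ha hb]
  exact setIntegral_eq_integral_of_forall_compl_eq_zero fun x hx => by rw [ha0 x hx, hb0 x hx]; ring

/-! ### The form space and the spectrum of its compact resolvent -/

theorem IsPot.exists_box_bound {V : ℝ → ℝ} (hV : IsPot V) (L : ℝ) :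
    ∃ C : ℝ, 0 ≤ C ∧ ∀ x ∈ box L, Real.sqrt (V x) ≤ C := by
  obtain ⟨C, hC⟩ := hV.bdd (L / 2)
  refine ⟨Real.sqrt C, Real.sqrt_nonneg _, fun x hx => Real.sqrt_le_sqrt (hC x ⟨?_, hx.2.le⟩)⟩
  have := hx.1
  linarith

theorem IsPot.memLp_sqrt_mul {V : ℝ → ℝ} (hV : IsPot V) (L : ℝ) (ψ : L2 L) :
    MemLp (fun x => (Real.sqrt (V x) : ℂ) * ψ x) 2 (volume.restrict (box L)) := by
  obtain ⟨C, -, hC⟩ := hV.exists_box_bound L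
  refine ((Lp.memLp ψ).const_mul (C : ℂ)).mono ?_ ?_
  · exact (Complex.measurable_ofReal.comp hV.meas.sqrt).aestronglyMeasurable.mul
      (Lp.aestronglyMeasurable ψ)
  · filter_upwards [ae_restrict_mem (measurableSet_box L)] with x hx
    rw [norm_mul, norm_mul, Complex.norm_real, Complex.norm_real, Real.norm_eq_abs,
      Real.norm_eq_abs, abs_of_nonneg (Real.sqrt_nonneg _)]
    gcongr
    exact (hC x hx).trans (le_abs_self C)

/-- Multiplication by `√V` on `L²(Λ)`. -/
noncomputable def sqrtMul (L : ℝ) {V : ℝ → ℝ} (hV : IsPot V) : L2 L →L[ℂ] L2 L :=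
  LinearMap.mkContinuous
    { toFun := fun ψ => (hV.memLp_sqrt_mul L ψ).toLp _
      map_add' := fun ψ ψ' => by
        refine Lp.ext ?_
        filter_upwards [MemLp.coeFn_toLp (hV.memLp_sqrt_mul L (ψ + ψ')), Lp.coeFn_add ψ ψ',
          MemLp.coeFn_toLp (hV.memLp_sqrt_mul L ψ), MemLp.coeFn_toLp (hV.memLp_sqrt_mul L ψ'),
          Lp.coeFn_add ((hV.memLp_sqrt_mul L ψ).toLp _) ((hV.memLp_sqrt_mul L ψ').toLp _)]
          with x a1 a2 a3 a4 a5
        rw [a1, a5, Pi.add_apply, a3, a4, a2, Pi.add_apply, mul_add]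
      map_smul' := fun c ψ => by
        refine Lp.ext ?_
        filter_upwards [MemLp.coeFn_toLp (hV.memLp_sqrt_mul L (c • ψ)), Lp.coeFn_smul c ψ,
          MemLp.coeFn_toLp (hV.memLp_sqrt_mul L ψ),
          Lp.coeFn_smul c ((hV.memLp_sqrt_mul L ψ).toLp _)] with x a1 a2 a3 a4
        rw [RingHom.id_apply, a1, a4, Pi.smul_apply, a3, a2, Pi.smul_apply, smul_eq_mul,
          smul_eq_mul]
        ring }
    (hV.exists_box_bound L).choose
    fun ψ => by
      obtain ⟨h0, hC⟩ := (hV.exists_box_bound L).choose_spec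
      refine Lp.norm_le_mul_norm_of_ae_le_mul ?_
      filter_upwards [MemLp.coeFn_toLp (hV.memLp_sqrt_mul L ψ),
        ae_restrict_mem (measurableSet_box L)] with x a1 hx
      simp only [LinearMap.coe_mk, AddHom.coe_mk]
      rw [a1, norm_mul, Complex.norm_real, Real.norm_eq_abs, abs_of_nonneg (Real.sqrt_nonneg _)]
      gcongr
      exact hC x hx

theorem sqrtMul_coe (L : ℝ) {V : ℝ → ℝ} (hV : IsPot V) (ψ : L2 L) :
    sqrtMul L hV ψ =ᵐ[volume.restrict (box L)] fun x => (Real.sqrt (V x) : ℂ) * ψ x :=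
  MemLp.coeFn_toLp (hV.memLp_sqrt_mul L ψ)

theorem sqrtMul_sqrtMul_coe (L : ℝ) {V : ℝ → ℝ} (hV : IsPot V) (ψ : L2 L) :
    sqrtMul L hV (sqrtMul L hV ψ) =ᵐ[volume.restrict (box L)] fun x => (V x : ℂ) * ψ x := by
  filter_upwards [sqrtMul_coe L hV ψ, sqrtMul_coe L hV (sqrtMul L hV ψ)] with x h1 h2
  rw [h2, h1, ← mul_assoc, ← Complex.ofReal_mul, Real.mul_self_sqrt (hV.nonneg x)]

theorem inner_sqrtMul_left (L : ℝ) {V : ℝ → ℝ} (hV : IsPot V) (ψ χ : L2 L) :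
    inner ℂ (sqrtMul L hV ψ) χ = inner ℂ ψ (sqrtMul L hV χ) := by
  rw [L2.inner_def, L2.inner_def]
  apply integral_congr_ae
  filter_upwards [sqrtMul_coe L hV ψ, sqrtMul_coe L hV χ] with x h1 h2
  rw [h1, h2]
  simp only [RCLike.inner_apply, map_mul, Complex.conj_ofReal]
  ring

/-- The eigenvalue equation tested with all of `H¹₀(Λ)`. -/
theorem mem_eigenspace_iff {L : ℝ} {V : ℝ → ℝ} (hV : IsPot V) {E : ℝ} {ψ : L2 L} :
    ψ ∈ eigenspace L V E ↔ ∃ g : L2 L, (ψ, g) ∈ H10 L ∧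
      ∀ q ∈ H10 L, inner ℂ q.2 g + inner ℂ (sqrtMul L hV q.1) (sqrtMul L hV ψ) =
        E * inner ℂ q.1 ψ := by
  have hw : ∀ w : L2 L, (w =ᵐ[volume.restrict (box L)] fun x => (V x : ℂ) * ψ x) →
      w = sqrtMul L hV (sqrtMul L hV ψ) := fun w h =>
    Lp.ext (h.trans (sqrtMul_sqrtMul_coe L hV ψ).symm)
  constructor
  · rintro ⟨g, w, h1, h2, h3⟩
    refine ⟨g, h1, fun q hq => ?_⟩
    have hcl : IsClosed {q : L2 L × L2 L | inner ℂ q.2 g +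
        inner ℂ (sqrtMul L hV q.1) (sqrtMul L hV ψ) = E * inner ℂ q.1 ψ} :=
      isClosed_eq (by fun_prop) (by fun_prop)
    refine closure_minimal (s := (testGraph L : Set (L2 L × L2 L))) ?_ hcl hq
    intro q hq
    have h4 : inner ℂ q.2 g = inner ℂ q.1 ((E : ℂ) • ψ - w) := h3 q hq
    have h5 := hw w h2
    show inner ℂ q.2 g + inner ℂ (sqrtMul L hV q.1) (sqrtMul L hV ψ) = E * inner ℂ q.1 ψ
    rw [h4, inner_sub_right, inner_sqrtMul_left, h5, inner_smul_right]
    ring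
  · rintro ⟨g, h1, h2⟩
    refine ⟨g, sqrtMul L hV (sqrtMul L hV ψ), h1, sqrtMul_sqrtMul_coe L hV ψ, fun q hq => ?_⟩
    have h3 := h2 q (Submodule.le_topologicalClosure _ hq)
    show inner ℂ q.2 g = inner ℂ q.1 ((E : ℂ) • ψ - sqrtMul L hV (sqrtMul L hV ψ))
    rw [inner_sub_right, inner_smul_right, ← h3, inner_sqrtMul_left]
    ring

/-! ### The first two eigenvalues -/

/-- The form domain with the graph inner product of `ψ ↦ (ψ, ψ', √V ψ)`, a closed subspace of
`L²(Λ)³`. -/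
noncomputable def formSpace (L : ℝ) {V : ℝ → ℝ} (hV : IsPot V) :
    Submodule ℂ (PiLp 2 fun _ : Fin 3 => L2 L) where
  carrier := {v | (v 0, v 1) ∈ H10 L ∧ v 2 = sqrtMul L hV (v 0)}
  zero_mem' := ⟨(H10 L).zero_mem, by simp⟩
  add_mem' := by
    rintro v w ⟨h1, h2⟩ ⟨h3, h4⟩
    refine ⟨(H10 L).add_mem h1 h3, ?_⟩
    rw [PiLp.add_apply, PiLp.add_apply, h2, h4, map_add]
  smul_mem' := by
    rintro c v ⟨h1, h2⟩
    refine ⟨(H10 L).smul_mem c h1, ?_⟩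
    rw [PiLp.smul_apply, PiLp.smul_apply, h2, map_smul]

theorem isClosed_formSpace (L : ℝ) {V : ℝ → ℝ} (hV : IsPot V) :
    IsClosed (formSpace L hV : Set (PiLp 2 fun _ : Fin 3 => L2 L)) := by
  have hc : ∀ i : Fin 3, Continuous fun v : PiLp 2 (fun _ : Fin 3 => L2 L) => v i := fun i =>
    (PiLp.proj (𝕜 := ℂ) 2 (fun _ : Fin 3 => L2 L) i).continuous
  refine IsClosed.inter ?_ ?_
  · exact (Submodule.isClosed_topologicalClosure (testGraph L)).preimage ((hc 0).prodMk (hc 1))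
  · exact isClosed_eq (hc 2) ((sqrtMul L hV).continuous.comp (hc 0))

instance completeSpace_formSpace (L : ℝ) {V : ℝ → ℝ} (hV : IsPot V) :
    CompleteSpace (formSpace L hV) := (isClosed_formSpace L hV).completeSpace_coe

/-- The embedding of the form domain into `L²(Λ)`. -/
noncomputable def formEmb (L : ℝ) {V : ℝ → ℝ} (hV : IsPot V) : formSpace L hV →L[ℂ] L2 L :=
  (PiLp.proj (𝕜 := ℂ) 2 (fun _ : Fin 3 => L2 L) 0).comp (formSpace L hV).subtypeL

theorem isCompactOperator_formEmb {L : ℝ} (hL : 0 < L) {V : ℝ → ℝ} (hV : IsPot V) :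
    IsCompactOperator (formEmb L hV) := by
  have := (isCompactOperator_primOp hL).comp_clm
    ((PiLp.proj (𝕜 := ℂ) 2 (fun _ : Fin 3 => L2 L) 1).comp (formSpace L hV).subtypeL)
  have e : ⇑(formEmb L hV) = primOp L ∘
      ((PiLp.proj (𝕜 := ℂ) 2 (fun _ : Fin 3 => L2 L) 1).comp (formSpace L hV).subtypeL) :=
    funext fun v => ((mem_H10_iff_primOp hL).1 v.2.1).1
  rw [e]
  exact this

/-- The element of the form domain determined by an element of `H¹₀(Λ)`. -/
noncomputable def formOf (L : ℝ) {V : ℝ → ℝ} (hV : IsPot V) (q : L2 L × L2 L) (hq : q ∈ H10 L) :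
    formSpace L hV :=
  ⟨WithLp.toLp 2 ![q.1, q.2, sqrtMul L hV q.1], hq, rfl⟩

theorem inner_formOf (L : ℝ) {V : ℝ → ℝ} (hV : IsPot V) (q : L2 L × L2 L) (hq : q ∈ H10 L)
    (v : formSpace L hV) : inner ℂ (formOf L hV q hq) v = inner ℂ q.1 (v.1 0) +
      inner ℂ q.2 (v.1 1) + inner ℂ (sqrtMul L hV q.1) (sqrtMul L hV (v.1 0)) := by
  rw [Submodule.coe_inner, PiLp.inner_apply, Fin.sum_univ_three, v.2.2]
  rfl

/-- An eigenvector of `J J*` for the embedding `J` of the form domain yields an eigenvector of the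
Schrödinger operator. -/
theorem mem_eigenspace_of_formEmb {L : ℝ} {V : ℝ → ℝ} (hV : IsPot V) {ψ : L2 L} {τ : ℝ}
    (hτ : τ ≠ 0)
    (h : formEmb L hV (ContinuousLinearMap.adjoint (formEmb L hV) ψ) = (τ : ℂ) • ψ) :
    ψ ∈ eigenspace L V (τ⁻¹ - 1) := by
  set v := ContinuousLinearMap.adjoint (formEmb L hV) ψ with hv
  have h0 : v.1 0 = (τ : ℂ) • ψ := h
  have hτ' : (τ : ℂ) ≠ 0 := by exact_mod_cast hτ
  have hmem : v.1 0 ∈ eigenspace L V (τ⁻¹ - 1) := by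
    refine (mem_eigenspace_iff hV).2 ⟨v.1 1, v.2.1, fun q hq => ?_⟩
    have h1 : inner ℂ (formOf L hV q hq) v = inner ℂ q.1 ψ := by
      rw [hv, ContinuousLinearMap.adjoint_inner_right]
      rfl
    rw [inner_formOf, h0, inner_smul_right] at h1
    rw [h0, inner_smul_right]
    push_cast
    field_simp
    linear_combination h1
  have := (eigenspace L V (τ⁻¹ - 1)).smul_mem ((τ : ℂ)⁻¹) hmem
  rwa [h0, smul_smul, inv_mul_cancel₀ hτ', one_smul] at this

section Abstract

variable {H K : Type*} [NormedAddCommGroup H] [InnerProductSpace ℂ H] [CompleteSpace H]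
  [NormedAddCommGroup K] [InnerProductSpace ℂ K] [CompleteSpace K]

open ContinuousLinearMap in
/-- The norm of a compact operator is attained: `‖J‖²` is an eigenvalue of `J J*`. -/
theorem exists_eigenvector_norm {J : H →L[ℂ] K} (hJ : IsCompactOperator J) (h0 : J ≠ 0) :
    ∃ ψ : K, ψ ≠ 0 ∧ J (adjoint J ψ) = ((‖J‖ ^ 2 : ℝ) : ℂ) • ψ := by
  set T : K →L[ℂ] K := J ∘L adjoint J with hT
  have hTc : IsCompactOperator T := hJ.comp_clm (adjoint J)
  have hnorm : ‖T‖ = ‖J‖ ^ 2 := by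
    have := norm_adjoint_comp_self (adjoint J)
    rw [adjoint_adjoint, LinearIsometryEquiv.norm_map] at this
    rw [hT, this, sq]
  have hself : IsSelfAdjoint T := by
    rw [isSelfAdjoint_iff', hT, adjoint_comp, adjoint_adjoint]
  have hJpos : 0 < ‖J‖ := norm_pos_iff.2 h0
  have hnt : Nontrivial K := by
    by_contra hK
    rw [not_nontrivial_iff_subsingleton] at hK
    exact h0 (ContinuousLinearMap.ext fun x => Subsingleton.elim _ _)
  obtain ⟨z, hz, hz2⟩ := spectrum.exists_nnnorm_eq_spectralRadius T
  have hz2 := hz2.trans (T.spectralRadius_eq_nnnorm hself)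
  rw [ENNReal.coe_inj] at hz2
  have hz3 : ‖z‖ = ‖J‖ ^ 2 := by rw [← hnorm]; exact congrArg NNReal.toReal hz2
  have hz0 : z ≠ 0 := by
    rw [← norm_pos_iff, hz3]; positivity
  obtain ⟨ψ, hψ⟩ := ((hTc.hasEigenvalue_iff_mem_spectrum hz0).2 hz).exists_hasEigenvector
  have hev : T ψ = z • ψ := hψ.apply_eq_smul
  have h1 : z * (‖ψ‖ : ℂ) ^ 2 = (‖adjoint J ψ‖ : ℂ) ^ 2 := by
    have h2 : inner ℂ ψ (T ψ) = inner ℂ (adjoint J ψ) (adjoint J ψ) := by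
      rw [adjoint_inner_left]; rfl
    rw [hev, inner_smul_right, inner_self_eq_norm_sq_to_K, inner_self_eq_norm_sq_to_K] at h2
    exact h2
  have hψ0 : ‖ψ‖ ≠ 0 := norm_ne_zero_iff.2 hψ.2
  have h2 : z = ((‖adjoint J ψ‖ ^ 2 / ‖ψ‖ ^ 2 : ℝ) : ℂ) := by
    have : (‖ψ‖ : ℂ) ≠ 0 := by exact_mod_cast hψ0
    push_cast
    field_simp
    exact h1
  have h3 : z = ((‖J‖ ^ 2 : ℝ) : ℂ) := by
    rw [← hz3]
    rw [h2, Complex.norm_real, Real.norm_of_nonneg (by positivity)]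
  refine ⟨ψ, hψ.2, ?_⟩
  rw [← h3]
  exact hev

open ContinuousLinearMap in
/-- If `J` is compact with dense range, the eigenvectors of `J J*` with positive eigenvalue are not
contained in a line, unless the whole space is. -/
theorem exists_eigenvector_notMem_span {J : H →L[ℂ] K} (hJ : IsCompactOperator J)
    (hd : DenseRange J) (ψ₀ : K) (hK : ∃ χ : K, χ ∉ Submodule.span ℂ {ψ₀}) :
    ∃ ψ : K, ∃ τ : ℝ, ψ ∉ Submodule.span ℂ {ψ₀} ∧ τ ≠ 0 ∧ J (adjoint J ψ) = (τ : ℂ) • ψ := by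
  set T : K →L[ℂ] K := J ∘L adjoint J with hT
  have hTc : IsCompactOperator T := hJ.comp_clm (adjoint J)
  have hself : IsSelfAdjoint T := by
    rw [isSelfAdjoint_iff', hT, adjoint_comp, adjoint_adjoint]
  have hsymm : T.IsSymmetric := isSelfAdjoint_iff_isSymmetric.1 hself
  have hspec := orthogonalComplement_iSup_eigenspaces_eq_bot hTc hsymm
  have hex : ∃ z : ℂ, ¬ Module.End.eigenspace (T : Module.End ℂ K) z ≤ Submodule.span ℂ {ψ₀} := by
    by_contra! hcon
    have hle : (⨆ z, Module.End.eigenspace (T : Module.End ℂ K) z) ≤ Submodule.span ℂ {ψ₀} :=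
      iSup_le hcon
    have h2 : (Submodule.span ℂ {ψ₀})ᗮ = ⊥ := by
      rw [← le_bot_iff, ← hspec]
      exact Submodule.orthogonal_le hle
    obtain ⟨χ, hχ⟩ := hK
    rw [Submodule.orthogonal_eq_bot_iff.1 h2] at hχ
    exact hχ trivial
  obtain ⟨z, hz⟩ := hex
  obtain ⟨ψ, hψ, hψ2⟩ := SetLike.not_le_iff_exists.1 hz
  have hev : T ψ = z • ψ := Module.End.mem_eigenspace_iff.1 hψ
  have hψ0 : ψ ≠ 0 := fun h => hψ2 (h ▸ Submodule.zero_mem _)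
  have h1 : z * (‖ψ‖ : ℂ) ^ 2 = (‖adjoint J ψ‖ : ℂ) ^ 2 := by
    have h2 : inner ℂ ψ (T ψ) = inner ℂ (adjoint J ψ) (adjoint J ψ) := by
      rw [adjoint_inner_left]; rfl
    rw [hev, inner_smul_right, inner_self_eq_norm_sq_to_K, inner_self_eq_norm_sq_to_K] at h2
    exact h2
  have hψ0 : ‖ψ‖ ≠ 0 := norm_ne_zero_iff.2 hψ0
  have h2 : z = ((‖adjoint J ψ‖ ^ 2 / ‖ψ‖ ^ 2 : ℝ) : ℂ) := by
    have : (‖ψ‖ : ℂ) ≠ 0 := by exact_mod_cast hψ0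
    push_cast
    field_simp
    exact h1
  have h3 : adjoint J ψ ≠ 0 := by
    intro h
    refine hψ0 (norm_eq_zero.2 ?_)
    refine hd.eq_zero_of_inner_left ℂ ?_
    intro x
    rw [← adjoint_inner_left, h, inner_zero_left]
  refine ⟨ψ, _, hψ2, ?_, h2 ▸ hev⟩
  have := norm_pos_iff.2 h3
  positivity

end Abstract

/-- The form domain is dense in `L²(Λ)`. -/
theorem denseRange_formEmb (L : ℝ) {V : ℝ → ℝ} (hV : IsPot V) : DenseRange (formEmb L hV) := by
  have h1 : Dense (testSpace L : Set (L2 L)) := by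
    rw [dense_iff_closure_eq, ← Submodule.topologicalClosure_coe, testSpace_closure]
    rfl
  refine h1.mono ?_
  rintro _ ⟨p, hp, rfl⟩
  exact ⟨formOf L hV p (Submodule.le_topologicalClosure _ hp), rfl⟩

theorem formEnergy_eq_norm {L : ℝ} {V : ℝ → ℝ} (hV : IsPot V) {ψ G : L2 L}
    {f₁ g₁ f₂ g₂ : ℝ → ℝ} (h₁ : IsTrial (-L / 2) (L / 2) f₁ g₁)
    (h₂ : IsTrial (-L / 2) (L / 2) f₂ g₂)
    (hψ : ψ =ᵐ[volume.restrict (box L)] fun x => (f₁ x : ℂ) + f₂ x * Complex.I)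
    (hG : G =ᵐ[volume.restrict (box L)] fun x => (g₁ x : ℂ) + g₂ x * Complex.I) :
    ‖G‖ ^ 2 + ‖sqrtMul L hV ψ‖ ^ 2 = formEnergy V f₁ g₁ + formEnergy V f₂ g₂ := by
  have hs : ∀ x (c : ℝ), (Real.sqrt (V x) * c) ^ 2 = V x * c ^ 2 := fun x c => by
    rw [mul_pow, Real.sq_sqrt (hV.nonneg x)]
  rw [norm_sq_eq_integral h₁.integrable_sq h₂.integrable_sq h₁.g_zero h₂.g_zero hG,
    norm_sq_eq_integral (a := fun x => Real.sqrt (V x) * f₁ x)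
      (b := fun x => Real.sqrt (V x) * f₂ x) (ψ := sqrtMul L hV ψ)]
  · simp only [hs]
    unfold formEnergy
    ring
  · simp only [hs]; exact h₁.integrable_pot hV
  · simp only [hs]; exact h₂.integrable_pot hV
  · intro x hx; simp [h₁.f_zero x hx]
  · intro x hx; simp [h₂.f_zero x hx]
  · filter_upwards [hψ, sqrtMul_coe L hV ψ] with x a1 a2
    rw [a2, a1]
    push_cast
    ring

/-- The ground state energy bounds the quadratic form from below on each side of a zero. -/
theorem min_groundEnergy_mul_le {a b y : ℝ} {V f g : ℝ → ℝ} (hV : IsPot V)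
    (h : IsTrial a b f g) (hy : f y = 0) :
    min (groundEnergy a y V) (groundEnergy y b V) * ∫ x, f x ^ 2 ≤ formEnergy V f g := by
  have hl := groundEnergy_mul_le hV (h.restrict_left hy)
  have hr := groundEnergy_mul_le hV (h.restrict_right hy)
  have split : ∀ F : ℝ → ℝ, Integrable F →
      ∫ x, F x = (∫ x, (Iio y).indicator F x) + ∫ x, (Ioi y).indicator F x := by
    intro F hF
    rw [integral_indicator measurableSet_Iio, integral_indicator measurableSet_Ioi,
      ← integral_Iic_eq_integral_Iio,
      intervalIntegral.integral_Iic_add_Ioi hF.integrableOn hF.integrableOn]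
  have sqi : ∀ (s : Set ℝ) (p : ℝ → ℝ), (fun x => s.indicator p x ^ 2) =
      s.indicator fun x => p x ^ 2 := by
    intro s p
    funext x
    by_cases hx : x ∈ s <;> simp [hx]
  have vsqi : ∀ (s : Set ℝ) (p : ℝ → ℝ), (fun x => V x * s.indicator p x ^ 2) =
      s.indicator fun x => V x * p x ^ 2 := by
    intro s p
    funext x
    by_cases hx : x ∈ s <;> simp [hx]
  unfold formEnergy at hl hr ⊢
  rw [sqi, sqi, vsqi] at hl hr
  rw [split _ h.integrable_f_sq, split _ h.integrable_sq, split _ (h.integrable_pot hV)]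
  set m := min (groundEnergy a y V) (groundEnergy y b V)
  have a1 : m * ∫ x, (Iio y).indicator (fun x => f x ^ 2) x ≤
      groundEnergy a y V * ∫ x, (Iio y).indicator (fun x => f x ^ 2) x :=
    mul_le_mul_of_nonneg_right (min_le_left _ _) (integral_nonneg fun x =>
      indicator_nonneg (fun _ _ => sq_nonneg _) x)
  have a2 : m * ∫ x, (Ioi y).indicator (fun x => f x ^ 2) x ≤
      groundEnergy y b V * ∫ x, (Ioi y).indicator (fun x => f x ^ 2) x :=
    mul_le_mul_of_nonneg_right (min_le_right _ _) (integral_nonneg fun x =>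
      indicator_nonneg (fun _ _ => sq_nonneg _) x)
  linarith

theorem inner_self_eq_ofReal_norm_sq {E : Type*} [NormedAddCommGroup E] [InnerProductSpace ℂ E]
    (x : E) : inner ℂ x x = ((‖x‖ ^ 2 : ℝ) : ℂ) := by
  rw [inner_self_eq_norm_sq_to_K]
  norm_cast

/-- Eigenvalues of the Schrödinger operator are nonnegative. -/
theorem nonneg_of_eigenspace {L : ℝ} {V : ℝ → ℝ} (hV : IsPot V) {E : ℝ} {ψ : L2 L}
    (h : ψ ∈ eigenspace L V E) (h0 : ψ ≠ 0) : 0 ≤ E := by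
  obtain ⟨g, h1, h2⟩ := (mem_eigenspace_iff hV).1 h
  have h3 := h2 _ h1
  simp only at h3
  simp only [inner_self_eq_ofReal_norm_sq] at h3
  have h4 : ‖g‖ ^ 2 + ‖sqrtMul L hV ψ‖ ^ 2 = E * ‖ψ‖ ^ 2 := by exact_mod_cast h3
  have h5 : 0 < ‖ψ‖ ^ 2 := by have := norm_pos_iff.2 h0; positivity
  by_contra! hE
  nlinarith [sq_nonneg ‖g‖, sq_nonneg ‖sqrtMul L hV ψ‖, mul_neg_of_neg_of_pos hE h5]

/-- The set whose infimum is `eigenvalue L V j` is bounded below, so that the infimum is genuine. -/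
theorem bddBelow_eigenCount {L : ℝ} {V : ℝ → ℝ} (hV : IsPot V) {j : ℕ} (hj : 1 ≤ j) :
    BddBelow {E : ℝ | (j : Cardinal) ≤ eigenCount L V E} := by
  refine ⟨0, fun E hE => ?_⟩
  by_contra! hneg
  have hbot : (⨆ e : Iic E, eigenspace L V (e : ℝ) : Submodule ℂ (L2 L)) = ⊥ := by
    rw [iSup_eq_bot]
    rintro ⟨e, he⟩
    rw [Submodule.eq_bot_iff]
    intro ψ hψ
    by_contra h0
    have := nonneg_of_eigenspace hV hψ h0
    have he' : e ≤ E := he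
    linarith
  have : (j : Cardinal) ≤ 0 := by
    have h1 : (j : Cardinal) ≤ eigenCount L V E := hE
    rwa [eigenCount, hbot, rank_bot] at h1
  have h2 : j = 0 := by exact_mod_cast le_antisymm this (zero_le)
  omega

/-- The norm of the compact embedding `J` of the form domain is attained at an eigenvector with
eigenvalue `‖J‖⁻² - 1`, the minimum of the form over
normalized elements of its domain. -/
theorem exists_eigenvector_le_groundEnergy {L : ℝ} (hL : 0 < L) {V : ℝ → ℝ} (hV : IsPot V) :
    ∃ (ψ : L2 L) (E : ℝ), ψ ≠ 0 ∧ ψ ∈ eigenspace L V E ∧ E ≤ groundEnergy (-L / 2) (L / 2) V := by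
  obtain ⟨f₀, g₀, h₀, hm₀⟩ := exists_isTrial (a := -L / 2) (b := L / 2) (by linarith)
  have key : ∀ f g, IsTrial (-L / 2) (L / 2) f g → ∫ x, f x ^ 2 = 1 →
      1 ≤ ‖formEmb L hV‖ ^ 2 * (1 + formEnergy V f g) := by
    intro f g h hm
    set v := formOf L hV _ (h.mem_H10 hL) with hv
    have hn0 : ‖formEmb L hV v‖ ^ 2 = 1 := by
      have : formEmb L hV v = (memLp_ofReal h.memLp_self L).toLp _ := rfl
      rw [this, norm_sq_eq_integral (a := f) (b := fun _ => 0) h.integrable_f_sq (by simp)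
        h.f_zero (fun _ _ => rfl), hm]
      · simp
      · filter_upwards [MemLp.coeFn_toLp (memLp_ofReal h.memLp_self L)] with x hx
        rw [hx]; simp
    have hz : IsTrial (-L / 2) (L / 2) (fun _ => 0) (fun _ => 0) := by
      simpa using h.const_mul 0
    have hn1 : ‖v‖ ^ 2 = 1 + formEnergy V f g := by
      have h1 : ((‖v‖ ^ 2 : ℝ) : ℂ) = inner ℂ v v := (inner_self_eq_ofReal_norm_sq v).symm
      have h2 : inner ℂ v v = ((‖v.1 0‖ ^ 2 + ‖v.1 1‖ ^ 2 + ‖sqrtMul L hV (v.1 0)‖ ^ 2 : ℝ) : ℂ) := by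
        have e := inner_formOf L hV _ (h.mem_H10 hL) v
        rw [← hv] at e
        refine e.trans ?_
        have e0 : ((memLp_ofReal h.memLp_self L).toLp _ : L2 L) = v.1 0 := rfl
        have e1 : ((memLp_ofReal h.memLp L).toLp _ : L2 L) = v.1 1 := rfl
        simp only [e0, e1, inner_self_eq_ofReal_norm_sq]
        push_cast
        rfl
      have h3 : ‖v‖ ^ 2 = ‖v.1 0‖ ^ 2 + ‖v.1 1‖ ^ 2 + ‖sqrtMul L hV (v.1 0)‖ ^ 2 := by
        exact_mod_cast h1.trans h2
      have h4 := formEnergy_eq_norm (ψ := v.1 0) (G := v.1 1) hV h hz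
        (by
          filter_upwards [MemLp.coeFn_toLp (memLp_ofReal h.memLp_self L)] with x hx
          have e0 : ((memLp_ofReal h.memLp_self L).toLp _ : L2 L) = v.1 0 := rfl
          rw [← e0, hx]; simp)
        (by
          filter_upwards [MemLp.coeFn_toLp (memLp_ofReal h.memLp L)] with x hx
          have e0 : ((memLp_ofReal h.memLp L).toLp _ : L2 L) = v.1 1 := rfl
          rw [← e0, hx]; simp)
      have h5 : formEnergy V (fun _ => 0) (fun _ => 0) = 0 := by simp [formEnergy]
      have h6 : ‖v.1 0‖ ^ 2 = 1 := hn0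
      rw [h3, h6, add_assoc, h4, h5, add_zero]
    have hle := (formEmb L hV).le_opNorm v
    calc (1 : ℝ) = ‖formEmb L hV v‖ ^ 2 := hn0.symm
      _ ≤ (‖formEmb L hV‖ * ‖v‖) ^ 2 := by gcongr
      _ = _ := by rw [mul_pow, hn1]
  have hJpos : 0 < ‖formEmb L hV‖ ^ 2 := by
    by_contra! hcon
    have h1 := key f₀ g₀ h₀ hm₀
    nlinarith [formEnergy_nonneg hV f₀ g₀]
  have hJ0 : formEmb L hV ≠ 0 := by
    intro h
    have h1 : ‖formEmb L hV‖ ≤ 0 :=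
      ContinuousLinearMap.opNorm_le_bound _ le_rfl fun v => by rw [h]; simp
    have h2 : ‖formEmb L hV‖ = 0 := le_antisymm h1 (formEmb L hV).opNorm_nonneg
    rw [h2] at hJpos
    norm_num at hJpos
  obtain ⟨ψ, h1, h2⟩ := exists_eigenvector_norm (isCompactOperator_formEmb hL hV) hJ0
  refine ⟨ψ, _, h1, mem_eigenspace_of_formEmb hV hJpos.ne' h2,
    le_groundEnergy (by linarith) fun f g h hm => ?_⟩
  have := key f g h hm
  rw [sub_le_iff_le_add, inv_le_iff_one_le_mul₀ hJpos]
  linarith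

/-- The first eigenvalue is at most the variational ground state energy. -/
theorem eigenvalue_one_le {L : ℝ} (hL : 0 < L) {V : ℝ → ℝ} (hV : IsPot V) :
    eigenvalue L V 1 ≤ groundEnergy (-L / 2) (L / 2) V := by
  obtain ⟨ψ, E, h0, h1, h2⟩ := exists_eigenvector_le_groundEnergy hL hV
  refine (csInf_le (bddBelow_eigenCount hV le_rfl) ?_).trans h2
  show ((1 : ℕ) : Cardinal) ≤ eigenCount L V E
  rw [Nat.cast_one, Cardinal.one_le_iff_pos, eigenCount, rank_pos_iff_exists_ne_zero]
  exact ⟨⟨ψ, (le_iSup (fun e : Iic E => eigenspace L V (e : ℝ)) ⟨E, self_mem_Iic⟩) h1⟩,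
    fun h => h0 (congrArg Subtype.val h)⟩

/-- Any level that bounds two eigenvalues bounds the ground state energy on one side of `y`: some
combination of two eigenfunctions vanishes at `y`. -/
theorem min_groundEnergy_le_of_two_le_eigenCount {L : ℝ} (hL : 0 < L) {V : ℝ → ℝ} (hV : IsPot V)
    {y : ℝ} (hy : y ∈ box L) {E : ℝ} (hE : ((2 : ℕ) : Cardinal) ≤ eigenCount L V E) :
    min (groundEnergy (-L / 2) y V) (groundEnergy y (L / 2) V) ≤ E := by
  -- two independent eigenvectors
  obtain ⟨ψ₁, e₁, he₁, hψ₁, h0₁⟩ : ∃ ψ e, e ≤ E ∧ ψ ∈ eigenspace L V e ∧ ψ ≠ 0 := by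
    by_contra! hcon
    have hbot : (⨆ e : Iic E, eigenspace L V (e : ℝ) : Submodule ℂ (L2 L)) = ⊥ := by
      rw [iSup_eq_bot]
      rintro ⟨e, he⟩
      rw [Submodule.eq_bot_iff]
      exact fun ψ hψ => hcon ψ e he hψ
    rw [eigenCount, hbot, rank_bot] at hE
    have : (2 : ℕ) = 0 := by exact_mod_cast le_antisymm hE (zero_le)
    omega
  obtain ⟨ψ₂, e₂, he₂, hψ₂, hn₂⟩ : ∃ ψ e, e ≤ E ∧ ψ ∈ eigenspace L V e ∧
      ψ ∉ Submodule.span ℂ {ψ₁} := by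
    by_contra! hcon
    have hle : (⨆ e : Iic E, eigenspace L V (e : ℝ) : Submodule ℂ (L2 L)) ≤
        Submodule.span ℂ {ψ₁} := iSup_le fun e ψ hψ => hcon ψ e e.2 hψ
    have h1 := hE.trans ((Submodule.rank_mono hle).trans (rank_span_le _))
    rw [Cardinal.mk_singleton] at h1
    have : (2 : ℕ) ≤ 1 := by exact_mod_cast h1
    omega
  obtain ⟨g₁, hg₁, ht₁⟩ := (mem_eigenspace_iff hV).1 hψ₁
  obtain ⟨g₂, hg₂, ht₂⟩ := (mem_eigenspace_iff hV).1 hψ₂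
  -- coefficients for which the combination vanishes at `y`
  obtain ⟨α, β, hαβ, hzero⟩ : ∃ α β : ℂ, α • ψ₁ + β • ψ₂ ≠ 0 ∧
      α * intOver L (-L / 2) y g₁ + β * intOver L (-L / 2) y g₂ = 0 := by
    set c₁ := intOver L (-L / 2) y g₁
    set c₂ := intOver L (-L / 2) y g₂
    by_cases hc : c₁ = 0
    · exact ⟨1, 0, by simpa using h0₁, by simp [hc]⟩
    · refine ⟨c₂, -c₁, fun h => hn₂ ?_, by ring⟩
      rw [Submodule.mem_span_singleton]
      refine ⟨c₁⁻¹ * c₂, ?_⟩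
      have : c₂ • ψ₁ = c₁ • ψ₂ := by
        rw [neg_smul] at h
        exact add_neg_eq_zero.1 h
      rw [mul_smul, this, smul_smul, inv_mul_cancel₀ hc, one_smul]
  set ψ := α • ψ₁ + β • ψ₂ with hψ
  set G := α • g₁ + β • g₂ with hG
  have hmem : (ψ, G) ∈ H10 L := (H10 L).add_mem ((H10 L).smul_mem α hg₁) ((H10 L).smul_mem β hg₂)
  -- the form is at most `E` on the combination
  have hform : ‖G‖ ^ 2 + ‖sqrtMul L hV ψ‖ ^ 2 ≤ E * ‖ψ‖ ^ 2 := by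
    have q₁ := ht₁ _ hmem
    have q₂ := ht₂ _ hmem
    simp only at q₁ q₂
    have hsym : ((e₁ : ℂ) - e₂) * inner ℂ ψ₁ ψ₂ = 0 := by
      have s₁ := ht₁ _ hg₂
      have s₂ := ht₂ _ hg₁
      simp only at s₁ s₂
      have s₃ := congrArg (starRingEnd ℂ) s₁
      simp only [map_add, map_mul, inner_conj_symm, Complex.conj_ofReal] at s₃
      linear_combination s₂ - s₃
    have hexp : ((‖G‖ ^ 2 + ‖sqrtMul L hV ψ‖ ^ 2 : ℝ) : ℂ) =
        α * (e₁ * inner ℂ ψ ψ₁) + β * (e₂ * inner ℂ ψ ψ₂) := by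
      push_cast
      rw [← Complex.ofReal_pow, ← Complex.ofReal_pow, ← inner_self_eq_ofReal_norm_sq,
        ← inner_self_eq_ofReal_norm_sq, ← q₁, ← q₂]
      conv_lhs =>
        congr
        · rw [hG, inner_add_right, inner_smul_right, inner_smul_right, ← hG]
        · rw [hψ, map_add, map_smul, map_smul, inner_add_right, inner_smul_right,
            inner_smul_right, ← map_smul, ← map_smul, ← map_add, ← hψ]
      ring
    have hnorm : ((‖ψ‖ ^ 2 : ℝ) : ℂ) = α * inner ℂ ψ ψ₁ + β * inner ℂ ψ ψ₂ := by
      rw [← inner_self_eq_ofReal_norm_sq]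
      conv_lhs => rw [hψ, inner_add_right, inner_smul_right, inner_smul_right, ← hψ]
    by_cases hee : e₁ = e₂
    · have h1 : ((‖G‖ ^ 2 + ‖sqrtMul L hV ψ‖ ^ 2 : ℝ) : ℂ) = ((e₁ * ‖ψ‖ ^ 2 : ℝ) : ℂ) := by
        rw [hexp, ← hee, Complex.ofReal_mul, hnorm]; ring
      have h2 : ‖G‖ ^ 2 + ‖sqrtMul L hV ψ‖ ^ 2 = e₁ * ‖ψ‖ ^ 2 := by exact_mod_cast h1
      rw [h2]
      gcongr
    · have hort : inner ℂ ψ₁ ψ₂ = 0 := by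
        have : (e₁ : ℂ) - e₂ ≠ 0 := by
          rw [← Complex.ofReal_sub]
          exact_mod_cast sub_ne_zero.2 hee
        exact (mul_eq_zero.1 hsym).resolve_left this
      have hort' : inner ℂ ψ₂ ψ₁ = 0 := by rw [← inner_conj_symm, hort, map_zero]
      have i₁ : α * inner ℂ ψ ψ₁ = ((‖α‖ ^ 2 * ‖ψ₁‖ ^ 2 : ℝ) : ℂ) := by
        rw [hψ, inner_add_left, inner_smul_left, inner_smul_left, hort', mul_zero, add_zero,
          inner_self_eq_ofReal_norm_sq, ← mul_assoc, Complex.mul_conj, Complex.normSq_eq_norm_sq]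
        push_cast
        ring
      have i₂ : β * inner ℂ ψ ψ₂ = ((‖β‖ ^ 2 * ‖ψ₂‖ ^ 2 : ℝ) : ℂ) := by
        rw [hψ, inner_add_left, inner_smul_left, inner_smul_left, hort, mul_zero, zero_add,
          inner_self_eq_ofReal_norm_sq, ← mul_assoc, Complex.mul_conj, Complex.normSq_eq_norm_sq]
        push_cast
        ring
      have h1 : ((‖G‖ ^ 2 + ‖sqrtMul L hV ψ‖ ^ 2 : ℝ) : ℂ) =
          ((e₁ * (‖α‖ ^ 2 * ‖ψ₁‖ ^ 2) + e₂ * (‖β‖ ^ 2 * ‖ψ₂‖ ^ 2) : ℝ) : ℂ) := by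
        rw [hexp]
        push_cast at i₁ i₂ ⊢
        linear_combination e₁ * i₁ + e₂ * i₂
      have h2 : ‖G‖ ^ 2 + ‖sqrtMul L hV ψ‖ ^ 2 =
          e₁ * (‖α‖ ^ 2 * ‖ψ₁‖ ^ 2) + e₂ * (‖β‖ ^ 2 * ‖ψ₂‖ ^ 2) := by exact_mod_cast h1
      have h3 : ‖ψ‖ ^ 2 = ‖α‖ ^ 2 * ‖ψ₁‖ ^ 2 + ‖β‖ ^ 2 * ‖ψ₂‖ ^ 2 := by
        rw [i₁, i₂] at hnorm
        exact_mod_cast hnorm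
      rw [h2, h3, mul_add]
      gcongr
  obtain ⟨f₁, k₁, f₂, k₂, hf₁, hf₂, r1, r2, r3⟩ := exists_isTrial_of_mem_H10 hL hmem
  have hval := r3 y hy
  have hvan : intOver L (-L / 2) y G = 0 := by
    rw [hG, map_add, map_smul, map_smul]; exact hzero
  simp only [hvan] at hval
  have v₁ : f₁ y = 0 := by simpa using congrArg Complex.re hval
  have v₂ : f₂ y = 0 := by simpa using congrArg Complex.im hval
  rw [formEnergy_eq_norm hV hf₁ hf₂ r1 r2,
    norm_sq_eq_integral hf₁.integrable_f_sq hf₂.integrable_f_sq hf₁.f_zero hf₂.f_zero r1] at hform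
  have m₁ := min_groundEnergy_mul_le hV hf₁ v₁
  have m₂ := min_groundEnergy_mul_le hV hf₂ v₂
  have hpos : 0 < (∫ x, f₁ x ^ 2) + ∫ x, f₂ x ^ 2 := by
    have := norm_sq_eq_integral hf₁.integrable_f_sq hf₂.integrable_f_sq hf₁.f_zero hf₂.f_zero r1
    rw [← this]
    have := norm_pos_iff.2 hαβ
    positivity
  refine le_of_mul_le_mul_right ?_ hpos
  linarith

/-- Splitting the interval at `y` bounds the second eigenvalue from below. -/
theorem min_groundEnergy_le_eigenvalue_two {L : ℝ} (hL : 0 < L) {V : ℝ → ℝ} (hV : IsPot V) {y : ℝ}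
    (hy : y ∈ box L) :
    min (groundEnergy (-L / 2) y V) (groundEnergy y (L / 2) V) ≤ eigenvalue L V 2 := by
  -- the set of levels above two eigenvalues is nonempty, so that the infimum over it is genuine
  refine le_csInf ?_ fun E hE => min_groundEnergy_le_of_two_le_eigenCount hL hV hy hE
  obtain ⟨ψ₁, e₁, h0₁, hψ₁, -⟩ := exists_eigenvector_le_groundEnergy hL hV
  -- `L²(Λ)` is not a line: two disjoint indicator functions
  have hK : ∃ χ : L2 L, χ ∉ Submodule.span ℂ {ψ₁} := by
    by_contra! hcon
    have hcon' : ∀ y z : ℝ, y < z → y ∈ Icc (-L / 2) (L / 2) → z ∈ Icc (-L / 2) (L / 2) →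
        ∃ c : ℂ, ψ₁ = c • (indicatorConstLp 2 (measurableSet_Ioo (a := y) (b := z))
          (measure_ne_top (volume.restrict (box L)) _) (1 : ℂ) : L2 L) := by
      intro y z hyz hy hz
      obtain ⟨c, hc⟩ := Submodule.mem_span_singleton.1 (hcon (indicatorConstLp 2
        (measurableSet_Ioo (a := y) (b := z)) (measure_ne_top (volume.restrict (box L)) _) (1 : ℂ)))
      have hc0 : c ≠ 0 := by
        rintro rfl
        rw [zero_smul] at hc
        have h1 := congrArg norm hc
        rw [norm_zero, norm_indicatorConstLp (by norm_num) (by norm_num), norm_one, one_mul,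
          measureReal_restrict_apply measurableSet_Ioo,
          inter_eq_left.2 (show Ioo y z ⊆ box L from Ioo_subset_Ioo hy.1 hz.2),
          Real.volume_real_Ioo_of_le hyz.le] at h1
        have : 0 < (z - y) ^ (1 / (2 : ENNReal).toReal) :=
          Real.rpow_pos_of_pos (sub_pos.2 hyz) _
        linarith
      exact ⟨c⁻¹, by rw [← hc, smul_smul, inv_mul_cancel₀ hc0, one_smul]⟩
    obtain ⟨c, hc⟩ := hcon' (-L / 2) 0 (by linarith) ⟨le_rfl, by linarith⟩
      ⟨by linarith, by linarith⟩
    obtain ⟨d, hd⟩ := hcon' 0 (L / 2) (by linarith) ⟨by linarith, by linarith⟩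
      ⟨by linarith, le_rfl⟩
    refine h0₁ (inner_self_eq_zero (𝕜 := ℂ).1 ?_)
    nth_rewrite 1 [hc]
    rw [hd, inner_smul_left, inner_smul_right, L2.inner_indicatorConstLp_one,
      setIntegral_congr_ae (g := fun _ => (0 : ℂ)) measurableSet_Ioo]
    · simp
    · filter_upwards [indicatorConstLp_coeFn (p := 2)
        (hs := measurableSet_Ioo (a := (0 : ℝ)) (b := L / 2))
        (hμs := measure_ne_top (volume.restrict (box L)) _) (c := (1 : ℂ))] with x hx hx2
      rw [hx, indicator_of_notMem fun h => by linarith [h.1, hx2.2]]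
  obtain ⟨ψ₂, τ, hn, hτ, hT⟩ := exists_eigenvector_notMem_span (isCompactOperator_formEmb hL hV)
    (denseRange_formEmb L hV) ψ₁ hK
  have hψ₂ := mem_eigenspace_of_formEmb hV hτ hT
  set e₂ := τ⁻¹ - 1
  refine ⟨max e₁ e₂, ?_⟩
  have hm₁ : ψ₁ ∈ (⨆ e : Iic (max e₁ e₂), eigenspace L V (e : ℝ) : Submodule ℂ (L2 L)) :=
    (le_iSup (fun e : Iic (max e₁ e₂) => eigenspace L V (e : ℝ)) ⟨e₁, mem_Iic.2 (le_max_left _ _)⟩) hψ₁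
  have hm₂ : ψ₂ ∈ (⨆ e : Iic (max e₁ e₂), eigenspace L V (e : ℝ) : Submodule ℂ (L2 L)) :=
    (le_iSup (fun e : Iic (max e₁ e₂) => eigenspace L V (e : ℝ)) ⟨e₂, mem_Iic.2 (le_max_right _ _)⟩) hψ₂
  have hli : LinearIndependent ℂ ![(⟨ψ₁, hm₁⟩ : (⨆ e : Iic (max e₁ e₂),
      eigenspace L V (e : ℝ) : Submodule ℂ (L2 L))), ⟨ψ₂, hm₂⟩] := by
    rw [LinearIndependent.pair_iff' (fun h => h0₁ (congrArg Subtype.val h))]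
    intro a ha
    exact hn (Submodule.mem_span_singleton.2 ⟨a, congrArg Subtype.val ha⟩)
  have := hli.cardinal_le_rank
  simpa [eigenCount] using this

/-! ### Lower bounds for the quadratic form -/

/-- Integration by parts for `f² h` with `h` continuously differentiable. -/
theorem IsTrial.sq_mul_sub {a b : ℝ} {f g : ℝ → ℝ} (hf : IsTrial a b f g) {x y : ℝ} (hxy : x ≤ y)
    {h h' : ℝ → ℝ} (hd : ∀ t ∈ Icc x y, HasDerivAt h (h' t) t) (hc : ContinuousOn h' (Icc x y)) :
    f y ^ 2 * h y - f x ^ 2 * h x = ∫ t in x..y, (2 * (f t * g t) * h t + f t ^ 2 * h' t) := by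
  -- a global primitive that agrees with `h` on `[x, y]`
  set γ : ℝ → ℝ := (Icc x y).indicator h' with hγ
  have hγi : Integrable γ := (integrable_indicator_iff measurableSet_Icc).2 hc.integrableOn_Icc
  set H : ℝ → ℝ := fun z => h x + ∫ t in x..z, γ t with hH
  have hHh : ∀ z ∈ Icc x y, H z = h z := by
    intro z hz
    have e1 : ∫ t in x..z, γ t = ∫ t in x..z, h' t := by
      apply intervalIntegral.integral_congr_ae
      filter_upwards with t ht
      rw [uIoc_of_le hz.1] at ht
      exact indicator_of_mem (show t ∈ Icc x y from ⟨ht.1.le, ht.2.trans hz.2⟩) _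
    have e2 : ∫ t in x..z, h' t = h z - h x := by
      refine intervalIntegral.integral_eq_sub_of_hasDerivAt (fun t ht => ?_) ?_
      · rw [uIcc_of_le hz.1] at ht
        exact hd t ⟨ht.1, ht.2.trans hz.2⟩
      · refine (hc.mono ?_).intervalIntegrable
        rw [uIcc_of_le hz.1]
        exact Icc_subset_Icc_right hz.2
    simp only [hH]
    rw [e1, e2]
    ring
  have hfg : LocallyIntegrable (fun t => g t * f t + f t * g t) := by
    have h1 : Integrable (fun t => g t * f t) :=
      (hf.memLp.integrable_mul hf.memLp_self (p := 2) (q := 2))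
    have h2 : Integrable (fun t => f t * g t) :=
      (hf.memLp_self.integrable_mul hf.memLp (p := 2) (q := 2))
    exact (h1.add h2).locallyIntegrable
  have hsq : ∀ s t, f t * f t - f s * f s = ∫ u in s..t, (g u * f u + f u * g u) := fun s t =>
    primitive_mul hf.integrable.locallyIntegrable hf.integrable.locallyIntegrable hf.ftc hf.ftc s t
  have hHp : ∀ s t, H t - H s = ∫ u in s..t, γ u := by
    intro s t
    simp only [hH]
    rw [add_sub_add_left_eq_sub, intervalIntegral.integral_interval_sub_left
      hγi.intervalIntegrable hγi.intervalIntegrable]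
  have := primitive_mul hfg hγi.locallyIntegrable hsq hHp x y
  rw [hHh y ⟨hxy, le_rfl⟩, hHh x ⟨le_rfl, hxy⟩] at this
  rw [sq, sq, this]
  apply intervalIntegral.integral_congr_ae
  filter_upwards with t ht
  rw [uIoc_of_le hxy] at ht
  have ht' : t ∈ Icc x y := ⟨ht.1.le, ht.2⟩
  rw [hHh t ht', hγ, indicator_of_mem ht']
  ring

/-- The lower bound for the form on an interval with Robin boundary conditions, from the trial
ground state `cos (k (t - c))`, `c` the midpoint. -/
theorem IsTrial.robin {a b : ℝ} {f g : ℝ → ℝ} (hf : IsTrial a b f g) {x y k ℓ : ℝ} (hxy : x ≤ y)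
    (hℓ : y - x ≤ ℓ) (hk : 0 ≤ k) (hkℓ : k * ℓ < Real.pi) :
    k ^ 2 * ∫ t in x..y, f t ^ 2 ≤ (∫ t in x..y, g t ^ 2) +
      k * Real.tan (k * ℓ / 2) * (f x ^ 2 + f y ^ 2) := by
  set c := (x + y) / 2 with hc
  have hpi := Real.pi_pos
  have hkl : k * (y - x) ≤ k * ℓ := mul_le_mul_of_nonneg_left hℓ hk
  have hrange : ∀ t ∈ Icc x y, k * (t - c) ∈ Ioo (-(Real.pi / 2)) (Real.pi / 2) := by
    intro t ht
    have h1 : k * (t - c) ≤ k * ((y - x) / 2) :=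
      mul_le_mul_of_nonneg_left (by linarith [ht.2]) hk
    have h2 : k * (-((y - x) / 2)) ≤ k * (t - c) :=
      mul_le_mul_of_nonneg_left (by linarith [ht.1]) hk
    constructor <;> nlinarith
  have hcos : ∀ t ∈ Icc x y, Real.cos (k * (t - c)) ≠ 0 := fun t ht =>
    (Real.cos_pos_of_mem_Ioo (hrange t ht)).ne'
  set h : ℝ → ℝ := fun t => -(k * Real.tan (k * (t - c))) with hh
  set h' : ℝ → ℝ := fun t => -(k * ((1 / Real.cos (k * (t - c)) ^ 2) * k)) with hh'
  have hd : ∀ t ∈ Icc x y, HasDerivAt h (h' t) t := by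
    intro t ht
    have h1 : HasDerivAt (fun t => k * (t - c)) k t := by
      simpa using ((hasDerivAt_id t).sub_const c).const_mul k
    exact (((Real.hasDerivAt_tan (hcos t ht)).comp t h1).const_mul k).neg
  have hcont : ContinuousOn h' (Icc x y) := by
    refine (ContinuousOn.mul continuousOn_const (ContinuousOn.mul (ContinuousOn.div
      continuousOn_const (by fun_prop) fun t ht => pow_ne_zero 2 (hcos t ht)) continuousOn_const)).neg
  have hcontH : ContinuousOn h (Icc x y) := fun t ht => (hd t ht).continuousAt.continuousWithinAt
  have hric : ∀ t ∈ Icc x y, h' t = -k ^ 2 - h t ^ 2 := by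
    intro t ht
    simp only [hh, hh']
    rw [Real.tan_eq_sin_div_cos]
    have hne := hcos t ht
    field_simp
    linear_combination (k ^ 2) * (Real.sin_sq_add_cos_sq (k * (t - c)))
  have hint := hf.sq_mul_sub hxy hd hcont
  -- integrate `(g - h f)² ≥ 0`
  have hu : uIcc x y = Icc x y := uIcc_of_le hxy
  have hgi : IntervalIntegrable (fun t => g t ^ 2) volume x y := hf.integrable_sq.intervalIntegrable
  have hfi : IntervalIntegrable (fun t => f t ^ 2) volume x y :=
    (hf.continuous.pow 2).intervalIntegrable _ _
  have hdi : IntervalIntegrable (fun t => 2 * (f t * g t) * h t + f t ^ 2 * h' t) volume x y := by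
    refine IntervalIntegrable.add ?_ ?_
    · have h0 : IntervalIntegrable (fun t => g t * (2 * f t * h t)) volume x y :=
        hf.integrable.intervalIntegrable.mul_continuousOn (by
          rw [hu]; exact (continuousOn_const.mul hf.continuous.continuousOn).mul hcontH)
      refine h0.congr (fun t _ => by ring)
    · refine ContinuousOn.intervalIntegrable ?_
      rw [hu]
      exact (hf.continuous.pow 2).continuousOn.mul hcont
  have hmono : ∫ t in x..y, ((2 * (f t * g t) * h t + f t ^ 2 * h' t) + k ^ 2 * f t ^ 2) ≤
      ∫ t in x..y, g t ^ 2 := by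
    refine intervalIntegral.integral_mono_on hxy (hdi.add (hfi.const_mul _)) hgi fun t ht => ?_
    rw [hric t ht]
    nlinarith [sq_nonneg (g t - h t * f t)]
  rw [intervalIntegral.integral_add hdi (hfi.const_mul _), ← hint,
    intervalIntegral.integral_const_mul] at hmono
  have e1 : h y = -(k * Real.tan (k * (y - x) / 2)) := by
    simp only [hh, hc]; congr 3; ring
  have e2 : h x = k * Real.tan (k * (y - x) / 2) := by
    simp only [hh, hc]
    rw [show k * (x - (x + y) / 2) = -(k * (y - x) / 2) by ring, Real.tan_neg]
    ring
  have htan : Real.tan (k * (y - x) / 2) ≤ Real.tan (k * ℓ / 2) := by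
    rcases hkl.eq_or_lt with h0 | h0
    · rw [h0]
    · have : 0 ≤ k * (y - x) := mul_nonneg hk (by linarith)
      exact (Real.tan_lt_tan_of_lt_of_lt_pi_div_two (by linarith) (by linarith) (by linarith)).le
  rw [e1, e2] at hmono
  have h3 : k * Real.tan (k * (y - x) / 2) * (f x ^ 2 + f y ^ 2) ≤
      k * Real.tan (k * ℓ / 2) * (f x ^ 2 + f y ^ 2) := by gcongr
  nlinarith

/-! ### Block decompositions -/

/-- A run of `m` consecutive unoccupied blocks among the blocks `1, …, n`, the first being `s`. -/
def IsRun (occ : ℕ → Prop) (n m s : ℕ) : Prop :=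
  1 ≤ s ∧ s + m ≤ n + 1 ∧ ∀ j, s ≤ j → j < s + m → ¬ occ j

/-- Block `l` belongs to a run of `m` unoccupied blocks or is adjacent to one. -/
def NearRun (occ : ℕ → Prop) (n m l : ℕ) : Prop :=
  ∃ s, IsRun occ n m s ∧ s ≤ l + 1 ∧ l ≤ s + m

/-- The `j`-th block of length `r`, counted from `a`. -/
def block (a r : ℝ) (j : ℕ) : Set ℝ := Ioc (a + (j - 1) * r) (a + j * r)

/-- The union of the blocks `1, …, n` that belong or are adjacent to a run. -/
def runRegion (a r : ℝ) (occ : ℕ → Prop) (n m : ℕ) : Set ℝ :=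
  ⋃ l ∈ {l | 1 ≤ l ∧ l ≤ n ∧ NearRun occ n m l}, block a r l

theorem measurableSet_runRegion (a r : ℝ) (occ : ℕ → Prop) (n m : ℕ) :
    MeasurableSet (runRegion a r occ n m) :=
  MeasurableSet.biUnion (to_countable _) fun _ _ => measurableSet_Ioc

theorem exists_mem_block {a r x : ℝ} (hr : 0 < r) (hx : a < x) :
    ∃ l : ℕ, 1 ≤ l ∧ x ∈ block a r l := by
  have h0 : 0 < (x - a) / r := div_pos (by linarith) hr
  refine ⟨⌈(x - a) / r⌉₊, Nat.one_le_ceil_iff.2 h0, ?_, ?_⟩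
  · have := Nat.ceil_lt_add_one h0.le
    have h1 : (⌈(x - a) / r⌉₊ : ℝ) - 1 < (x - a) / r := by linarith
    rw [lt_div_iff₀ hr] at h1
    linarith
  · have := Nat.le_ceil ((x - a) / r)
    rw [div_le_iff₀ hr] at this
    linarith

/-- The induction behind `sq_mul_integral_le_formEnergy`: the quadratic form is bounded from below
cell by cell, a cell being the interval between consecutive nodes `z i`, `z j`; each node lends half
of its weight `v` to either of its two cells. Only cells of fewer than `m` free blocks count. -/
theorem sum_cells_le {a b r c₀ k : ℝ} {n m : ℕ} (hr : 0 < r) (hb : b = a + n * r) {f g : ℝ → ℝ}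
    (hf : IsTrial a b f g) {occ : ℕ → Prop} {z v : ℕ → ℝ}
    (hocc0 : occ 0) (hz0 : z 0 = a)
    (hz : ∀ j, occ j → j ≤ n + 1 → z j ∈ Icc (a + (j - 1) * r) (a + j * r) ∧ z j ≤ b)
    (hv : ∀ j, 0 ≤ v j) (hfv : ∀ j, occ j → j ≤ n + 1 → c₀ * f (z j) ^ 2 ≤ v j)
    (hk : 0 ≤ k) (hkπ : k * ((m + 1) * r) < Real.pi)
    (hkc : k * Real.tan (k * ((m + 1) * r) / 2) ≤ c₀ / 2) :
    ∀ j, occ j → j ≤ n + 1 →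
      k ^ 2 * ∫ x in a..z j, ((runRegion a r occ n m)ᶜ).indicator (fun x => f x ^ 2) x ≤
        (∫ x in a..z j, g x ^ 2) + (∑ i ∈ Finset.range j, v i) + v j / 2 := by
  classical
  set F := ((runRegion a r occ n m)ᶜ).indicator (fun x => f x ^ 2) with hF
  have hFi : Integrable F := hf.integrable_f_sq.indicator (measurableSet_runRegion a r occ n m).compl
  intro j
  induction j using Nat.strong_induction_on with
  | _ j ih =>
  intro hj hjn
  rcases Nat.eq_zero_or_pos j with rfl | hjpos
  · rw [hz0]
    simp only [intervalIntegral.integral_same, mul_zero, Finset.range_zero, Finset.sum_empty]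
    linarith [hv 0]
  -- the preceding node
  obtain ⟨i, hij, hi, hbetween⟩ : ∃ i < j, occ i ∧ ∀ l, i < l → l < j → ¬ occ l := by
    set i := Nat.findGreatest occ (j - 1) with hidef
    refine ⟨i, by have := Nat.findGreatest_le (P := occ) (j - 1); omega,
      Nat.findGreatest_spec (m := 0) (Nat.zero_le _) hocc0, fun l h1 h2 =>
      Nat.findGreatest_is_greatest h1 (by omega)⟩
  have hin : i ≤ n + 1 := by omega
  have hIH := ih i hij hi hin
  obtain ⟨⟨zi1, zi2⟩, zib⟩ := hz i hi hin
  obtain ⟨⟨zj1, zj2⟩, zjb⟩ := hz j hj hjn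
  have hij' : (i : ℝ) + 1 ≤ j := by exact_mod_cast hij
  have hzij : z i ≤ z j := by nlinarith
  have hgi : ∀ x y, IntervalIntegrable (fun t => g t ^ 2) volume x y := fun x y =>
    hf.integrable_sq.intervalIntegrable
  rw [← intervalIntegral.integral_add_adjacent_intervals (b := z i) hFi.intervalIntegrable
      hFi.intervalIntegrable,
    ← intervalIntegral.integral_add_adjacent_intervals (b := z i) (hgi _ _) (hgi _ _)]
  have hsum : (∑ l ∈ Finset.range i, v l) + v i ≤ ∑ l ∈ Finset.range j, v l := by
    rw [← Finset.sum_range_succ]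
    exact Finset.sum_le_sum_of_subset_of_nonneg (Finset.range_subset_range.2 hij)
      fun l _ _ => hv l
  have hcell : k ^ 2 * ∫ x in z i..z j, F x ≤ (∫ x in z i..z j, g x ^ 2) + v i / 2 + v j / 2 := by
    by_cases hm : j ≤ i + m
    · have hlen : z j - z i ≤ (m + 1) * r := by
        have : (j : ℝ) ≤ i + m := by exact_mod_cast hm
        nlinarith
      have hrob := hf.robin hzij hlen hk hkπ
      have hle : ∫ x in z i..z j, F x ≤ ∫ x in z i..z j, f x ^ 2 := by
        refine intervalIntegral.integral_mono_on hzij hFi.intervalIntegrable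
          ((hf.continuous.pow 2).intervalIntegrable _ _) fun x _ => ?_
        exact indicator_le_self' (fun _ _ => sq_nonneg _) x
      have h1 := hfv i hi hin
      have h2 := hfv j hj hjn
      have h3 : k * Real.tan (k * ((m + 1) * r) / 2) * (f (z i) ^ 2 + f (z j) ^ 2) ≤
          c₀ / 2 * (f (z i) ^ 2 + f (z j) ^ 2) := by gcongr
      have h4 : k ^ 2 * ∫ x in z i..z j, F x ≤ k ^ 2 * ∫ x in z i..z j, f x ^ 2 := by gcongr
      linarith
    · have hzero : ∫ x in z i..z j, F x = 0 := by
        rw [intervalIntegral.integral_congr_ae (g := fun _ => (0 : ℝ)),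
          intervalIntegral.integral_zero]
        filter_upwards with x hx
        rw [uIoc_of_le hzij] at hx
        have hax : a < x := by
          have h0 : (0 : ℝ) ≤ i := i.cast_nonneg
          rcases Nat.eq_zero_or_pos i with h | h
          · rw [h, hz0] at hx; exact hx.1
          · have : (1 : ℝ) ≤ i := by exact_mod_cast h
            nlinarith [hx.1]
        obtain ⟨l, hl1, hl2, hl3⟩ := exists_mem_block hr hax
        have hil : i ≤ l := by
          have h1 : ((i : ℝ) - 1) * r < l * r := by linarith [hx.1]
          have h2 : (i : ℝ) - 1 < l := lt_of_mul_lt_mul_right h1 hr.le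
          have h3 : (i : ℝ) < l + 1 := by linarith
          have : i < l + 1 := by exact_mod_cast h3
          omega
        have hlj : l ≤ j := by
          have h1 : ((l : ℝ) - 1) * r < j * r := by linarith [hx.2]
          have h2 : (l : ℝ) - 1 < j := lt_of_mul_lt_mul_right h1 hr.le
          have h3 : (l : ℝ) < j + 1 := by linarith
          have : l < j + 1 := by exact_mod_cast h3
          omega
        have hln : l ≤ n := by
          have h1 : ((l : ℝ) - 1) * r < n * r := by linarith [hx.2]
          have h2 : (l : ℝ) - 1 < n := lt_of_mul_lt_mul_right h1 hr.le
          have h3 : (l : ℝ) < n + 1 := by linarith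
          have : l < n + 1 := by exact_mod_cast h3
          omega
        refine indicator_of_notMem (notMem_compl_iff.2 ?_) _
        refine mem_biUnion (x := l) ⟨hl1, hln, max (i + 1) (min l (j - m)), ⟨?_, ?_, ?_⟩, ?_, ?_⟩
          ⟨hl2, hl3⟩
        · omega
        · omega
        · intro l' h1 h2
          exact hbetween l' (by omega) (by omega)
        · omega
        · omega
      rw [hzero, mul_zero]
      have : 0 ≤ ∫ x in z i..z j, g x ^ 2 :=
        intervalIntegral.integral_nonneg hzij fun _ _ => sq_nonneg _
      linarith [hv i, hv j]
  rw [mul_add]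
  linarith

theorem block_disjoint {a r : ℝ} (hr : 0 < r) {i j : ℕ} (hij : i ≠ j) :
    Disjoint (block a r i) (block a r j) := by
  wlog h : i < j generalizing i j
  · exact (this hij.symm (by omega)).symm
  rw [Set.disjoint_left]
  intro x hx hx'
  have : (i : ℝ) + 1 ≤ j := by exact_mod_cast h
  have h1 := hx.2
  have h2 := hx'.1
  nlinarith

theorem sum_setIntegral_block_le {a r : ℝ} (hr : 0 < r) {F : ℝ → ℝ} (hF : Integrable F)
    (h0 : ∀ x, 0 ≤ F x) (s : Finset ℕ) : ∑ j ∈ s, ∫ x in block a r j, F x ≤ ∫ x, F x := by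
  have := integral_biUnion_finset (μ := volume) (f := F) s (s := block a r)
    (fun _ _ => measurableSet_Ioc) (fun i _ j _ hij => block_disjoint hr hij)
    (fun _ _ => hF.integrableOn)
  rw [← this]
  exact setIntegral_le_integral hF (ae_of_all _ h0)

/-- If every occupied block carries a fixed amount of potential, the quadratic form is bounded from
below by `k²` on the region away from long runs of unoccupied blocks. -/
theorem sq_mul_integral_le_formEnergy {a b r c₀ k : ℝ} {n m : ℕ} (hr : 0 < r) (hb : b = a + n * r)
    {V f g : ℝ → ℝ} (hV : IsPot V) (hf : IsTrial a b f g) {occ : ℕ → Prop}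
    (hocc : ∀ j, 1 ≤ j → j ≤ n → occ j → c₀ ≤ ∫ x in block a r j, V x)
    (hk : 0 ≤ k) (hkπ : k * ((m + 1) * r) < Real.pi)
    (hkc : k * Real.tan (k * ((m + 1) * r) / 2) ≤ c₀ / 2) :
    k ^ 2 * ∫ x, ((runRegion a r occ n m)ᶜ).indicator (fun x => f x ^ 2) x ≤
      formEnergy V f g := by
  classical
  have hab : a ≤ b := by rw [hb]; nlinarith [n.cast_nonneg (α := ℝ), mul_nonneg n.cast_nonneg hr.le (α := ℝ)]
  -- the endpoints serve as additional nodes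
  set occ' : ℕ → Prop := fun j => j = 0 ∨ j = n + 1 ∨ occ j with hocc'
  have hregion : runRegion a r occ' n m = runRegion a r occ n m := by
    have hrun : ∀ s, IsRun occ' n m s ↔ IsRun occ n m s := by
      intro s
      refine and_congr_right fun h1 => and_congr_right fun h2 => ?_
      refine forall_congr' fun j => forall_congr' fun h3 => forall_congr' fun h4 => ?_
      simp only [hocc', not_or]
      exact ⟨fun h => h.2.2, fun h => ⟨by omega, by omega, h⟩⟩
    have hnear : ∀ l, NearRun occ' n m l ↔ NearRun occ n m l := fun l =>
      exists_congr fun s => and_congr_left fun _ => hrun s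
    unfold runRegion
    simp only [hnear]
  have hz : ∀ j, ∃ z, occ' j → j ≤ n + 1 → (z ∈ Icc (a + (j - 1) * r) (a + j * r) ∧ z ≤ b) ∧
      (j = 0 → z = a) ∧ (j = n + 1 → z = b) ∧
      c₀ * f z ^ 2 ≤ (if 1 ≤ j ∧ j ≤ n then ∫ x in block a r j, V x * f x ^ 2 else 0) := by
    intro j
    by_cases h0 : j = 0
    · subst h0
      refine ⟨a, fun _ _ => ⟨⟨⟨by push_cast; linarith, by push_cast; linarith⟩, hab⟩, fun _ => rfl,
        fun h => absurd h (by omega), ?_⟩⟩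
      rw [hf.f_zero a (fun h => lt_irrefl _ h.1), if_neg (by omega)]
      simp
    by_cases hn : j = n + 1
    · subst hn
      refine ⟨b, fun _ _ => ⟨⟨⟨by push_cast; linarith, by push_cast; linarith⟩, le_rfl⟩,
        fun h => absurd h (by omega), fun _ => rfl, ?_⟩⟩
      rw [hf.f_zero b (fun h => lt_irrefl _ h.2), if_neg (by omega)]
      simp
    · obtain ⟨z, hzmem, hzmin⟩ := (isCompact_Icc (a := a + (j - 1) * r) (b := a + j * r)).exists_isMinOn
        (nonempty_Icc.2 (by nlinarith)) (hf.continuous.pow 2).continuousOn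
      refine ⟨z, fun ho hjn => ⟨⟨hzmem, ?_⟩, fun h => absurd h h0, fun h => absurd h hn, ?_⟩⟩
      · refine hzmem.2.trans ?_
        rw [hb]
        have : (j : ℝ) ≤ n := by exact_mod_cast (by omega : j ≤ n)
        gcongr
      · have ho' : occ j := by
          rcases ho with h | h | h
          · exact absurd h h0
          · exact absurd h hn
          · exact h
        rw [if_pos ⟨by omega, by omega⟩]
        have h1 := hocc j (by omega) (by omega) ho'
        calc c₀ * f z ^ 2 ≤ (∫ x in block a r j, V x) * f z ^ 2 := by gcongr
          _ = ∫ x in block a r j, V x * f z ^ 2 := (integral_mul_const _ _).symm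
          _ ≤ ∫ x in block a r j, V x * f x ^ 2 := by
            have hVi : IntegrableOn V (block a r j) := by
              obtain ⟨C, hC⟩ := hV.bdd (max |a + (j - 1) * r| |a + j * r|)
              refine Measure.integrableOn_of_bounded (M := C) (by simp [block])
                hV.meas.aestronglyMeasurable ?_
              filter_upwards [ae_restrict_mem measurableSet_Ioc] with x hx
              rw [Real.norm_of_nonneg (hV.nonneg x)]
              refine hC x ⟨?_, ?_⟩
              · linarith [hx.1, neg_abs_le (a + (j - 1) * r),
                  le_max_left |a + (j - 1) * r| |a + j * r|]
              · linarith [hx.2, le_abs_self (a + j * r),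
                  le_max_right |a + (j - 1) * r| |a + j * r|]
            refine setIntegral_mono_on (hVi.mul_const _) (hf.integrable_pot hV).integrableOn
              measurableSet_Ioc fun x hx => ?_
            exact mul_le_mul_of_nonneg_left (hzmin ⟨hx.1.le, hx.2⟩) (hV.nonneg x)
  choose z hz using hz
  set v : ℕ → ℝ := fun j => if 1 ≤ j ∧ j ≤ n then ∫ x in block a r j, V x * f x ^ 2 else 0 with hv
  have hVf0 : ∀ x, 0 ≤ V x * f x ^ 2 := fun x => mul_nonneg (hV.nonneg x) (sq_nonneg _)
  have hv0 : ∀ j, 0 ≤ v j := by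
    intro j
    simp only [hv]
    split_ifs
    · exact integral_nonneg fun x => hVf0 x
    · exact le_rfl
  have hn1 : occ' (n + 1) := Or.inr (Or.inl rfl)
  have hmain := sum_cells_le (c₀ := c₀) (v := v) hr hb hf (occ := occ') (Or.inl rfl)
    ((hz 0 (Or.inl rfl) (by omega)).2.1 rfl) (fun j h1 h2 => (hz j h1 h2).1) hv0
    (fun j h1 h2 => (hz j h1 h2).2.2.2) hk hkπ hkc (n + 1) hn1 le_rfl
  rw [(hz (n + 1) hn1 le_rfl).2.2.1 rfl, hregion] at hmain
  have hext : ∀ F : ℝ → ℝ, (∀ x, x ∉ Ioo a b → F x = 0) → ∫ x in a..b, F x = ∫ x, F x := by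
    intro F hF
    rw [intervalIntegral.integral_of_le hab]
    exact setIntegral_eq_integral_of_forall_compl_eq_zero fun x hx =>
      hF x fun h => hx (Ioo_subset_Ioc_self h)
  rw [hext _ fun x hx => by simp [indicator, hf.f_zero x hx],
    hext _ fun x hx => by simp [hf.g_zero x hx]] at hmain
  have hvn : v (n + 1) = 0 := if_neg (by omega)
  have hsum : ∑ i ∈ Finset.range (n + 1), v i ≤ ∫ x, V x * f x ^ 2 := by
    simp only [hv]
    rw [← Finset.sum_filter]
    exact sum_setIntegral_block_le hr (hf.integrable_pot hV) hVf0 _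
  unfold formEnergy
  linarith

/-! ### Localization of low-energy trial functions -/

/-- Without runs the form is bounded from below by `k²`. -/
theorem sq_le_groundEnergy {a b r c₀ k : ℝ} {n m : ℕ} (hr : 0 < r) (hb : b = a + n * r)
    (hab : a < b) {V : ℝ → ℝ} (hV : IsPot V) {occ : ℕ → Prop}
    (hocc : ∀ j, 1 ≤ j → j ≤ n → occ j → c₀ ≤ ∫ x in block a r j, V x)
    (hk : 0 ≤ k) (hkπ : k * ((m + 1) * r) < Real.pi)
    (hkc : k * Real.tan (k * ((m + 1) * r) / 2) ≤ c₀ / 2) (hrun : ∀ s, ¬ IsRun occ n m s) :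
    k ^ 2 ≤ groundEnergy a b V := by
  refine le_groundEnergy hab fun f g hf h1 => ?_
  have h := sq_mul_integral_le_formEnergy hr hb hV hf hocc hk hkπ hkc
  have hR : runRegion a r occ n m = ∅ := by
    simp only [runRegion, iUnion_eq_empty]
    rintro l ⟨-, -, s, hs, -⟩
    exact absurd hs (hrun s)
  rw [hR, compl_empty, indicator_univ, h1, mul_one] at h
  exact h

/-- Near the right end of the interval, away from long runs, the form is at least `k²`. -/
theorem sq_mul_integral_le_of_forall_not_isRun {a b r c₀ k A : ℝ} {n m : ℕ} (hr : 0 < r)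
    (hb : b = a + n * r) (hA : a ≤ b - A) {V f g : ℝ → ℝ} (hV : IsPot V)
    (hf : IsTrial (b - A) b f g) {occ : ℕ → Prop}
    (hocc : ∀ j, 1 ≤ j → j ≤ n → occ j → c₀ ≤ ∫ x in block a r j, V x)
    (hk : 0 ≤ k) (hkπ : k * ((m + 1) * r) < Real.pi)
    (hkc : k * Real.tan (k * ((m + 1) * r) / 2) ≤ c₀ / 2)
    (hrun : ∀ s, IsRun occ n m s → a + (s + m) * r ≤ b - A) :
    k ^ 2 * ∫ x, f x ^ 2 ≤ formEnergy V f g := by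
  have h := sq_mul_integral_le_formEnergy hr hb hV (hf.mono hA le_rfl) hocc hk hkπ hkc
  convert h using 3
  funext x
  by_cases hx : x ∈ runRegion a r occ n m
  · rw [indicator_of_notMem (notMem_compl_iff.2 hx)]
    simp only [runRegion, mem_iUnion] at hx
    obtain ⟨l, ⟨-, -, s, hs, h1, h2⟩, hxl⟩ := hx
    have h3 := hrun s hs
    have h4 : (l : ℝ) * r ≤ (s + m) * r := by
      have : (l : ℝ) ≤ s + m := by exact_mod_cast h2
      gcongr
    rw [hf.f_zero x fun h5 => by linarith [hxl.2, h5.1]]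
    ring
  · rw [indicator_of_mem (mem_compl hx)]

/-- Localization with a smooth partition of unity: if the form is at least `k²` near the right end
of an interval, the interval can be shortened at little cost in energy. -/
theorem exists_localization_const : ∃ K : ℝ, 0 < K ∧ ∀ {a b A k : ℝ} {V f g : ℝ → ℝ}, 0 < A →
    IsPot V → IsTrial a b f g → ∫ x, f x ^ 2 = 1 →
    (∀ h h', IsTrial (b - A) b h h' → k ^ 2 * ∫ x, h x ^ 2 ≤ formEnergy V h h') →
    a ≤ b - A → formEnergy V f g + K / A ^ 2 < k ^ 2 →
    groundEnergy a (b - A / 2) V ≤ formEnergy V f g + K / A ^ 2 := by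
  set T := Real.smoothTransition with hT
  have hTs : ContDiff ℝ 1 T := Real.smoothTransition.contDiff (n := 1)
  have hTd : ∀ s, HasDerivAt T (deriv T s) s := fun s =>
    (hTs.differentiable (by norm_num) s).hasDerivAt
  have hT'c : Continuous (deriv T) := hTs.continuous_deriv (by norm_num)
  have hT'0 : ∀ s ≤ 0, deriv T s = 0 := fun s hs => by
    refine IsLocalMin.deriv_eq_zero (Filter.Eventually.of_forall fun x => ?_)
    rw [hT, Real.smoothTransition.zero_of_nonpos hs]
    exact Real.smoothTransition.nonneg x
  have hT'1 : ∀ s, 1 ≤ s → deriv T s = 0 := fun s hs => by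
    refine IsLocalMax.deriv_eq_zero (Filter.Eventually.of_forall fun x => ?_)
    rw [hT, Real.smoothTransition.one_of_one_le hs]
    exact Real.smoothTransition.le_one x
  obtain ⟨C, hC⟩ := (isCompact_Icc (a := (0 : ℝ)) (b := 1)).exists_bound_of_continuousOn
    hT'c.continuousOn
  have hC' : ∀ s, deriv T s ^ 2 ≤ C ^ 2 := by
    intro s
    by_cases h0 : s ≤ 0
    · rw [hT'0 s h0, zero_pow two_ne_zero]; exact sq_nonneg C
    by_cases h1 : 1 ≤ s
    · rw [hT'1 s h1, zero_pow two_ne_zero]; exact sq_nonneg C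
    · have := hC s ⟨by linarith, by linarith⟩
      rw [Real.norm_eq_abs] at this
      exact sq_le_sq' (by linarith [neg_abs_le (deriv T s)]) ((le_abs_self _).trans this)
  refine ⟨(Real.pi * C) ^ 2 + 1, by positivity, ?_⟩
  intro a b A k V f g hA hV hf hmass hright hab hlt
  set K := (Real.pi * C) ^ 2 + 1
  set φ : ℝ → ℝ := fun x => Real.pi / 2 * T ((x - (b - A)) / (A / 2)) with hφ
  set φ' : ℝ → ℝ := fun x => Real.pi / 2 * (deriv T ((x - (b - A)) / (A / 2)) * (1 / (A / 2)))
    with hφ'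
  have hφd : ∀ x, HasDerivAt φ (φ' x) x := by
    intro x
    have h1 : HasDerivAt (fun x : ℝ => (x - (b - A)) / (A / 2)) (1 / (A / 2)) x :=
      ((hasDerivAt_id x).sub_const _).div_const _
    exact ((hTd _).comp x h1).const_mul _
  have hφc : Continuous φ := continuous_iff_continuousAt.2 fun x => (hφd x).continuousAt
  have hφ'c : Continuous φ' := by simp only [hφ']; fun_prop
  have hφ'le : ∀ x, φ' x ^ 2 ≤ K / A ^ 2 := by
    intro x
    have e : φ' x ^ 2 = Real.pi ^ 2 * deriv T ((x - (b - A)) / (A / 2)) ^ 2 / A ^ 2 := by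
      simp only [hφ']; field_simp
    rw [e]
    gcongr
    have := hC' ((x - (b - A)) / (A / 2))
    calc _ ≤ Real.pi ^ 2 * C ^ 2 := by gcongr
      _ ≤ K := by simp only [K]; nlinarith
  have hφr : ∀ x, b - A / 2 ≤ x → φ x = Real.pi / 2 ∧ φ' x = 0 := by
    intro x hx
    have h1 : 1 ≤ (x - (b - A)) / (A / 2) := by rw [le_div_iff₀ (by linarith)]; linarith
    exact ⟨by simp only [hφ, hT, Real.smoothTransition.one_of_one_le h1, mul_one],
      by simp only [hφ', hT'1 _ h1, zero_mul, mul_zero]⟩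
  have hφl : ∀ x, x ≤ b - A → φ x = 0 ∧ φ' x = 0 := by
    intro x hx
    have h1 : (x - (b - A)) / (A / 2) ≤ 0 :=
      div_nonpos_of_nonpos_of_nonneg (by linarith) (by linarith)
    exact ⟨by simp only [hφ, hT, Real.smoothTransition.zero_of_nonpos h1, mul_zero],
      by simp only [hφ', hT'0 _ h1, zero_mul, mul_zero]⟩
  have t1 := hf.mul_contDiff (fun x => (hφd x).cos) (by fun_prop)
  have t2 := hf.mul_contDiff (fun x => (hφd x).sin) (by fun_prop)
  have t1' : IsTrial a (b - A / 2) _ _ := ⟨t1.memLp, fun x hx => by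
      by_cases h : b - A / 2 ≤ x
      · simp [(hφr x h).1]
      · exact t1.f_zero x fun h' => hx ⟨h'.1, not_le.1 h⟩, fun x hx => by
      by_cases h : b - A / 2 ≤ x
      · simp [(hφr x h).1, (hφr x h).2]
      · exact t1.g_zero x fun h' => hx ⟨h'.1, not_le.1 h⟩, t1.ftc⟩
  have t2' : IsTrial (b - A) b _ _ := ⟨t2.memLp, fun x hx => by
      by_cases h : x ≤ b - A
      · simp [(hφl x h).1]
      · exact t2.f_zero x fun h' => hx ⟨not_le.1 h, h'.2⟩, fun x hx => by
      by_cases h : x ≤ b - A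
      · simp [(hφl x h).1, (hφl x h).2]
      · exact t2.g_zero x fun h' => hx ⟨not_le.1 h, h'.2⟩, t2.ftc⟩
  have q1 := groundEnergy_mul_le hV t1'
  have q2 := hright _ _ t2'
  have hmass' : (∫ x, (Real.cos (φ x) * f x) ^ 2) + ∫ x, (Real.sin (φ x) * f x) ^ 2 = 1 := by
    rw [← integral_add t1.integrable_f_sq t2.integrable_f_sq, ← hmass]
    congr 1
    funext x
    linear_combination (f x ^ 2) * Real.sin_sq_add_cos_sq (φ x)
  have hen : formEnergy V (fun x => Real.cos (φ x) * f x)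
        (fun x => -Real.sin (φ x) * φ' x * f x + Real.cos (φ x) * g x) +
      formEnergy V (fun x => Real.sin (φ x) * f x)
        (fun x => Real.cos (φ x) * φ' x * f x + Real.sin (φ x) * g x) ≤
      formEnergy V f g + K / A ^ 2 := by
    have e1 : (∫ x, (-Real.sin (φ x) * φ' x * f x + Real.cos (φ x) * g x) ^ 2) +
        (∫ x, (Real.cos (φ x) * φ' x * f x + Real.sin (φ x) * g x) ^ 2) ≤
        (∫ x, g x ^ 2) + K / A ^ 2 := by
      rw [← integral_add t1.integrable_sq t2.integrable_sq]
      calc _ ≤ ∫ x, (g x ^ 2 + K / A ^ 2 * f x ^ 2) := by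
            refine integral_mono (t1.integrable_sq.add t2.integrable_sq)
              (hf.integrable_sq.add (hf.integrable_f_sq.const_mul _)) fun x => ?_
            have h1 := mul_le_mul_of_nonneg_right (hφ'le x) (sq_nonneg (f x))
            have h2 := Real.sin_sq_add_cos_sq (φ x)
            have h3 : (-Real.sin (φ x) * φ' x * f x + Real.cos (φ x) * g x) ^ 2 +
                (Real.cos (φ x) * φ' x * f x + Real.sin (φ x) * g x) ^ 2 =
                φ' x ^ 2 * f x ^ 2 + g x ^ 2 := by
              linear_combination (φ' x ^ 2 * f x ^ 2 + g x ^ 2) * h2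
            simp only
            linarith
        _ = _ := by
            rw [integral_add hf.integrable_sq (hf.integrable_f_sq.const_mul _),
              integral_const_mul, hmass, mul_one]
    have e2 : (∫ x, V x * (Real.cos (φ x) * f x) ^ 2) + ∫ x, V x * (Real.sin (φ x) * f x) ^ 2 =
        ∫ x, V x * f x ^ 2 := by
      rw [← integral_add (t1.integrable_pot hV) (t2.integrable_pot hV)]
      congr 1
      funext x
      linear_combination (V x * f x ^ 2) * Real.sin_sq_add_cos_sq (φ x)
    unfold formEnergy
    linarith
  have p1 : 0 ≤ ∫ x, (Real.cos (φ x) * f x) ^ 2 := integral_nonneg fun x => sq_nonneg _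
  have p2 : 0 ≤ ∫ x, (Real.sin (φ x) * f x) ^ 2 := integral_nonneg fun x => sq_nonneg _
  by_contra! hcon
  set m1 := ∫ x, (Real.cos (φ x) * f x) ^ 2
  set m2 := ∫ x, (Real.sin (φ x) * f x) ^ 2
  set e' := formEnergy V f g + K / A ^ 2
  have h3 : (groundEnergy a (b - A / 2) V - e') * m1 + (k ^ 2 - e') * m2 ≤ 0 := by
    nlinarith
  have h4 : 0 ≤ (groundEnergy a (b - A / 2) V - e') * m1 := mul_nonneg (by linarith) p1
  have h5 : 0 ≤ (k ^ 2 - e') * m2 := mul_nonneg (by linarith) p2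
  have h6 : m1 = 0 := by
    rcases mul_eq_zero.1 (le_antisymm (by linarith) h4) with h | h
    · linarith
    · exact h
  have h7 : m2 = 0 := by
    rcases mul_eq_zero.1 (le_antisymm (by linarith) h5) with h | h
    · linarith
    · exact h
  linarith

theorem IsTrial.setIntegral_block_sq_le {a b r : ℝ} {f g : ℝ → ℝ} (hf : IsTrial a b f g)
    (hr : 0 < r) {j l : ℕ} (hjl : j ≤ l + 1) (hlj : l ≤ j + 1) :
    ∫ x in block a r l, f x ^ 2 ≤ 2 * r * f (a + (j - 1 / 2) * r) ^ 2 + 4 * r ^ 2 *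
      ((∫ x in block (a - r) r l, g x ^ 2) + (∫ x in block a r l, g x ^ 2) +
        ∫ x in block (a + r) r l, g x ^ 2) := by
  have hg0 : ∀ x, 0 ≤ g x ^ 2 := fun x => sq_nonneg _
  have hgi := hf.integrable_sq
  set c := a + ((j : ℝ) - 1 / 2) * r with hc
  have hjl' : (j : ℝ) ≤ l + 1 := by exact_mod_cast hjl
  have hlj' : (l : ℝ) ≤ j + 1 := by exact_mod_cast hlj
  have hc1 : a + (l - 2) * r ≤ c := by rw [hc]; nlinarith
  have hc2 : c ≤ a + (l + 1) * r := by rw [hc]; nlinarith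
  have hG : (∫ x in block (a - r) r l, g x ^ 2) + (∫ x in block a r l, g x ^ 2) +
      (∫ x in block (a + r) r l, g x ^ 2) = ∫ x in a + (l - 2) * r..a + (l + 1) * r, g x ^ 2 := by
    have e : ∀ a' : ℝ, ∫ x in block a' r l, g x ^ 2 =
        ∫ x in a' + (l - 1) * r..a' + l * r, g x ^ 2 := fun a' => by
      rw [intervalIntegral.integral_of_le (by nlinarith)]
      rfl
    rw [e, e, e, show a - r + ((l : ℝ) - 1) * r = a + (l - 2) * r by ring,
      show a - r + (l : ℝ) * r = a + (l - 1) * r by ring,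
      show a + r + ((l : ℝ) - 1) * r = a + l * r by ring,
      show a + r + (l : ℝ) * r = a + (l + 1) * r by ring,
      intervalIntegral.integral_add_adjacent_intervals hgi.intervalIntegrable
        hgi.intervalIntegrable,
      intervalIntegral.integral_add_adjacent_intervals hgi.intervalIntegrable
        hgi.intervalIntegrable]
  rw [hG]
  set G := ∫ x in a + (l - 2) * r..a + (l + 1) * r, g x ^ 2 with hGdef
  have hpt : ∀ y ∈ block a r l, f y ^ 2 ≤ 2 * f c ^ 2 + 4 * r * G := by
    intro y hy
    have hGle : ∀ x z, x ≤ z → a + (l - 2) * r ≤ x → z ≤ a + (l + 1) * r →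
        ∫ t in x..z, g t ^ 2 ≤ G := fun x z hxz h4 h5 =>
      intervalIntegral.integral_mono_interval h4 hxz h5 (ae_of_all _ hg0) hgi.intervalIntegrable
    have hG0 : 0 ≤ G := intervalIntegral.integral_nonneg (by nlinarith) fun x _ => hg0 x
    have hd : (f y - f c) ^ 2 ≤ 2 * r * G := by
      have hy1 := hy.1
      have hy2 := hy.2
      rcases le_total c y with hcy | hcy
      · refine (hf.sq_sub_le hcy).trans ?_
        have h6 := hGle c y hcy hc1 (by nlinarith)
        have h7 : y - c ≤ 2 * r := by rw [hc]; nlinarith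
        have h8 : 0 ≤ y - c := by linarith
        calc _ ≤ (y - c) * G := by gcongr
          _ ≤ _ := by gcongr
      · rw [← neg_sq, neg_sub]
        refine (hf.sq_sub_le hcy).trans ?_
        have h6 := hGle y c hcy (by nlinarith) hc2
        have h7 : c - y ≤ 2 * r := by rw [hc]; nlinarith
        have h8 : 0 ≤ c - y := by linarith
        calc _ ≤ (c - y) * G := by gcongr
          _ ≤ _ := by gcongr
    nlinarith [sq_nonneg (f y - 2 * f c)]
  have hfin : volume (block a r l) ≠ ⊤ := by simp [block]
  calc ∫ x in block a r l, f x ^ 2 ≤ ∫ _ in block a r l, (2 * f c ^ 2 + 4 * r * G) :=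
        setIntegral_mono_on hf.integrable_f_sq.integrableOn
          (integrableOn_const hfin) measurableSet_Ioc hpt
    _ = r * (2 * f c ^ 2 + 4 * r * G) := by
        rw [setIntegral_const, smul_eq_mul, block, measureReal_def, Real.volume_Ioc,
          ENNReal.toReal_ofReal (by nlinarith)]
        ring
    _ = _ := by ring

open Classical in
/-- The starting blocks of the runs. -/
noncomputable def runStarts (occ : ℕ → Prop) (n m : ℕ) : Finset ℕ :=
  (Finset.range (n + 2)).filter (IsRun occ n m)

/-- If there are not too many runs, a normalized trial function of low energy has an amplitude
bounded from below at the centre of some block of a run. -/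
theorem exists_le_sq_of_formEnergy_le {a b r c₀ k Q κ : ℝ} {n m D : ℕ} (hr : 0 < r)
    (hb : b = a + n * r) {V f g : ℝ → ℝ} (hV : IsPot V) (hf : IsTrial a b f g)
    (hmass : ∫ x, f x ^ 2 = 1) {occ : ℕ → Prop}
    (hocc : ∀ j, 1 ≤ j → j ≤ n → occ j → c₀ ≤ ∫ x in block a r j, V x)
    (hk : 0 < k) (hkπ : k * ((m + 1) * r) < Real.pi)
    (hkc : k * Real.tan (k * ((m + 1) * r) / 2) ≤ c₀ / 2) (hm : 1 ≤ m) (hκ : 0 ≤ κ)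
    (hQ : formEnergy V f g ≤ Q) (hD : (runStarts occ n m).card ≤ D)
    (hcond : 2 * r * κ * (D * (m + 2)) + 12 * r ^ 2 * Q < 1 - Q / k ^ 2) :
    ∃ s j, IsRun occ n m s ∧ s ≤ j ∧ j < s + m ∧ κ ≤ f (a + (j - 1 / 2) * r) ^ 2 := by
  classical
  by_contra! hcon
  set T : Finset ℕ := (Finset.Icc 1 n).filter (NearRun occ n m) with hT
  have hR : runRegion a r occ n m = ⋃ l ∈ T, block a r l := by
    simp only [runRegion, hT, Finset.mem_filter, Finset.mem_Icc, mem_ofPred_eq, and_assoc]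
  have hTcard : T.card ≤ D * (m + 2) := by
    have h1 : T ⊆ (runStarts occ n m).biUnion fun s => Finset.Icc (s - 1) (s + m) := by
      intro l hl
      simp only [hT, Finset.mem_filter, Finset.mem_Icc] at hl
      obtain ⟨-, s, hs, h2, h3⟩ := hl
      simp only [Finset.mem_biUnion, Finset.mem_Icc, runStarts, Finset.mem_filter,
        Finset.mem_range]
      exact ⟨s, ⟨by have := hs.2.1; omega, hs⟩, by omega, h3⟩
    refine (Finset.card_le_card h1).trans ((Finset.card_biUnion_le_card_mul _ _ (m + 2) ?_).trans
      (Nat.mul_le_mul_right _ hD))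
    intro s hs
    simp only [runStarts, Finset.mem_filter] at hs
    have := hs.2.1
    rw [Nat.card_Icc]
    omega
  have hg0 : ∀ x, 0 ≤ g x ^ 2 := fun x => sq_nonneg _
  have hgi := hf.integrable_sq
  -- the mass of a single block
  have hblock : ∀ l ∈ T, ∫ x in block a r l, f x ^ 2 ≤ 2 * r * κ + 4 * r ^ 2 *
      ((∫ x in block (a - r) r l, g x ^ 2) + (∫ x in block a r l, g x ^ 2) +
        ∫ x in block (a + r) r l, g x ^ 2) := by
    intro l hl
    simp only [hT, Finset.mem_filter, Finset.mem_Icc] at hl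
    obtain ⟨-, s, hs, h2, h3⟩ := hl
    set j := max s (min l (s + m - 1)) with hj
    have hj1 : s ≤ j := le_max_left _ _
    have hj2 : j < s + m := by omega
    have hjl : j ≤ l + 1 := by omega
    have hlj : l ≤ j + 1 := by omega
    have hfc := hcon s j hs hj1 hj2
    have hloc := hf.setIntegral_block_sq_le hr hjl hlj
    nlinarith
  have hmassR : ∫ x in runRegion a r occ n m, f x ^ 2 ≤
      2 * r * κ * (D * (m + 2)) + 12 * r ^ 2 * Q := by
    have h1 := integral_biUnion_finset (μ := volume) (f := fun x => f x ^ 2) T (s := block a r)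
      (fun _ _ => measurableSet_Ioc) (fun i _ j _ hij => block_disjoint hr hij)
      (fun _ _ => hf.integrable_f_sq.integrableOn)
    rw [hR, h1]
    refine (Finset.sum_le_sum hblock).trans ?_
    rw [Finset.sum_add_distrib, Finset.sum_const, nsmul_eq_mul, ← Finset.mul_sum,
      Finset.sum_add_distrib, Finset.sum_add_distrib]
    have h2 : ∫ x, g x ^ 2 ≤ Q := by
      have : 0 ≤ ∫ x, V x * f x ^ 2 := integral_nonneg fun x => mul_nonneg (hV.nonneg x) (sq_nonneg _)
      unfold formEnergy at hQ
      linarith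
    have h3 := sum_setIntegral_block_le (a := a - r) hr hgi hg0 T
    have h4 := sum_setIntegral_block_le (a := a) hr hgi hg0 T
    have h5 := sum_setIntegral_block_le (a := a + r) hr hgi hg0 T
    have h6 : (T.card : ℝ) ≤ D * (m + 2) := by exact_mod_cast hTcard
    have h7 : (T.card : ℝ) * (2 * r * κ) ≤ D * (m + 2) * (2 * r * κ) := by gcongr
    have h8 : 4 * r ^ 2 * ((∑ i ∈ T, ∫ x in block (a - r) r i, g x ^ 2) +
        (∑ i ∈ T, ∫ x in block a r i, g x ^ 2) + ∑ i ∈ T, ∫ x in block (a + r) r i, g x ^ 2) ≤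
        4 * r ^ 2 * (3 * Q) := by gcongr; linarith
    linarith
  have hmassC := sq_mul_integral_le_formEnergy hr hb hV hf hocc hk.le hkπ hkc
  have hmeas := measurableSet_runRegion a r occ n m
  rw [integral_indicator hmeas.compl] at hmassC
  have hsplit := integral_add_compl hmeas hf.integrable_f_sq
  rw [hmass] at hsplit
  have hC : ∫ x in (runRegion a r occ n m)ᶜ, f x ^ 2 ≤ Q / k ^ 2 := by
    rw [le_div_iff₀ (by positivity)]
    linarith
  linarith

/-! ### The potential of a point configuration and its change under insertion of a gap -/

/-- A single-site potential: nonnegative, bounded, measurable and supported in `(-d, d)`. -/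
structure IsSite (v : ℝ → ℝ) (d : ℝ) : Prop where
  meas : Measurable v
  nonneg : ∀ x, 0 ≤ v x
  bdd : ∃ C, ∀ x, v x ≤ C
  supp : ∀ x, d ≤ |x| → v x = 0
  pos : 0 < d

/-- The potential `∫ v (x - y) μ(dy)` of the configuration `μ`. -/
noncomputable def pot (v : ℝ → ℝ) (μ : Measure ℝ) (x : ℝ) : ℝ := ∫ y, v (x - y) ∂μ

section pot

variable {v : ℝ → ℝ} {d : ℝ} (hv : IsSite v d) (μ : Measure ℝ) [IsLocallyFiniteMeasure μ]

theorem IsSite.eq_zero_of_notMem (hv : IsSite v d) {x y : ℝ} (h : y ∉ Ioo (x - d) (x + d)) :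
    v (x - y) = 0 := by
  refine hv.supp _ ?_
  by_contra! h'
  rw [abs_lt] at h'
  exact h ⟨by linarith, by linarith⟩

theorem IsSite.integrable (hv : IsSite v d) (x : ℝ) : Integrable (fun y => v (x - y)) μ := by
  obtain ⟨C, hC⟩ := hv.bdd
  have h1 : IntegrableOn (fun y => v (x - y)) (Ioo (x - d) (x + d)) μ := by
    refine Measure.integrableOn_of_bounded (M := C) ?_
      (hv.meas.comp (measurable_const.sub measurable_id)).aestronglyMeasurable ?_
    · exact measure_Ioo_lt_top.ne
    · filter_upwards with y
      rw [Real.norm_of_nonneg (hv.nonneg _)]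
      exact hC _
  rw [← integrableOn_univ]
  exact h1.of_forall_sdiff_eq_zero MeasurableSet.univ fun y hy => hv.eq_zero_of_notMem hy.2

theorem IsSite.isPot (hv : IsSite v d) : IsPot (pot v μ) where
  meas := by
    have : StronglyMeasurable (fun p : ℝ × ℝ => v (p.1 - p.2)) :=
      (hv.meas.comp (measurable_fst.sub measurable_snd)).stronglyMeasurable
    exact this.integral_prod_right.measurable
  nonneg x := integral_nonneg fun y => hv.nonneg _
  bdd R := by
    obtain ⟨C, hC⟩ := hv.bdd
    refine ⟨C * μ.real (Icc (-R - d) (R + d)), fun x hx => ?_⟩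
    calc pot v μ x ≤ ∫ y, (Icc (-R - d) (R + d)).indicator (fun _ => C) y ∂μ := by
          refine integral_mono (hv.integrable μ x)
            ((integrable_indicator_iff measurableSet_Icc).2
              (integrableOn_const measure_Icc_lt_top.ne)) fun y => ?_
          by_cases hy : y ∈ Icc (-R - d) (R + d)
          · rw [indicator_of_mem hy]; exact hC _
          · rw [indicator_of_notMem hy]
            exact (hv.eq_zero_of_notMem fun h => hy
              ⟨by linarith [h.1, hx.1], by linarith [h.2, hx.2]⟩).le
      _ = C * μ.real (Icc (-R - d) (R + d)) := by
          rw [integral_indicator measurableSet_Icc, setIntegral_const, smul_eq_mul, mul_comm]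

theorem IsSite.pot_eq_zero (hv : IsSite v d) {μ : Measure ℝ} {x : ℝ}
    (h : μ (Ioo (x - d) (x + d)) = 0) : pot v μ x = 0 := by
  refine integral_eq_zero_of_ae ?_
  filter_upwards [measure_eq_zero_iff_ae_notMem.1 h] with y hy
  exact hv.eq_zero_of_notMem hy

/-- An interval that contains a point of the configuration well inside carries at least the
full weight of one single-site potential. -/
theorem IsSite.le_setIntegral_pot (hv : IsSite v d) {α β : ℝ}
    (h : 1 ≤ μ (Icc (α + d) (β - d))) : ∫ x, v x ≤ ∫ x in Ioc α β, pot v μ x := by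
  have hpot := hv.isPot μ
  have hvi : Integrable v := by
    have := hv.integrable volume 0
    simpa using this.comp_neg
  have hm : Measurable fun p : ℝ × ℝ => ENNReal.ofReal (v (p.1 - p.2)) :=
    (hv.meas.comp (measurable_fst.sub measurable_snd)).ennreal_ofReal
  have hVi : IntegrableOn (pot v μ) (Ioc α β) := by
    obtain ⟨C, hC⟩ := hpot.bdd (max |α| |β|)
    refine Measure.integrableOn_of_bounded (M := C) (by simp) hpot.meas.aestronglyMeasurable ?_
    filter_upwards [ae_restrict_mem measurableSet_Ioc] with x hx
    rw [Real.norm_of_nonneg (hpot.nonneg x)]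
    exact hC x ⟨by linarith [hx.1, neg_abs_le α, le_max_left |α| |β|],
      by linarith [hx.2, le_abs_self β, le_max_right |α| |β|]⟩
  rw [← ENNReal.ofReal_le_ofReal_iff (integral_nonneg fun x => hpot.nonneg x),
    ofReal_integral_eq_lintegral_ofReal hvi (ae_of_all _ hv.nonneg),
    ofReal_integral_eq_lintegral_ofReal hVi (ae_of_all _ hpot.nonneg)]
  calc ∫⁻ x, ENNReal.ofReal (v x)
      ≤ (∫⁻ x, ENNReal.ofReal (v x)) * μ (Icc (α + d) (β - d)) := le_mul_of_one_le_right' h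
    _ = ∫⁻ _ in Icc (α + d) (β - d), (∫⁻ x, ENNReal.ofReal (v x)) ∂μ :=
        (setLIntegral_const _ _).symm
    _ ≤ ∫⁻ y in Icc (α + d) (β - d), (∫⁻ x in Ioc α β, ENNReal.ofReal (v (x - y))) ∂μ := by
        refine setLIntegral_mono' measurableSet_Icc fun y hy => ?_
        rw [← lintegral_sub_right_eq_self (fun x => ENNReal.ofReal (v x)) y,
          ← lintegral_indicator (measurableSet_Ioc : MeasurableSet (Ioc α β))]
        refine lintegral_mono fun x => ?_
        by_cases hx : x ∈ Ioc α β
        · rw [indicator_of_mem hx]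
        · rw [indicator_of_notMem hx, hv.eq_zero_of_notMem, ENNReal.ofReal_zero]
          exact fun h' => hx ⟨by linarith [hy.1, h'.2], by linarith [hy.2, h'.1]⟩
    _ ≤ ∫⁻ y, (∫⁻ x in Ioc α β, ENNReal.ofReal (v (x - y))) ∂μ := setLIntegral_le_lintegral _ _
    _ = ∫⁻ x in Ioc α β, ∫⁻ y, ENNReal.ofReal (v (x - y)) ∂μ :=
        (lintegral_lintegral_swap (f := fun x y => ENNReal.ofReal (v (x - y)))
          hm.aemeasurable).symm
    _ = ∫⁻ x in Ioc α β, ENNReal.ofReal (pot v μ x) := by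
        refine lintegral_congr fun x => ?_
        rw [pot, ofReal_integral_eq_lintegral_ofReal (hv.integrable μ x)
          (ae_of_all _ fun y => hv.nonneg _)]

end pot

/-- The map that opens a gap of length `t` at `x`: points to the right of `x` move by `t`. -/
noncomputable def openGap (x t y : ℝ) : ℝ := if y ≤ x then y else y + t

theorem measurable_openGap (x t : ℝ) : Measurable (openGap x t) :=
  Measurable.ite measurableSet_Iic measurable_id (measurable_id.add_const t)

/-- The configuration `μ` with a gap of length `t` inserted at `x`. -/
noncomputable def insertGap (x t : ℝ) (μ : Measure ℝ) : Measure ℝ := μ.map (openGap x t)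

theorem openGap_mem {x t y : ℝ} (ht : 0 ≤ t) : y ≤ openGap x t y ∧ openGap x t y ≤ y + t := by
  unfold openGap
  split_ifs
  · exact ⟨le_rfl, by linarith⟩
  · exact ⟨by linarith, le_rfl⟩

theorem insertGap_insertGap {x s t : ℝ} (ht : 0 ≤ t) (μ : Measure ℝ) :
    insertGap x s (insertGap x t μ) = insertGap x (s + t) μ := by
  unfold insertGap
  rw [Measure.map_map (measurable_openGap x s) (measurable_openGap x t)]
  congr 1
  funext y
  simp only [Function.comp, openGap]
  split_ifs <;> linarith

theorem insertGap_apply (x t : ℝ) (μ : Measure ℝ) {B : Set ℝ} (hB : MeasurableSet B) :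
    insertGap x t μ B = μ (openGap x t ⁻¹' B) :=
  Measure.map_apply (measurable_openGap x t) hB

theorem insertGap_Icc {x t : ℝ} (ht : 0 ≤ t) {α β : ℝ} (μ : Measure ℝ) :
    μ (Icc α (β - t)) ≤ insertGap x t μ (Icc α β) := by
  rw [insertGap_apply x t μ measurableSet_Icc]
  refine measure_mono fun y hy => ?_
  have := openGap_mem (x := x) (y := y) ht
  exact ⟨hy.1.trans this.1, by linarith [hy.2, this.2]⟩

theorem isLocallyFiniteMeasure_insertGap {x t : ℝ} (ht : 0 ≤ t) (μ : Measure ℝ)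
    [IsLocallyFiniteMeasure μ] : IsLocallyFiniteMeasure (insertGap x t μ) := by
  refine ⟨fun y => ⟨Ioo (y - 1) (y + 1), Ioo_mem_nhds (by linarith) (by linarith), ?_⟩⟩
  rw [insertGap_apply x t μ measurableSet_Ioo]
  refine (measure_mono fun z hz => ?_).trans_lt (measure_Icc_lt_top (a := y - 1 - t) (b := y + 1))
  have := openGap_mem (x := x) (y := z) ht
  exact ⟨by linarith [hz.1, this.2], by linarith [hz.2, this.1]⟩

section insertGap

variable {v : ℝ → ℝ} {d x t : ℝ} {μ : Measure ℝ}

theorem IsSite.pot_insertGap (hv : IsSite v d) (z : ℝ) :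
    pot v (insertGap x t μ) z = ∫ y, v (z - openGap x t y) ∂μ :=
  integral_map (measurable_openGap x t).aemeasurable
    (hv.meas.comp (measurable_const.sub measurable_id)).aestronglyMeasurable

theorem IsSite.pot_insertGap_left (hv : IsSite v d) (ht : 0 ≤ t)
    (h0 : μ (Ioo (x - 2 * d) (x + 2 * d)) = 0) {z : ℝ} (hz : z ≤ x + d) :
    pot v (insertGap x t μ) z = pot v μ z := by
  rw [hv.pot_insertGap]
  refine integral_congr_ae ?_
  filter_upwards [measure_eq_zero_iff_ae_notMem.1 h0] with y hy
  simp only [openGap]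
  split_ifs with hyx
  · rfl
  · have hd := hv.pos
    have : x + 2 * d ≤ y := by
      by_contra! h
      exact hy ⟨by linarith, h⟩
    rw [hv.eq_zero_of_notMem fun h => by linarith [h.2],
      hv.eq_zero_of_notMem fun h => by linarith [h.2]]

theorem IsSite.pot_insertGap_right (hv : IsSite v d) (htd : t ≤ d)
    (h0 : μ (Ioo (x - 2 * d) (x + 2 * d)) = 0) {z : ℝ} (hz : x ≤ z) :
    pot v (insertGap x t μ) z = pot v μ (z - t) := by
  rw [hv.pot_insertGap]
  refine integral_congr_ae ?_
  filter_upwards [measure_eq_zero_iff_ae_notMem.1 h0] with y hy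
  simp only [openGap]
  split_ifs with hyx
  · have hd := hv.pos
    have : y ≤ x - 2 * d := by
      by_contra! h
      exact hy ⟨h, by linarith⟩
    rw [hv.eq_zero_of_notMem fun h => by linarith [h.1],
      hv.eq_zero_of_notMem fun h => by linarith [h.1]]
  · congr 1
    ring

theorem IsSite.pot_insertGap_gap (hv : IsSite v d) (htd : t ≤ d)
    (h0 : μ (Ioo (x - 2 * d) (x + 2 * d)) = 0) {z : ℝ} (hz : z ∈ Ioc x (x + t)) :
    pot v (insertGap x t μ) z = 0 := by
  have ht : 0 ≤ t := by linarith [hz.1, hz.2]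
  rw [hv.pot_insertGap_left ht h0 (by linarith [hz.2])]
  exact hv.pot_eq_zero (measure_mono_null (Ioo_subset_Ioo (by linarith [hz.1, hv.pos])
    (by linarith [hz.2])) h0)

end insertGap

/-- The resonance event at the point `c`: the configuration is empty near `c`; inserting at `c` a
gap of length `j h` lowers the ground state energy on `(a, b)` by at least `2 δ`; yet the energy of
`(a, b)` is nearly reached on one side of each of the points `c + j h`. -/
structure IsResonant (v : ℝ → ℝ) (a b d h δ : ℝ) (K : ℕ) (c : ℝ) (μ : Measure ℝ) : Prop where
  empty : μ (Ioo (c - 2 * d) (c + 2 * d)) = 0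
  drop : ∀ j : ℕ, 1 ≤ j → j ≤ K → groundEnergy a b (pot v (insertGap c (j * h) μ)) + 2 * δ ≤
    groundEnergy a b (pot v μ)
  split : ∀ j : ℕ, 1 ≤ j → j ≤ K →
    min (groundEnergy a (c + j * h) (pot v μ)) (groundEnergy (c + j * h) b (pot v μ)) ≤
      groundEnergy a b (pot v μ) + δ

/-- Of the configurations obtained from `μ` by inserting gaps of lengths `k h` at `c`, at most one is
resonant: a longer gap lowers the energy on `(a, b)` while the two sides of the gap still look the
same, so that their energies exceed the lowered one. -/
theorem IsResonant.eq_of_insertGap {v : ℝ → ℝ} {a b d h δ c : ℝ} {K : ℕ} (hv : IsSite v d)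
    {μ : Measure ℝ} [IsLocallyFiniteMeasure μ] (hh : 0 < h) (hδ : 0 < δ) (hK : K * h ≤ d)
    (hac : a < c) (hcb : c + d < b) {k₁ k₂ : ℕ} (hk₁ : k₁ ≤ K) (hk₂ : k₂ ≤ K)
    (h₁ : IsResonant v a b d h δ K c (insertGap c (k₁ * h) μ))
    (h₂ : IsResonant v a b d h δ K c (insertGap c (k₂ * h) μ)) : k₁ = k₂ := by
  by_contra hne
  wlog hlt : k₁ < k₂ generalizing k₁ k₂
  · exact this hk₂ hk₁ h₂ h₁ (Ne.symm hne) (by omega)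
  obtain ⟨j, rfl⟩ := Nat.exists_eq_add_of_lt hlt
  set μ₁ := insertGap c (k₁ * h) μ with hμ₁
  have hloc : IsLocallyFiniteMeasure μ₁ := isLocallyFiniteMeasure_insertGap (by positivity) μ
  have e : insertGap c ((k₁ + j + 1 : ℕ) * h) μ = insertGap c ((j + 1 : ℕ) * h) μ₁ := by
    rw [hμ₁, insertGap_insertGap (by positivity)]
    congr 1
    push_cast
    ring
  rw [e] at h₂
  have hdrop := h₁.drop (j + 1) (by omega) (by omega)
  have hsplit := h₂.split (j + 1) (by omega) (by omega)
  set t : ℝ := (j + 1 : ℕ) * h with ht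
  have ht0 : 0 < t := by positivity
  have htd : t ≤ d := by
    refine le_trans ?_ hK
    exact mul_le_mul_of_nonneg_right (by exact_mod_cast (by omega : j + 1 ≤ K)) hh.le
  have hpot := hv.isPot μ₁
  have eL : groundEnergy a (c + t) (pot v (insertGap c t μ₁)) = groundEnergy a (c + t) (pot v μ₁) :=
    groundEnergy_congr fun z hz => hv.pot_insertGap_left ht0.le h₁.empty (by linarith [hz.2])
  have eR : groundEnergy (c + t) b (pot v (insertGap c t μ₁)) =
      groundEnergy c (b - t) (pot v μ₁) := by
    rw [← groundEnergy_translate c (b - t) (pot v μ₁) t, sub_add_cancel]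
    exact groundEnergy_congr fun z hz =>
      hv.pot_insertGap_right htd h₁.empty (by linarith [hz.1])
  have lL := groundEnergy_anti (a := a) (b := c + t) (a' := a) (b' := b) (by linarith) le_rfl
    (by linarith) hpot
  have lR := groundEnergy_anti (a := c) (b := b - t) (a' := a) (b' := b) (by linarith) hac.le
    (by linarith) hpot
  rw [eL, eR] at hsplit
  rcases min_le_iff.1 hsplit with h | h <;> linarith

/-- The part of a block whose points influence the potential inside the block only. -/
def core (a r d : ℝ) (j : ℕ) : Set ℝ := Icc (a + (j - 1) * r + d) (a + j * r - d)

/-- If every point has a side on which the ground state energy exceeds that of the whole interval by at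
most `δ`, the configuration is resonant at the midpoint of a block
in some run: stretching a nearly minimizing trial function, whose square is at least `κ` at that
midpoint, shows that the inserted gaps lower the energy. `Kc` is the constant of
`exists_localization_const`. -/
theorem exists_isResonant {v : ℝ → ℝ} {d : ℝ} (hv : IsSite v d) {Kc : ℝ}
    (hKc : ∀ {a b A k : ℝ} {V f g : ℝ → ℝ}, 0 < A →
      IsPot V → IsTrial a b f g → ∫ x, f x ^ 2 = 1 →
      (∀ h h', IsTrial (b - A) b h h' → k ^ 2 * ∫ x, h x ^ 2 ≤ formEnergy V h h') →
      a ≤ b - A → formEnergy V f g + Kc / A ^ 2 < k ^ 2 →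
      groundEnergy a (b - A / 2) V ≤ formEnergy V f g + Kc / A ^ 2)
    {a b r c₀ k Q κ A e₀ δ h : ℝ} {n m D K : ℕ} (hr : 6 * d ≤ r) (hb : b = a + n * r)
    (hc₀ : c₀ ≤ ∫ x, v x) {μ : Measure ℝ} [IsLocallyFiniteMeasure μ]
    (hμ : ∀ j, μ (core a r d j) ≠ 0 → 1 ≤ μ (core a r d j))
    (hk : 0 < k) (hkπ : k * ((m + 1) * r) < Real.pi)
    (hkc : k * Real.tan (k * ((m + 1) * r) / 2) ≤ c₀ / 2) (hm : 1 ≤ m) (hκ : 0 < κ)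
    (hA : a ≤ b - A) (hdA : 2 * d ≤ A) (hδ : 0 < δ) (hKA : Kc / A ^ 2 ≤ δ) (hQk : Q < k ^ 2)
    (hcond : 2 * r * κ * (D * (m + 2)) + 12 * r ^ 2 * Q < 1 - Q / k ^ 2)
    (heδ : 4 * δ ≤ e₀) (hh : 8 * δ ≤ h * κ * e₀) (hh0 : 0 < h) (hK : K * h ≤ d)
    (hE : groundEnergy a b (pot v μ) + 2 * δ ≤ Q) (hE₀ : e₀ ≤ groundEnergy a b (pot v μ))
    (hD : (runStarts (fun j => μ (core a r d j) ≠ 0) n m).card ≤ D)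
    (hright : ∀ s, IsRun (fun j => μ (core a r d j) ≠ 0) n m s → a + (s + m) * r ≤ b - A)
    (hgap : ∀ y ∈ Ioo a b, min (groundEnergy a y (pot v μ)) (groundEnergy y b (pot v μ)) ≤
      groundEnergy a b (pot v μ) + δ) :
    ∃ s j, IsRun (fun j => μ (core a r d j) ≠ 0) n m s ∧ s ≤ j ∧ j < s + m ∧
      IsResonant v a b d h δ K (a + (j - 1 / 2) * r) μ := by
  have hd := hv.pos
  have hr0 : 0 < r := by linarith
  have hA0 : 0 < A := by linarith
  have hpot := hv.isPot μ
  set V := pot v μ with hV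
  set occ : ℕ → Prop := fun j => μ (core a r d j) ≠ 0 with hoccdef
  have hocc : ∀ j, 1 ≤ j → j ≤ n → occ j → c₀ ≤ ∫ x in block a r j, V x := fun j _ _ hj =>
    hc₀.trans (hv.le_setIntegral_pot μ (hμ j hj))
  set E := groundEnergy a b V with hEdef
  -- a nearly optimal trial function that stays away from the right end
  obtain ⟨f₀, g₀, hf₀, hm₀, he₀⟩ := exists_formEnergy_lt (a := a) (b := b) (V := V) (c := E + δ)
    (by linarith) (by linarith)
  have hloc : groundEnergy a (b - A / 2) V ≤ formEnergy V f₀ g₀ + Kc / A ^ 2 :=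
    hKc hA0 hpot hf₀ hm₀ (fun p p' hp => sq_mul_integral_le_of_forall_not_isRun hr0 hb hA hpot hp
      hocc hk.le hkπ hkc hright) hA (by linarith)
  obtain ⟨f, g, hf, hmass, he⟩ := exists_formEnergy_lt (a := a) (b := b - A / 2) (V := V)
    (c := E + 2 * δ) (by linarith) (by linarith)
  obtain ⟨s, j, hs, hsj, hjm, hfc⟩ := exists_le_sq_of_formEnergy_le hr0 hb hpot
    (hf.mono le_rfl (by linarith)) hmass hocc hk hkπ hkc hm hκ.le (by linarith) hD hcond
  set c := a + ((j : ℝ) - 1 / 2) * r with hc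
  have h1j : (1 : ℝ) ≤ j := by exact_mod_cast hs.1.trans hsj
  have hjm' : (j : ℝ) + 1 ≤ s + m := by exact_mod_cast hjm
  have hrj : r ≤ j * r := le_mul_of_one_le_left hr0.le h1j
  have hac : a < c := by linarith
  have hcb : c + d < b := by
    have := hright s hs
    have h2 : (j : ℝ) * r ≤ (s + m) * r := by gcongr; linarith
    linarith
  have hempty : μ (Ioo (c - 2 * d) (c + 2 * d)) = 0 := by
    have h1 : ¬ occ j := hs.2.2 j hsj hjm
    simp only [hoccdef, not_not] at h1
    have hsub : Ioo (c - 2 * d) (c + 2 * d) ⊆ core a r d j := fun y hy =>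
      ⟨by linarith [hy.1], by linarith [hy.2]⟩
    exact measure_mono_null hsub h1
  have hjK : ∀ i : ℕ, i ≤ K → (i : ℝ) * h ≤ d := fun i hi => by
    refine le_trans ?_ hK
    exact mul_le_mul_of_nonneg_right (by exact_mod_cast hi) hh0.le
  refine ⟨s, j, hs, hsj, hjm, hempty, fun i hi1 hi2 => ?_, fun i hi1 hi2 => ?_⟩
  · have hi : h ≤ i * h := le_mul_of_one_le_left hh0.le (by exact_mod_cast hi1)
    set t : ℝ := i * h with ht
    have htd : t ≤ d := hjK i hi2
    have ht0 : 0 ≤ t := hh0.le.trans hi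
    have hloc' : IsLocallyFiniteMeasure (insertGap c t μ) := isLocallyFiniteMeasure_insertGap ht0 μ
    have hpot' := hv.isPot (insertGap c t μ)
    obtain ⟨f', g', hf', hmass', he'⟩ := hf.stretch (W := pot v (insertGap c t μ)) ht0 hpot
      (fun z hz => hv.pot_insertGap_left ht0 hempty (by linarith))
      (fun z hz => hv.pot_insertGap_gap htd hempty hz)
      (fun z hz => hv.pot_insertGap_right htd hempty (by linarith))
    have h1 := groundEnergy_mul_le hpot' (hf'.mono (b' := b) le_rfl (by linarith))
    rw [hmass', he', hmass] at h1
    set E' := groundEnergy a b (pot v (insertGap c t μ))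
    have hE'0 : 0 ≤ E' := groundEnergy_nonneg a b hpot'
    have h2 : E' * (1 + t * κ) < E + 2 * δ := by
      refine lt_of_le_of_lt ?_ he
      refine le_trans ?_ h1
      gcongr
    have h3 : h * κ * e₀ ≤ t * κ * e₀ := by gcongr; linarith
    -- `4 δ ≤ e₀ ≤ E` gives `e₀ ≤ 2 (E - 2 δ)`, so the gain `t κ (E - 2 δ)` is at least `4 δ`
    have h4 : t * κ * e₀ ≤ t * κ * (2 * (E - 2 * δ)) := by
      gcongr
      linarith
    have h5 : E + 2 * δ ≤ (E - 2 * δ) * (1 + t * κ) := by linarith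
    have h6 : E' < E - 2 * δ := lt_of_mul_lt_mul_right (h2.trans_le h5) (by positivity)
    linarith
  · have := hjK i hi2
    have h0 : 0 ≤ (i : ℝ) * h := by positivity
    exact hgap _ ⟨by linarith, by linarith⟩

/-! ### The law of a Poisson random measure -/

section law

variable {Ω : Type*} [MeasurableSpace Ω] {P : Measure Ω} {ν : ℝ}
  {M M' : Ω → Measure ℝ}

theorem measurable_apply (hM : Measurable M) {B : Set ℝ} (hB : MeasurableSet B) :
    Measurable fun ω => M ω B := (Measure.measurable_coe hB).comp hM

theorem IsPoissonRandomMeasure.measure_eq_zero (hM : IsPoissonRandomMeasure P ν M) {B : Set ℝ}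
    (hB : MeasurableSet B) (hB' : Bornology.IsBounded B) :
    P {ω | M ω B = 0} = ENNReal.ofReal (Real.exp (-(ν * volume.real B))) := by
  have := hM.law B hB hB' 0
  simpa using this

/-- Independence over pairwise disjoint sets indexed by any finite type. -/
theorem iIndepFun_of_fintype {ι : Type*} [Fintype ι]
    (h : ∀ (n : ℕ) (B : Fin n → Set ℝ), (∀ i, MeasurableSet (B i)) →
      Pairwise (fun i k => Disjoint (B i) (B k)) → iIndepFun (fun i ω => M ω (B i)) P)
    {B : ι → Set ℝ} (hB : ∀ i, MeasurableSet (B i))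
    (hd : Pairwise fun i k => Disjoint (B i) (B k)) : iIndepFun (fun i ω => M ω (B i)) P := by
  set e := Fintype.equivFin ι
  have h1 := h (Fintype.card ι) (fun i => B (e.symm i)) (fun i => hB _)
    fun i k hik => hd (e.symm.injective.ne hik)
  have h2 := h1.precomp e.injective
  simpa using h2

variable [IsProbabilityMeasure P]

theorem IsPoissonRandomMeasure.map_eq (hM : IsPoissonRandomMeasure P ν M) (hν : 0 < ν) {B : Set ℝ}
    (hB : MeasurableSet B) (hB' : Bornology.IsBounded B) :
    P.map (fun ω => M ω B) =
      (poissonMeasure (ν * volume.real B).toNNReal).map (Nat.cast : ℕ → ENNReal) := by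
  have hX := measurable_apply hM.measurable hB
  have hcoe : ((ν * volume.real B).toNNReal : ℝ) = ν * volume.real B :=
    Real.coe_toNNReal _ (by positivity)
  have := Measure.isProbabilityMeasure_map (μ := P) hX.aemeasurable
  refine (Measure.eq_of_le_of_measure_univ_eq (Measure.le_iff.2 fun s hs => ?_) (by simp)).symm
  rw [Measure.map_apply (by fun_prop) hs, Measure.map_apply hX hs]
  set A : Set ℕ := (Nat.cast : ℕ → ENNReal) ⁻¹' s with hA
  have hmeas : ∀ m : ℕ, MeasurableSet {ω | M ω B = (m : ENNReal)} := fun m =>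
    hX (measurableSet_singleton _)
  have e1 : poissonMeasure (ν * volume.real B).toNNReal A = P (⋃ m ∈ A, {ω | M ω B = (m : ENNReal)}) := by
    rw [measure_biUnion A.to_countable ?_ fun m _ => hmeas m]
    · conv_lhs => rw [← biUnion_of_singleton A]
      rw [measure_biUnion A.to_countable ?_ fun m _ => measurableSet_singleton m]
      · refine tsum_congr fun m => ?_
        rw [poissonMeasure_singleton, hM.law B hB hB', hcoe]
      · intro i _ j _ hij
        simpa using hij
    · intro i _ j _ hij
      refine Set.disjoint_left.2 fun ω h1 h2 => hij ?_
      exact Nat.cast_injective (R := ENNReal) (h1.symm.trans h2)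
  rw [e1]
  refine measure_mono fun ω hω => ?_
  simp only [mem_iUnion] at hω
  obtain ⟨m, hm, hω⟩ := hω
  have hω' : M ω B = (m : ENNReal) := hω
  show M ω B ∈ s
  rw [hω']
  exact hm

/-- Almost surely, the number of points in a bounded set is a natural number. -/
theorem IsPoissonRandomMeasure.ae_mem_range (hM : IsPoissonRandomMeasure P ν M) (hν : 0 < ν)
    {B : Set ℝ} (hB : MeasurableSet B) (hB' : Bornology.IsBounded B) :
    ∀ᵐ ω ∂P, ∃ m : ℕ, M ω B = m := by
  have hX := measurable_apply hM.measurable hB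
  have hr : MeasurableSet (range (Nat.cast : ℕ → ENNReal)) := (countable_range _).measurableSet
  have h := congrArg (fun μ => μ (range (Nat.cast : ℕ → ENNReal))ᶜ) (hM.map_eq hν hB hB')
  rw [Measure.map_apply hX hr.compl, Measure.map_apply (by fun_prop) hr.compl] at h
  have h0 : (Nat.cast : ℕ → ENNReal) ⁻¹' (range (Nat.cast : ℕ → ENNReal))ᶜ = ∅ := by
    ext m; simp
  rw [h0, measure_empty] at h
  filter_upwards [measure_eq_zero_iff_ae_notMem.1 h] with ω hω
  simp only [mem_preimage, mem_compl_iff, mem_range, not_not] at hω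
  obtain ⟨m, hm⟩ := hω
  exact ⟨m, hm.symm⟩

theorem IsPoissonRandomMeasure.ae_isLocallyFiniteMeasure (hM : IsPoissonRandomMeasure P ν M)
    (hν : 0 < ν) : ∀ᵐ ω ∂P, IsLocallyFiniteMeasure (M ω) := by
  have h : ∀ R : ℕ, ∀ᵐ ω ∂P, ∃ m : ℕ, M ω (Ioo (-(R : ℝ)) R) = m := fun R =>
    hM.ae_mem_range hν measurableSet_Ioo (Metric.isBounded_Ioo _ _)
  filter_upwards [ae_all_iff.2 h] with ω hω
  refine ⟨fun x => ?_⟩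
  obtain ⟨R, hR⟩ := exists_nat_gt |x|
  obtain ⟨m, hm⟩ := hω R
  refine ⟨Ioo (-(R : ℝ)) R, Ioo_mem_nhds ?_ ?_, ?_⟩
  · linarith [neg_abs_le x]
  · linarith [le_abs_self x]
  · rw [hm]; exact ENNReal.natCast_lt_top m

theorem map_apply_eq_of_bounded (hM : Measurable M) (hM' : Measurable M')
    (h : ∀ B, MeasurableSet B → Bornology.IsBounded B →
      P.map (fun ω => M ω B) = P.map (fun ω => M' ω B)) {B : Set ℝ} (hB : MeasurableSet B) :
    P.map (fun ω => M ω B) = P.map (fun ω => M' ω B) := by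
  have h1 := Measure.isProbabilityMeasure_map (μ := P) (measurable_apply hM hB).aemeasurable
  refine Measure.ext_of_Iic _ _ fun c => ?_
  have key : ∀ {M : Ω → Measure ℝ}, Measurable M → P.map (fun ω => M ω B) (Iic c) =
      ⨅ R : ℕ, P.map (fun ω => M ω (B ∩ Icc (-(R : ℝ)) R)) (Iic c) := by
    intro M hM
    have hmono : Monotone fun R : ℕ => B ∩ Icc (-(R : ℝ)) R := fun R R' hR => by
      have : (R : ℝ) ≤ R' := by exact_mod_cast hR
      exact inter_subset_inter_right _ (Icc_subset_Icc (by linarith) this)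
    have hU : ⋃ R : ℕ, B ∩ Icc (-(R : ℝ)) R = B := by
      rw [← inter_iUnion]
      refine inter_eq_left.2 fun x _ => ?_
      obtain ⟨R, hR⟩ := exists_nat_gt |x|
      exact mem_iUnion.2 ⟨R, by linarith [neg_abs_le x], by linarith [le_abs_self x]⟩
    have hB' : ∀ R : ℕ, MeasurableSet (B ∩ Icc (-(R : ℝ)) R) := fun R => hB.inter measurableSet_Icc
    have e : (fun ω => M ω B) ⁻¹' Iic c =
        ⋂ R : ℕ, (fun ω => M ω (B ∩ Icc (-(R : ℝ)) R)) ⁻¹' Iic c := by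
      ext ω
      simp only [mem_preimage, mem_Iic, mem_iInter]
      conv_lhs => rw [← hU, hmono.measure_iUnion]
      exact iSup_le_iff
    rw [Measure.map_apply (measurable_apply hM hB) measurableSet_Iic, e,
      Antitone.measure_iInter]
    · exact iInf_congr fun R => (Measure.map_apply (measurable_apply hM (hB' R))
        measurableSet_Iic).symm
    · intro R R' hR ω hω
      exact (measure_mono (hmono hR)).trans hω
    · exact fun R => ((measurable_apply hM (hB' R)) measurableSet_Iic).nullMeasurableSet
    · exact ⟨0, measure_ne_top _ _⟩
  rw [key hM, key hM']
  refine iInf_congr fun R => ?_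
  rw [h _ (hB.inter measurableSet_Icc) (Metric.isBounded_Icc _ _ |>.subset inter_subset_right)]

/-- Two random measures with independent values on disjoint sets have the same law if their
values on bounded sets do. -/
theorem map_eq_map_of_forall_isBounded (hM : Measurable M) (hM' : Measurable M')
    (hi : ∀ (n : ℕ) (B : Fin n → Set ℝ), (∀ i, MeasurableSet (B i)) →
      Pairwise (fun i k => Disjoint (B i) (B k)) → iIndepFun (fun i ω => M ω (B i)) P)
    (hi' : ∀ (n : ℕ) (B : Fin n → Set ℝ), (∀ i, MeasurableSet (B i)) →
      Pairwise (fun i k => Disjoint (B i) (B k)) → iIndepFun (fun i ω => M' ω (B i)) P)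
    (h : ∀ B, MeasurableSet B → Bornology.IsBounded B →
      P.map (fun ω => M ω B) = P.map (fun ω => M' ω B)) : P.map M = P.map M' := by
  classical
  -- joint laws over finitely many disjoint sets
  have h1 : ∀ {ι : Type} [Fintype ι] {B : ι → Set ℝ}, (∀ i, MeasurableSet (B i)) →
      (Pairwise fun i k => Disjoint (B i) (B k)) →
      P.map (fun ω i => M ω (B i)) = P.map (fun ω i => M' ω (B i)) := by
    intro ι _ B hB hd
    rw [(iIndepFun_iff_map_fun_eq_pi_map fun i => (measurable_apply hM (hB i)).aemeasurable).1
        (iIndepFun_of_fintype hi hB hd),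
      (iIndepFun_iff_map_fun_eq_pi_map fun i => (measurable_apply hM' (hB i)).aemeasurable).1
        (iIndepFun_of_fintype hi' hB hd)]
    congr 1
    funext i
    exact map_apply_eq_of_bounded hM hM' h (hB i)
  -- joint laws over finitely many sets, through the atoms they generate
  have h2 : ∀ J : Finset {s : Set ℝ // MeasurableSet s},
      P.map (fun ω (B : J) => M ω B.1.1) = P.map (fun ω (B : J) => M' ω B.1.1) := by
    intro J
    set atom : Set J → Set ℝ := fun σ => {x | ∀ B : J, x ∈ B.1.1 ↔ B ∈ σ} with hatom
    have hatomM : ∀ σ, MeasurableSet (atom σ) := by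
      intro σ
      have : atom σ = ⋂ B : J, {x | x ∈ B.1.1 ↔ B ∈ σ} := by ext x; simp [hatom]
      rw [this]
      refine MeasurableSet.iInter fun B => ?_
      by_cases hB : B ∈ σ
      · have : {x | x ∈ B.1.1 ↔ B ∈ σ} = B.1.1 := by ext x; simp [hB]
        rw [this]
        exact B.1.2
      · have : {x | x ∈ B.1.1 ↔ B ∈ σ} = B.1.1ᶜ := by ext x; simp [hB]
        rw [this]
        exact B.1.2.compl
    have hatomD : Pairwise fun σ τ => Disjoint (atom σ) (atom τ) := by
      intro σ τ hστ
      refine Set.disjoint_left.2 fun x hx hx' => hστ ?_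
      ext B
      exact (hx B).symm.trans (hx' B)
    have hsum : ∀ (μ : Measure ℝ) (B : J), μ B.1.1 =
        ∑ σ : Set J, if B ∈ σ then μ (atom σ) else 0 := by
      intro μ B
      rw [← Finset.sum_filter, ← measure_biUnion_finset (fun σ _ τ _ hστ => hatomD hστ)
        fun σ _ => hatomM σ]
      congr 1
      ext x
      simp only [Finset.mem_filter, Finset.mem_univ, true_and, mem_iUnion, exists_prop]
      constructor
      · intro hx
        exact ⟨{B | x ∈ B.1.1}, hx, fun B => Iff.rfl⟩
      · rintro ⟨σ, hσ, hx⟩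
        exact (hx B).2 hσ
    set comb : (Set J → ENNReal) → J → ENNReal := fun w B => ∑ σ : Set J, if B ∈ σ then w σ else 0
      with hcomb
    have hcombM : Measurable comb := by
      refine measurable_pi_lambda _ fun B => Finset.measurable_sum _ fun σ _ => ?_
      by_cases hB : B ∈ σ
      · simpa [hB] using measurable_pi_apply σ
      · simp [hB]
    have key : ∀ {M : Ω → Measure ℝ}, Measurable M → P.map (fun ω (B : J) => M ω B.1.1) =
        (P.map (fun ω σ => M ω (atom σ))).map comb := by
      intro M hM
      rw [Measure.map_map hcombM (measurable_pi_lambda _ fun σ => measurable_apply hM (hatomM σ))]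
      congr 1
      funext ω B
      exact hsum (M ω) B
    rw [key hM, key hM']
    congr 1
    exact h1 hatomM hatomD
  -- all evaluations together
  set ev : Measure ℝ → {s : Set ℝ // MeasurableSet s} → ENNReal := fun μ s => μ s.1 with hev
  have hevM : Measurable ev := measurable_pi_lambda _ fun s => Measure.measurable_coe s.2
  have h5 : P.map (ev ∘ M) = P.map (ev ∘ M') := by
    have := Measure.isProbabilityMeasure_map (μ := P) (hevM.comp hM).aemeasurable
    refine IsProjectiveLimit.unique (P := fun J => (P.map (ev ∘ M)).map J.restrict)
      (fun J => rfl) fun J => ?_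
    show _ = (P.map (ev ∘ M)).map J.restrict
    rw [Measure.map_map (Finset.measurable_restrict J) (hevM.comp hM'),
      Measure.map_map (Finset.measurable_restrict J) (hevM.comp hM)]
    exact (h2 J).symm
  ext S hS
  obtain ⟨S', hS', rfl⟩ : ∃ S', MeasurableSet S' ∧ ev ⁻¹' S' = S := by
    have e : (Measure.instMeasurableSpace : MeasurableSpace (Measure ℝ)) =
        MeasurableSpace.comap ev MeasurableSpace.pi := by
      rw [MeasurableSpace.pi, MeasurableSpace.comap_iSup]
      simp only [MeasurableSpace.comap_comp]
      rw [iSup_subtype]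
      rfl
    rw [e] at hS
    exact hS
  rw [Measure.map_apply hM hS, Measure.map_apply hM' hS, ← preimage_comp, ← preimage_comp,
    ← Measure.map_apply (hevM.comp hM) hS', ← Measure.map_apply (hevM.comp hM') hS', h5]

end law

section

variable {Ω : Type*} [MeasurableSpace Ω] {P : Measure Ω} [IsProbabilityMeasure P] {ν : ℝ}
  {M : Ω → Measure ℝ}

theorem measurable_insertGap (x t : ℝ) : Measurable (insertGap x t) :=
  Measure.measurable_map _ (measurable_openGap x t)

theorem measurable_restrict_measure {S : Set ℝ} (hS : MeasurableSet S) :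
    Measurable fun μ : Measure ℝ => μ.restrict S := by
  refine Measure.measurable_of_measurable_coe _ fun B hB => ?_
  simp only [Measure.restrict_apply hB]
  exact Measure.measurable_coe (hB.inter hS)

theorem volume_preimage_openGap {x t : ℝ} (ht : 0 ≤ t) {B : Set ℝ} (hB : MeasurableSet B) :
    volume (openGap x t ⁻¹' B) = volume (B ∩ (Ioc x (x + t))ᶜ) := by
  have e1 : openGap x t ⁻¹' B = (B ∩ Iic x) ∪ (fun y => y + t) ⁻¹' (B ∩ Ioi (x + t)) := by
    ext y
    simp only [mem_preimage, openGap, mem_union, mem_inter_iff, mem_Iic, mem_Ioi]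
    split_ifs with h
    · exact ⟨fun hy => Or.inl ⟨hy, h⟩, fun hy => hy.elim (fun h => h.1) fun h' => by linarith [h'.2]⟩
    · exact ⟨fun hy => Or.inr ⟨hy, by linarith⟩, fun hy => hy.elim (fun h' => absurd h'.2 h)
        fun h' => h'.1⟩
  have e2 : B ∩ (Ioc x (x + t))ᶜ = (B ∩ Iic x) ∪ (B ∩ Ioi (x + t)) := by
    ext y
    simp only [mem_inter_iff, mem_compl_iff, mem_Ioc, not_and_or, not_lt, not_le, mem_union,
      mem_Iic, mem_Ioi]
    tauto
  have hB2 : MeasurableSet (B ∩ Ioi (x + t)) := hB.inter measurableSet_Ioi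
  rw [e1, e2, measure_union ?_ ((measurable_add_const t) hB2), measure_union ?_ hB2,
    measure_preimage_add_right]
  · exact Set.disjoint_left.2 fun y h1 h2 => by
      have := h1.2; have := h2.2; simp only [mem_Iic, mem_Ioi] at *; linarith
  · exact Set.disjoint_left.2 fun y h1 h2 => by
      have := h1.2; have := h2.2; simp only [mem_Iic, mem_Ioi] at *; linarith

theorem isBounded_preimage_openGap {x t : ℝ} (ht : 0 ≤ t) {B : Set ℝ} (hB : Bornology.IsBounded B) :
    Bornology.IsBounded (openGap x t ⁻¹' B) := by
  obtain ⟨R, hR⟩ := hB.subset_closedBall 0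
  rw [Real.closedBall_eq_Icc] at hR
  refine (Metric.isBounded_Icc (0 - R - t) (0 + R)).subset fun y hy => ?_
  have h1 := hR hy
  have h2 := openGap_mem (x := x) (y := y) ht
  exact ⟨by linarith [h1.1, h2.2], by linarith [h1.2, h2.1]⟩

/-- Opening a gap in a Poisson random measure has the same effect on its law as erasing the points
in an interval of the length of the gap. -/
theorem IsPoissonRandomMeasure.map_insertGap (hM : IsPoissonRandomMeasure P ν M) (hν : 0 < ν)
    {x t : ℝ} (ht : 0 ≤ t) : P.map (fun ω => insertGap x t (M ω)) =
      P.map (fun ω => (M ω).restrict (Ioc x (x + t))ᶜ) := by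
  have hS : MeasurableSet (Ioc x (x + t))ᶜ := measurableSet_Ioc.compl
  refine map_eq_map_of_forall_isBounded ((measurable_insertGap x t).comp hM.measurable)
    ((measurable_restrict_measure hS).comp hM.measurable) (fun n B hB hd => ?_)
    (fun n B hB hd => ?_) fun B hB hb => ?_
  · simp only [insertGap_apply x t _ (hB _)]
    exact hM.indep n _ (fun i => measurable_openGap x t (hB i)) fun i k hik =>
      (hd hik).preimage _
  · simp only [Measure.restrict_apply (hB _)]
    exact hM.indep n _ (fun i => (hB i).inter hS) fun i k hik =>
      (hd hik).mono inter_subset_left inter_subset_left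
  · simp only [insertGap_apply x t _ hB, Measure.restrict_apply hB]
    rw [hM.map_eq hν (measurable_openGap x t hB) (isBounded_preimage_openGap ht hb),
      hM.map_eq hν (hB.inter hS) (hb.subset inter_subset_left), measureReal_def,
      volume_preimage_openGap ht hB, measureReal_def]

/-- An event that forces `(x, x + t]` to be empty is at least as probable after a gap of length `t` is
inserted at `x`: by `map_insertGap` this amounts to erasing the points in `(x, x + t]`, which changes
nothing on the event. -/
theorem IsPoissonRandomMeasure.measure_le_insertGap (hM : IsPoissonRandomMeasure P ν M) (hν : 0 < ν)
    {x t : ℝ} (ht : 0 ≤ t) {B : Set (Measure ℝ)} (hB : MeasurableSet B)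
    (h0 : ∀ μ ∈ B, μ (Ioc x (x + t)) = 0) :
    P {ω | M ω ∈ B} ≤ P {ω | insertGap x t (M ω) ∈ B} := by
  have hS : MeasurableSet (Ioc x (x + t))ᶜ := measurableSet_Ioc.compl
  have h := congrArg (fun Q => Q B) (hM.map_insertGap hν (x := x) ht)
  have m1 : Measurable fun ω => insertGap x t (M ω) := (measurable_insertGap x t).comp hM.measurable
  have m2 : Measurable fun ω => (M ω).restrict (Ioc x (x + t))ᶜ :=
    (measurable_restrict_measure hS).comp hM.measurable
  rw [Measure.map_apply m1 hB, Measure.map_apply m2 hB] at h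
  refine le_of_le_of_eq (measure_mono fun ω hω => ?_) h.symm
  have h1 : (M ω).restrict (Ioc x (x + t))ᶜ = M ω := by
    refine Measure.restrict_eq_self_of_ae_mem ?_
    filter_upwards [measure_eq_zero_iff_ae_notMem.1 (h0 _ hω)] with y hy using hy
  show (M ω).restrict (Ioc x (x + t))ᶜ ∈ B
  rw [h1]
  exact hω

end

/-! ### Measurability of the ground state energy -/

theorem IsTrial.sq_le {a b : ℝ} {f g : ℝ → ℝ} (h : IsTrial a b f g) (hab : a ≤ b) (x : ℝ) :
    f x ^ 2 ≤ (b - a) * ∫ t, g t ^ 2 := by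
  have h0 : 0 ≤ ∫ t, g t ^ 2 := integral_nonneg fun t => sq_nonneg _
  by_cases hx : x ∈ Ioo a b
  · have h1 := h.sq_sub_le hx.1.le
    rw [h.f_zero a fun h => lt_irrefl _ h.1, sub_zero] at h1
    refine h1.trans ?_
    rw [intervalIntegral.integral_of_le hx.1.le]
    have h2 : ∫ t in Ioc a x, g t ^ 2 ≤ ∫ t, g t ^ 2 :=
      setIntegral_le_integral h.integrable_sq (ae_of_all _ fun t => sq_nonneg _)
    have h3 : 0 ≤ x - a := by linarith [hx.1]
    calc _ ≤ (x - a) * ∫ t, g t ^ 2 := by gcongr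
      _ ≤ _ := by
        gcongr
        exact hx.2.le
  · rw [h.f_zero x hx]
    rw [zero_pow two_ne_zero]
    exact mul_nonneg (by linarith) h0

/-- A Poincaré inequality: on a bounded interval `∫ f'²` controls the whole quadratic form. -/
theorem exists_formEnergy_le_mul {a b : ℝ} (hab : a ≤ b) {V : ℝ → ℝ} (hV : IsPot V) :
    ∃ C, 0 ≤ C ∧ ∀ f g, IsTrial a b f g → formEnergy V f g ≤ C * ∫ x, g x ^ 2 := by
  obtain ⟨C, hC⟩ := hV.bdd (max |a| |b|)
  have hC' : ∀ x ∈ Ioo a b, V x ≤ |C| := fun x hx => (hC x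
    ⟨by linarith [hx.1, neg_abs_le a, le_max_left |a| |b|],
      by linarith [hx.2, le_abs_self b, le_max_right |a| |b|]⟩).trans (le_abs_self C)
  have hba : 0 ≤ b - a := by linarith
  refine ⟨1 + |C| * (b - a) * (b - a), by positivity, fun f g h => ?_⟩
  set G := ∫ x, g x ^ 2 with hG
  have h1 : ∫ x, V x * f x ^ 2 ≤ ∫ x, (Ioo a b).indicator (fun _ => |C| * ((b - a) * G)) x := by
    refine integral_mono (h.integrable_pot hV) ((integrable_indicator_iff measurableSet_Ioo).2
      (integrableOn_const measure_Ioo_lt_top.ne)) fun x => ?_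
    by_cases hx : x ∈ Ioo a b
    · simp only [indicator_of_mem hx]
      exact mul_le_mul (hC' x hx) (h.sq_le hab x) (sq_nonneg _) (abs_nonneg _)
    · simp [indicator_of_notMem hx, h.f_zero x hx]
  rw [integral_indicator measurableSet_Ioo, setIntegral_const, measureReal_def, Real.volume_Ioo,
    ENNReal.toReal_ofReal hba, smul_eq_mul] at h1
  unfold formEnergy
  linarith

/-- The quadratic form is continuous in the following weak sense. -/
theorem formEnergy_le_of_isTrial {a b : ℝ} {V f g f' g' : ℝ → ℝ} (hV : IsPot V)
    (h : IsTrial a b f g) (h' : IsTrial a b f' g') {η : ℝ} (hη : 0 < η) :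
    formEnergy V f' g' ≤ (1 + η) * formEnergy V f g +
      (1 + 1 / η) * formEnergy V (fun x => f' x + -1 * f x) (fun x => g' x + -1 * g x) := by
  have hd := h'.add (h.const_mul (-1))
  have key : ∀ x y : ℝ, y ^ 2 ≤ (1 + η) * x ^ 2 + (1 + 1 / η) * (y + -1 * x) ^ 2 := by
    intro x y
    have e : (1 + η) * x ^ 2 + (1 + 1 / η) * (y + -1 * x) ^ 2 - y ^ 2 =
        (η * x - (y - x)) ^ 2 / η := by
      field_simp
      ring
    have : 0 ≤ (η * x - (y - x)) ^ 2 / η := by positivity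
    linarith
  have e1 : ∫ x, g' x ^ 2 ≤ (1 + η) * (∫ x, g x ^ 2) +
      (1 + 1 / η) * ∫ x, (g' x + -1 * g x) ^ 2 := by
    rw [← integral_const_mul, ← integral_const_mul,
      ← integral_add (h.integrable_sq.const_mul _) (hd.integrable_sq.const_mul _)]
    exact integral_mono h'.integrable_sq ((h.integrable_sq.const_mul _).add
      (hd.integrable_sq.const_mul _)) fun x => key _ _
  have e2 : ∫ x, V x * f' x ^ 2 ≤ (1 + η) * (∫ x, V x * f x ^ 2) +
      (1 + 1 / η) * ∫ x, V x * (f' x + -1 * f x) ^ 2 := by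
    rw [← integral_const_mul, ← integral_const_mul,
      ← integral_add ((h.integrable_pot hV).const_mul _) ((hd.integrable_pot hV).const_mul _)]
    refine integral_mono (h'.integrable_pot hV) (((h.integrable_pot hV).const_mul _).add
      ((hd.integrable_pot hV).const_mul _)) fun x => ?_
    have := mul_le_mul_of_nonneg_left (key (f x) (f' x)) (hV.nonneg x)
    simp only
    linarith
  unfold formEnergy
  linarith

/-- A countable family of trial functions suffices to compute all ground state energies. -/
theorem exists_countable_trials {a b : ℝ} (hab : a < b) : ∃ D : Set ((ℝ → ℝ) × (ℝ → ℝ)),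
    D.Countable ∧ D.Nonempty ∧ (∀ p ∈ D, IsTrial a b p.1 p.2) ∧
    ∀ V, IsPot V → groundEnergy a b V = ⨅ p : D, formEnergy V p.1.1 p.1.2 := by
  have : Fact ((2 : ENNReal) ≠ ⊤) := ⟨by simp⟩
  set S : Set (Lp ℝ 2 (volume : Measure ℝ)) :=
    {G | ∃ f g, IsTrial a b f g ∧ ∫ x, f x ^ 2 = 1 ∧ g =ᵐ[volume] G} with hS
  obtain ⟨T, hTS, hTc, hTd⟩ :=
    (TopologicalSpace.IsSeparable.of_separableSpace S).exists_countable_dense_subset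
  choose! F G hF hmass hFG using fun (q : Lp ℝ 2 (volume : Measure ℝ)) (hq : q ∈ S) => hq
  have hdense : ∀ f g, IsTrial a b f g → ∫ x, f x ^ 2 = 1 → ∀ ε > 0, ∃ q ∈ T,
      ∫ x, (G q x + -1 * g x) ^ 2 < ε := by
    intro f g h h1 ε hε
    have hmem : h.memLp.toLp g ∈ closure T := hTd ⟨f, g, h, h1, (h.memLp.coeFn_toLp).symm⟩
    obtain ⟨q, hq, hdist⟩ := Metric.mem_closure_iff.1 hmem (Real.sqrt ε) (Real.sqrt_pos.2 hε)
    refine ⟨q, hq, ?_⟩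
    have e : ∫ x, (G q x + -1 * g x) ^ 2 = ‖q - h.memLp.toLp g‖ ^ 2 := by
      rw [← real_inner_self_eq_norm_sq, L2.inner_def]
      refine integral_congr_ae ?_
      filter_upwards [hFG q (hTS hq), h.memLp.coeFn_toLp, Lp.coeFn_sub q (h.memLp.toLp g)]
        with x h2 h3 h4
      rw [h4, Pi.sub_apply, h3, h2]
      simp only [RCLike.inner_apply, conj_trivial]
      ring
    rw [e, ← dist_eq_norm, dist_comm]
    exact (Real.lt_sqrt dist_nonneg).1 hdist
  obtain ⟨f₀, g₀, h₀, h₁⟩ := exists_isTrial hab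
  obtain ⟨q₀, hq₀, -⟩ := hdense f₀ g₀ h₀ h₁ 1 one_pos
  refine ⟨(fun q => (F q, G q)) '' T, hTc.image _, ⟨_, mem_image_of_mem _ hq₀⟩, ?_, fun V hV => ?_⟩
  · rintro _ ⟨q, hq, rfl⟩
    exact hF q (hTS hq)
  have hbdd : BddBelow (range fun p : ((fun q => (F q, G q)) '' T) => formEnergy V p.1.1 p.1.2) :=
    ⟨0, by rintro _ ⟨p, rfl⟩; exact formEnergy_nonneg hV _ _⟩
  have hne : Nonempty ((fun q => (F q, G q)) '' T) := ⟨⟨_, mem_image_of_mem _ hq₀⟩⟩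
  refine le_antisymm (le_ciInf ?_) (le_groundEnergy hab fun f g h h1 => ?_)
  · rintro ⟨_, q, hq, rfl⟩
    have := groundEnergy_mul_le hV (hF q (hTS hq))
    rwa [hmass q (hTS hq), mul_one] at this
  obtain ⟨C, hC0, hC⟩ := exists_formEnergy_le_mul hab.le hV
  refine le_of_forall_pos_le_add fun ε hε => ?_
  set E := formEnergy V f g with hE
  have hE0 : 0 ≤ E := formEnergy_nonneg hV _ _
  -- the relative and the absolute error contribute `ε / 2` each
  set η := ε / (2 * (E + 1)) with hη
  have hη0 : 0 < η := by positivity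
  obtain ⟨q, hq, hlt⟩ := hdense f g h h1 (ε / (2 * ((1 + 1 / η) * (C + 1)))) (by positivity)
  have hd := (hF q (hTS hq)).add (h.const_mul (-1))
  have h2 := formEnergy_le_of_isTrial hV h (hF q (hTS hq)) hη0
  have h3 := hC _ _ hd
  have h4 : (1 + 1 / η) * formEnergy V (fun x => F q x + -1 * f x) (fun x => G q x + -1 * g x) ≤
      ε / 2 := by
    have h5 : C * ∫ x, (G q x + -1 * g x) ^ 2 ≤
        (C + 1) * (ε / (2 * ((1 + 1 / η) * (C + 1)))) := by
      gcongr
      linarith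
    calc _ ≤ (1 + 1 / η) * ((C + 1) * (ε / (2 * ((1 + 1 / η) * (C + 1))))) := by
          gcongr
          exact h3.trans h5
      _ = ε / 2 := by field_simp
  have h6 : η * E ≤ ε / 2 := by
    rw [hη, div_mul_eq_mul_div, div_le_div_iff₀ (by positivity) two_pos]
    nlinarith
  have h7 : (⨅ p : ((fun q => (F q, G q)) '' T), formEnergy V p.1.1 p.1.2) ≤
      formEnergy V (F q) (G q) := ciInf_le hbdd ⟨_, mem_image_of_mem _ hq⟩
  linarith

theorem IsSite.integral_pot_mul {v : ℝ → ℝ} {d : ℝ} (hv : IsSite v d) (μ : Measure ℝ)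
    [IsLocallyFiniteMeasure μ] {a b : ℝ} {f g : ℝ → ℝ} (h : IsTrial a b f g) :
    ∫ x, pot v μ x * f x ^ 2 =
      (∫⁻ y, (∫⁻ x, ENNReal.ofReal (v (x - y) * f x ^ 2)) ∂μ).toReal := by
  have hpot := hv.isPot μ
  have hm : Measurable fun p : ℝ × ℝ => ENNReal.ofReal (v (p.1 - p.2) * f p.1 ^ 2) :=
    ((hv.meas.comp (measurable_fst.sub measurable_snd)).mul
      ((h.continuous.measurable.comp measurable_fst).pow_const 2)).ennreal_ofReal
  rw [integral_eq_lintegral_of_nonneg_ae (ae_of_all _ fun x => mul_nonneg (hpot.nonneg x)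
    (sq_nonneg _)) (hpot.meas.mul (h.continuous.measurable.pow_const 2)).aestronglyMeasurable,
    ← lintegral_lintegral_swap (f := fun x y => ENNReal.ofReal (v (x - y) * f x ^ 2))
      hm.aemeasurable]
  congr 1
  refine lintegral_congr fun x => ?_
  rw [pot, ← integral_mul_const, ofReal_integral_eq_lintegral_ofReal
    ((hv.integrable μ x).mul_const _) (ae_of_all _ fun y => mul_nonneg (hv.nonneg _) (sq_nonneg _))]

/-- On the locally finite configurations the ground state energy is a measurable function. -/
theorem IsSite.exists_measurable_groundEnergy {v : ℝ → ℝ} {d : ℝ} (hv : IsSite v d) {a b : ℝ}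
    (hab : a < b) : ∃ e : Measure ℝ → ℝ, Measurable e ∧
      ∀ μ : Measure ℝ, IsLocallyFiniteMeasure μ → groundEnergy a b (pot v μ) = e μ := by
  obtain ⟨D, hDc, -, hDt, hD⟩ := exists_countable_trials hab
  have hDc' : Countable D := hDc.to_subtype
  refine ⟨fun μ => ⨅ p : D, ((∫ x, p.1.2 x ^ 2) +
    (∫⁻ y, (∫⁻ x, ENNReal.ofReal (v (x - y) * p.1.1 x ^ 2)) ∂μ).toReal), ?_, fun μ hμ => ?_⟩
  · refine Measurable.iInf fun p => ((Measure.measurable_lintegral ?_).ennreal_toReal).const_add _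
    have hm : Measurable fun q : ℝ × ℝ => ENNReal.ofReal (v (q.2 - q.1) * p.1.1 q.2 ^ 2) :=
      ((hv.meas.comp (measurable_snd.sub measurable_fst)).mul
        (((hDt p.1 p.2).continuous.measurable.comp measurable_snd).pow_const 2)).ennreal_ofReal
    exact hm.lintegral_prod_right'
  · rw [hD _ (hv.isPot μ)]
    refine iInf_congr fun p => ?_
    rw [formEnergy, hv.integral_pot_mul μ (hDt p.1 p.2)]

/-! ### Probabilities of the exceptional events -/

theorem groundEnergy_le_of_eq_zero {α β : ℝ} (h : α < β) {V : ℝ → ℝ} (hV : IsPot V)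
    (h0 : ∀ x ∈ Ioo α β, V x = 0) : groundEnergy α β V ≤ (Real.pi / (β - α)) ^ 2 := by
  set k := Real.pi / (β - α) with hk
  have hl : 0 < β - α := by linarith
  have hk0 : 0 < k := div_pos Real.pi_pos hl
  have hkπ : k * β - k * α = Real.pi := by rw [hk]; field_simp
  set f : ℝ → ℝ := (Ioo α β).indicator fun x => Real.sin (k * x - k * α) with hf
  set g : ℝ → ℝ := (Ioo α β).indicator fun x => Real.cos (k * x - k * α) * k with hg
  have hgi : Integrable g := (integrable_indicator_iff measurableSet_Ioo).2
    ((Continuous.integrableOn_Icc (by fun_prop)).mono_set Ioo_subset_Icc_self)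
  have hsin : ∀ z, ∫ t in α..z, Real.cos (k * t - k * α) * k = Real.sin (k * z - k * α) := by
    intro z
    rw [intervalIntegral.integral_eq_sub_of_hasDerivAt (f := fun t => Real.sin (k * t - k * α))
      (fun t _ => ?_) (Continuous.intervalIntegrable (by fun_prop) _ _)]
    · simp
    · have h1 : HasDerivAt (fun t : ℝ => k * t - k * α) k t := by
        simpa using ((hasDerivAt_id t).const_mul k).sub_const (k * α)
      exact h1.sin
  have hprim : ∀ z, f z = ∫ t in α..z, g t := by
    intro z
    rcases le_total z α with hz | hz
    · rw [hf, indicator_of_notMem fun h => by linarith [h.1],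
        intervalIntegral.integral_congr_ae (g := fun _ => (0 : ℝ)), intervalIntegral.integral_zero]
      filter_upwards with t ht
      rw [uIoc_of_ge hz] at ht
      exact indicator_of_notMem (fun h => by linarith [h.1, ht.2]) _
    rcases lt_or_ge z β with hzβ | hzβ
    · have e : ∫ t in α..z, g t = ∫ t in α..z, Real.cos (k * t - k * α) * k := by
        apply intervalIntegral.integral_congr_ae
        filter_upwards with t ht
        rw [uIoc_of_le hz] at ht
        exact indicator_of_mem (show t ∈ Ioo α β from ⟨ht.1, ht.2.trans_lt hzβ⟩) _
      rw [e, hsin]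
      rcases hz.eq_or_lt with hz0 | hz0
      · rw [← hz0, sub_self, Real.sin_zero]
        exact indicator_of_notMem (fun h => lt_irrefl _ h.1) _
      · exact indicator_of_mem (show z ∈ Ioo α β from ⟨hz0, hzβ⟩) _
    · have e1 : ∫ t in β..z, g t = 0 := by
        rw [intervalIntegral.integral_congr_ae (g := fun _ => (0 : ℝ)),
          intervalIntegral.integral_zero]
        filter_upwards with t ht
        rw [uIoc_of_le hzβ] at ht
        exact indicator_of_notMem (fun h => by linarith [h.2, ht.1]) _
      have e2 : ∫ t in α..β, g t = ∫ t in α..β, Real.cos (k * t - k * α) * k := by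
        rw [intervalIntegral.integral_of_le h.le, intervalIntegral.integral_of_le h.le,
          integral_Ioc_eq_integral_Ioo, integral_Ioc_eq_integral_Ioo]
        exact setIntegral_congr_fun measurableSet_Ioo fun t ht => indicator_of_mem ht _
      rw [← intervalIntegral.integral_add_adjacent_intervals (b := β) hgi.intervalIntegrable
        hgi.intervalIntegrable, e1, e2, hsin, hkπ, Real.sin_pi, add_zero]
      exact indicator_of_notMem (fun h => by linarith [h.2]) _
  have ht : IsTrial α β f g := by
    refine ⟨?_, fun x hx => indicator_of_notMem hx _, fun x hx => indicator_of_notMem hx _,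
      fun x y => ?_⟩
    · refine (memLp_indicator_iff_restrict measurableSet_Ioo).2 ?_
      refine MemLp.of_bound (C := k) (Continuous.aestronglyMeasurable (by fun_prop))
        (ae_of_all _ fun x => ?_)
      rw [Real.norm_eq_abs, abs_mul, abs_of_pos hk0]
      exact mul_le_of_le_one_left hk0.le (Real.abs_cos_le_one _)
    · rw [hprim, hprim, intervalIntegral.integral_interval_sub_left hgi.intervalIntegrable
        hgi.intervalIntegrable]
  have key := groundEnergy_mul_le hV ht
  have hext : ∀ F : ℝ → ℝ, ∫ x, ((Ioo α β).indicator F x) ^ 2 = ∫ x in α..β, F x ^ 2 := by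
    intro F
    rw [intervalIntegral.integral_of_le h.le, integral_Ioc_eq_integral_Ioo,
      ← integral_indicator measurableSet_Ioo]
    congr 1
    funext x
    by_cases hx : x ∈ Ioo α β <;> simp [hx]
  have e1 : ∫ x, f x ^ 2 = k⁻¹ * (Real.pi / 2) := by
    rw [hf, hext, intervalIntegral.integral_comp_mul_sub (fun y => Real.sin y ^ 2) hk0.ne', sub_self,
      hkπ, integral_sin_sq]
    simp
  have e2 : ∫ x, g x ^ 2 = k ^ 2 * (k⁻¹ * (Real.pi / 2)) := by
    rw [hg, hext]
    simp only [mul_pow]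
    rw [intervalIntegral.integral_mul_const,
      intervalIntegral.integral_comp_mul_sub (fun y => Real.cos y ^ 2) hk0.ne', sub_self,
      hkπ, integral_cos_sq]
    simp
    ring
  have e3 : ∫ x, V x * f x ^ 2 = 0 := by
    have : (fun x => V x * f x ^ 2) = 0 := by
      funext x
      by_cases hx : x ∈ Ioo α β
      · simp [h0 x hx]
      · simp [hf, hx]
    rw [this]
    simp
  rw [formEnergy, e1, e2, e3, add_zero] at key
  exact le_of_mul_le_mul_right key (by positivity)

section

variable {Ω : Type*} [MeasurableSpace Ω] {P : Measure Ω} {ν : ℝ} {M : Ω → Measure ℝ}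

theorem IsPoissonRandomMeasure.measure_forall_eq_zero_le (hM : IsPoissonRandomMeasure P ν M)
    (hν : 0 < ν) {ι : Type*} (s : Finset ι) {B : ι → Set ℝ} {w : ℝ} (hB : ∀ i, MeasurableSet (B i))
    (hb : ∀ i, Bornology.IsBounded (B i)) (hd : Pairwise fun i k => Disjoint (B i) (B k))
    (hw : ∀ i, w ≤ volume.real (B i)) :
    P {ω | ∀ i ∈ s, M ω (B i) = 0} ≤ ENNReal.ofReal (Real.exp (-(ν * (s.card * w)))) := by
  have hbU : Bornology.IsBounded (⋃ i ∈ s, B i) :=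
    (Bornology.isBounded_biUnion_finset s).2 fun i _ => hb i
  have h1 := hM.measure_eq_zero (s.measurableSet_biUnion fun i _ => hB i) hbU
  refine (measure_mono fun ω hω => ?_).trans (h1.le.trans ?_)
  · exact (measure_biUnion_null_iff s.countable_toSet).2 hω
  · refine ENNReal.ofReal_le_ofReal (Real.exp_le_exp.2 (neg_le_neg ?_))
    rw [measureReal_biUnion_finset (fun i _ k _ hik => hd hik) (fun i _ => hB i)
      fun i _ => (hb i).measure_lt_top.ne]
    gcongr
    calc (s.card : ℝ) * w = ∑ i ∈ s, w := by rw [Finset.sum_const, nsmul_eq_mul]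
      _ ≤ _ := Finset.sum_le_sum fun i _ => hw i

theorem disjoint_Icc_blocks {a r d d' : ℝ} (hr : 0 < r) (hd : 0 < d) (hd' : 0 ≤ d') :
    Pairwise fun i k : ℕ => Disjoint (Icc (a + (i - 1) * r + d) (a + i * r - d'))
      (Icc (a + (k - 1) * r + d) (a + k * r - d')) := by
  intro i k hik
  refine (block_disjoint (a := a) hr hik).mono ?_ ?_ <;>
  · intro x hx
    exact ⟨by linarith [hx.1], by linarith [hx.2]⟩

theorem measurableSet_isRun (hM : Measurable M) (a r d : ℝ) (n m s : ℕ) :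
    MeasurableSet {ω | IsRun (fun j => M ω (core a r d j) ≠ 0) n m s} := by
  have e : {ω | IsRun (fun j => M ω (core a r d j) ≠ 0) n m s} =
      {ω | 1 ≤ s ∧ s + m ≤ n + 1} ∩ ⋂ j ∈ Set.Ico s (s + m), {ω | M ω (core a r d j) = 0} := by
    ext ω
    simp only [IsRun, mem_ofPred_eq, mem_inter_iff, mem_iInter, mem_Ico, not_not]
    tauto
  rw [e]
  refine (MeasurableSet.const _).inter (MeasurableSet.biInter (to_countable _) fun j _ => ?_)
  exact measurable_apply hM measurableSet_Icc (measurableSet_singleton 0)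

theorem IsPoissonRandomMeasure.measure_isRun_le (hM : IsPoissonRandomMeasure P ν M) (hν : 0 < ν)
    {a r d : ℝ} (hr : 0 < r) (hd : 0 < d) (n m s : ℕ) :
    P {ω | IsRun (fun j => M ω (core a r d j) ≠ 0) n m s} ≤
      ENNReal.ofReal (Real.exp (-(ν * (m * (r - 2 * d))))) := by
  have h := hM.measure_forall_eq_zero_le hν (Finset.Ico s (s + m)) (B := core a r d)
    (w := r - 2 * d) (fun _ => measurableSet_Icc) (fun _ => Metric.isBounded_Icc _ _)
    (disjoint_Icc_blocks hr hd hd.le) fun i => by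
      rw [core, measureReal_def, Real.volume_Icc, ENNReal.toReal_ofReal']
      refine le_of_eq_of_le ?_ (le_max_left _ _)
      ring
  rw [Nat.card_Ico, Nat.add_sub_cancel_left] at h
  refine (measure_mono fun ω hω j hj => ?_).trans h
  rw [Finset.mem_Ico] at hj
  exact not_not.1 (hω.2.2 j hj.1 hj.2)

theorem IsPoissonRandomMeasure.measure_exists_isRun_le (hM : IsPoissonRandomMeasure P ν M)
    (hν : 0 < ν) {a r d : ℝ} (hr : 0 < r) (hd : 0 < d) (n m : ℕ) (F : Finset ℕ) :
    P {ω | ∃ s ∈ F, IsRun (fun j => M ω (core a r d j) ≠ 0) n m s} ≤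
      F.card * ENNReal.ofReal (Real.exp (-(ν * (m * (r - 2 * d))))) := by
  have e : {ω | ∃ s ∈ F, IsRun (fun j => M ω (core a r d j) ≠ 0) n m s} =
      ⋃ s ∈ F, {ω | IsRun (fun j => M ω (core a r d j) ≠ 0) n m s} := by
    ext ω; simp
  rw [e]
  refine (measure_biUnion_finset_le _ _).trans ?_
  refine (Finset.sum_le_sum fun s _ => hM.measure_isRun_le hν hr hd n m s).trans ?_
  rw [Finset.sum_const, nsmul_eq_mul]

/-- Markov's inequality for the number of runs. -/
theorem IsPoissonRandomMeasure.measure_lt_card_runStarts_le (hM : IsPoissonRandomMeasure P ν M)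
    (hν : 0 < ν) {a r d : ℝ} (hr : 0 < r) (hd : 0 < d) (n m D : ℕ) :
    ((D + 1 : ℕ) : ENNReal) *
      P {ω | D < (runStarts (fun j => M ω (core a r d j) ≠ 0) n m).card} ≤
      (n + 2 : ℕ) * ENNReal.ofReal (Real.exp (-(ν * (m * (r - 2 * d))))) := by
  classical
  set R : ℕ → Set Ω := fun s => {ω | IsRun (fun j => M ω (core a r d j) ≠ 0) n m s} with hR
  have hRm : ∀ s, MeasurableSet (R s) := measurableSet_isRun hM.measurable a r d n m
  set X : Ω → ENNReal := fun ω => ∑ s ∈ Finset.range (n + 2), (R s).indicator 1 ω with hX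
  have hXe : ∀ ω, X ω = (runStarts (fun j => M ω (core a r d j) ≠ 0) n m).card := by
    intro ω
    simp only [hX, runStarts, indicator_apply, Pi.one_apply]
    rw [Finset.sum_boole]
    congr!
  have hXm : Measurable X := Finset.measurable_sum _ fun s _ => measurable_one.indicator (hRm s)
  have h1 := mul_meas_ge_le_lintegral₀ (μ := P) hXm.aemeasurable ((D + 1 : ℕ) : ENNReal)
  have e : {ω | D < (runStarts (fun j => M ω (core a r d j) ≠ 0) n m).card} =
      {ω | ((D + 1 : ℕ) : ENNReal) ≤ X ω} := by
    ext ω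
    simp only [mem_ofPred_eq, hXe]
    rw [Nat.cast_le]
    exact Iff.rfl
  rw [e]
  refine h1.trans ?_
  rw [lintegral_finsetSum _ fun s _ => measurable_one.indicator (hRm s)]
  simp only [lintegral_indicator_one (hRm _)]
  refine (Finset.sum_le_sum fun s _ => hM.measure_isRun_le hν hr hd n m s).trans ?_
  rw [Finset.sum_const, nsmul_eq_mul, Finset.card_range]

/-- The probability that none of `k` disjoint blocks of length `w` is empty. -/
theorem IsPoissonRandomMeasure.measure_forall_block_ne_zero_le [IsProbabilityMeasure P]
    (hM : IsPoissonRandomMeasure P ν M)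
    (a : ℝ) {w : ℝ} (hw : 0 < w) (k : ℕ) :
    P {ω | ∀ i < k, M ω (block a w (i + 1)) ≠ 0} ≤
      ENNReal.ofReal (Real.exp (-(k * Real.exp (-(ν * w))))) := by
  have hvol : ∀ i : ℕ, volume.real (block a w (i + 1)) = w := fun i => by
    rw [block, measureReal_def, Real.volume_Ioc, ENNReal.toReal_ofReal] <;> push_cast <;> nlinarith
  have hBm : ∀ i : ℕ, MeasurableSet (block a w (i + 1)) := fun i => measurableSet_Ioc
  have hind := hM.indep k (fun i => block a w ((i : ℕ) + 1)) (fun i => hBm i)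
    fun i j hij => block_disjoint hw (by simpa [Fin.ext_iff] using hij)
  have h1 := hind.measure_inter_preimage_eq_mul Finset.univ (sets := fun _ => {0}ᶜ)
    fun i _ => (measurableSet_singleton 0).compl
  have e : {ω | ∀ i < k, M ω (block a w (i + 1)) ≠ 0} =
      ⋂ i ∈ (Finset.univ : Finset (Fin k)), (fun ω => M ω (block a w ((i : ℕ) + 1))) ⁻¹' {0}ᶜ := by
    ext ω
    simp only [mem_ofPred_eq, Finset.mem_univ, iInter_true, mem_iInter, mem_preimage, mem_compl_iff,
      mem_singleton_iff]
    exact ⟨fun h i => h i i.2, fun h i hi => h ⟨i, hi⟩⟩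
  set p := Real.exp (-(ν * w)) with hp
  have hq : ∀ i : Fin k, P ((fun ω => M ω (block a w ((i : ℕ) + 1))) ⁻¹' {0}ᶜ) ≤
      ENNReal.ofReal (Real.exp (-p)) := by
    intro i
    have hm : MeasurableSet ((fun ω => M ω (block a w ((i : ℕ) + 1))) ⁻¹' {0}) :=
      measurable_apply hM.measurable (hBm i) (measurableSet_singleton 0)
    have h2 : P ((fun ω => M ω (block a w ((i : ℕ) + 1))) ⁻¹' {0}) = ENNReal.ofReal p := by
      have := hM.measure_eq_zero (hBm i) (Metric.isBounded_Ioc _ _)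
      rw [hvol] at this
      exact this
    rw [preimage_compl, prob_compl_eq_one_sub hm, h2, ← ENNReal.ofReal_one,
      ← ENNReal.ofReal_sub _ (Real.exp_pos _).le]
    exact ENNReal.ofReal_le_ofReal (by linarith [Real.add_one_le_exp (-p)])
  rw [e, h1]
  refine (Finset.prod_le_prod' fun i _ => hq i).trans ?_
  rw [Finset.prod_const, Finset.card_univ, Fintype.card_fin, ← ENNReal.ofReal_pow (Real.exp_pos _).le,
    ← Real.exp_nat_mul]
  refine le_of_eq ?_
  congr 2
  ring

theorem IsSite.groundEnergy_le_of_block {v : ℝ → ℝ} {d : ℝ} (hv : IsSite v d) {μ : Measure ℝ}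
    [IsLocallyFiniteMeasure μ] {a b w : ℝ} {i : ℕ} (hw : 2 * d < w) (hi : 1 ≤ i) (hb : a + i * w ≤ b)
    (h0 : μ (block a w i) = 0) : groundEnergy a b (pot v μ) ≤ (Real.pi / (w - 2 * d)) ^ 2 := by
  have hd := hv.pos
  have hi' : (1 : ℝ) ≤ i := by exact_mod_cast hi
  have h1 : 0 ≤ ((i : ℝ) - 1) * w := mul_nonneg (by linarith) (by linarith)
  have h2 := groundEnergy_le_of_eq_zero (α := a + (i - 1) * w + d) (β := a + i * w - d)
    (by linarith) (hv.isPot μ) fun x hx => hv.pot_eq_zero (measure_mono_null (fun y hy => ?_) h0)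
  · refine (groundEnergy_anti (by linarith) (by linarith) (by linarith) (hv.isPot μ)).trans
      (h2.trans_eq ?_)
    congr 2
    ring
  · exact ⟨by linarith [hx.1, hy.1], by linarith [hx.2, hy.2]⟩

theorem isLocallyFiniteMeasure_iff_forall_nat {μ : Measure ℝ} :
    IsLocallyFiniteMeasure μ ↔ ∀ R : ℕ, μ (Icc (-(R : ℝ)) R) < ⊤ := by
  refine ⟨fun h R => measure_Icc_lt_top, fun h => ⟨fun x => ?_⟩⟩
  obtain ⟨R, hR⟩ := exists_nat_gt |x|
  exact ⟨_, Icc_mem_nhds (by linarith [neg_abs_le x]) (by linarith [le_abs_self x]), h R⟩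

theorem isLocallyFiniteMeasure_of_insertGap {x t : ℝ} (ht : 0 ≤ t) {μ : Measure ℝ}
    (h : IsLocallyFiniteMeasure (insertGap x t μ)) : IsLocallyFiniteMeasure μ := by
  refine isLocallyFiniteMeasure_iff_forall_nat.2 fun R => ?_
  refine lt_of_le_of_lt ?_ (measure_Icc_lt_top (μ := insertGap x t μ) (a := -(R : ℝ)) (b := R + t))
  have := insertGap_Icc (x := x) ht (α := -(R : ℝ)) (β := R + t) μ
  rwa [add_sub_cancel_right] at this

/-- The configurations that are empty in the cores of the blocks `s, …, s + m - 1` and resonant at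
the point `c`. -/
def resonantSet (v : ℝ → ℝ) (a b r d h δ : ℝ) (K s m : ℕ) (c : ℝ) : Set (Measure ℝ) :=
  {μ | IsLocallyFiniteMeasure μ ∧ (∀ j ∈ Finset.Ico s (s + m), μ (core a r d j) = 0) ∧
    IsResonant v a b d h δ K c μ}

theorem measurableSet_resonantSet {v : ℝ → ℝ} {a b r d h δ c : ℝ} {K s m : ℕ} (hv : IsSite v d)
    (hac : a < c) (hcb : c + d < b) (hh : 0 ≤ h) (hK : K * h ≤ d) :
    MeasurableSet (resonantSet v a b r d h δ K s m c) := by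
  have hd := hv.pos
  obtain ⟨e, hem, he⟩ := hv.exists_measurable_groundEnergy (a := a) (b := b) (by linarith)
  have hL : ∀ j : ℕ, ∃ e : Measure ℝ → ℝ, Measurable e ∧
      ∀ μ : Measure ℝ, IsLocallyFiniteMeasure μ → groundEnergy a (c + j * h) (pot v μ) = e μ :=
    fun j => hv.exists_measurable_groundEnergy (by nlinarith [mul_nonneg j.cast_nonneg hh (α := ℝ)])
  have hR : ∀ j : ℕ, ∃ e : Measure ℝ → ℝ, Measurable e ∧ (j ≤ K →
      ∀ μ : Measure ℝ, IsLocallyFiniteMeasure μ → groundEnergy (c + j * h) b (pot v μ) = e μ) := by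
    intro j
    by_cases hj : j ≤ K
    · have hj' : (j : ℝ) ≤ K := by exact_mod_cast hj
      obtain ⟨e, h1, h2⟩ := hv.exists_measurable_groundEnergy (a := c + j * h) (b := b)
        (by nlinarith)
      exact ⟨e, h1, fun _ => h2⟩
    · exact ⟨0, measurable_zero, fun h => absurd h hj⟩
  choose eL heLm heL using hL
  choose eR heRm heR using hR
  have e1 : resonantSet v a b r d h δ K s m c =
      (⋂ R : ℕ, {μ | μ (Icc (-(R : ℝ)) R) < ⊤}) ∩
      ((⋂ j ∈ Set.Ico s (s + m), {μ | μ (core a r d j) = 0}) ∩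
      ({μ | μ (Ioo (c - 2 * d) (c + 2 * d)) = 0} ∩
      ((⋂ j ∈ Set.Icc 1 K, {μ | e (insertGap c (j * h) μ) + 2 * δ ≤ e μ}) ∩
      (⋂ j ∈ Set.Icc 1 K, {μ | min (eL j μ) (eR j μ) ≤ e μ + δ})))) := by
    ext μ
    simp only [resonantSet, mem_ofPred_eq, mem_inter_iff, mem_iInter, Finset.mem_Ico, Set.mem_Ico,
      Set.mem_Icc, ← isLocallyFiniteMeasure_iff_forall_nat]
    refine and_congr_right fun hμ => and_congr_right fun _ => ?_
    have hins : ∀ j : ℕ, groundEnergy a b (pot v (insertGap c (j * h) μ)) =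
        e (insertGap c (j * h) μ) := fun j =>
      he _ (isLocallyFiniteMeasure_insertGap (by positivity) μ)
    constructor
    · rintro ⟨h1, h2, h3⟩
      refine ⟨h1, fun j hj => ?_, fun j hj => ?_⟩
      · rw [← hins, ← he μ hμ]; exact h2 j hj.1 hj.2
      · rw [← heL j μ hμ, ← heR j hj.2 μ hμ, ← he μ hμ]; exact h3 j hj.1 hj.2
    · rintro ⟨h1, h2, h3⟩
      refine ⟨h1, fun j hj1 hj2 => ?_, fun j hj1 hj2 => ?_⟩
      · rw [hins, he μ hμ]; exact h2 j ⟨hj1, hj2⟩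
      · rw [heL j μ hμ, heR j hj2 μ hμ, he μ hμ]; exact h3 j ⟨hj1, hj2⟩
  rw [e1]
  refine (MeasurableSet.iInter fun R => ?_).inter ((MeasurableSet.biInter (to_countable _)
    fun j _ => ?_).inter (MeasurableSet.inter ?_ ((MeasurableSet.biInter (to_countable _)
    fun j _ => ?_).inter (MeasurableSet.biInter (to_countable _) fun j _ => ?_))))
  · exact Measure.measurable_coe measurableSet_Icc measurableSet_Iio
  · exact Measure.measurable_coe measurableSet_Icc (measurableSet_singleton 0)
  · exact Measure.measurable_coe measurableSet_Ioo (measurableSet_singleton 0)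
  · exact measurableSet_le ((hem.comp (measurable_insertGap _ _)).add_const _) hem
  · exact measurableSet_le ((heLm j).min (heRm j)) (hem.add_const _)

/-- A Wegner-type estimate: resonances at a given point are improbable, because the `K + 1` events
that a resonance appears after the insertion of a gap of length `k h`, `0 ≤ k ≤ K`, are disjoint
and each is at least as probable as the resonance itself. -/
theorem IsPoissonRandomMeasure.measure_resonantSet_le [IsProbabilityMeasure P]
    (hM : IsPoissonRandomMeasure P ν M) (hν : 0 < ν)
    {v : ℝ → ℝ} {a b r d h δ c : ℝ} {K s m : ℕ} (hv : IsSite v d) (hr : 0 < r)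
    (hac : a < c) (hcb : c + d < b) (hh : 0 < h) (hδ : 0 < δ) (hK : K * h ≤ d) :
    ((K + 1 : ℕ) : ENNReal) * P {ω | M ω ∈ resonantSet v a b r d h δ K s m c} ≤
      ENNReal.ofReal (Real.exp (-(ν * (m * (r - 3 * d))))) := by
  have hd := hv.pos
  have hRm := measurableSet_resonantSet (r := r) (δ := δ) (s := s) (m := m) hv hac hcb hh.le hK
  set R := resonantSet v a b r d h δ K s m c with hR
  have hkK : ∀ k ∈ Finset.range (K + 1), (k : ℝ) * h ≤ d := fun k hk => by
    refine le_trans ?_ hK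
    have : (k : ℝ) ≤ K := by exact_mod_cast Nat.lt_succ_iff.1 (Finset.mem_range.1 hk)
    gcongr
  have h1 : ∀ k ∈ Finset.range (K + 1), P {ω | M ω ∈ R} ≤ P {ω | insertGap c (k * h) (M ω) ∈ R} := by
    intro k hk
    refine hM.measure_le_insertGap hν (by positivity) hRm fun μ hμ => ?_
    refine measure_mono_null (fun y hy => ?_) hμ.2.2.empty
    exact ⟨by linarith [hy.1], by linarith [hy.2, hkK k hk]⟩
  have hdisj : (↑(Finset.range (K + 1)) : Set ℕ).PairwiseDisjoint
      fun k : ℕ => {ω | insertGap c (k * h) (M ω) ∈ R} := by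
    intro k₁ hk₁ k₂ hk₂ hne
    refine Set.disjoint_left.2 fun ω h1 h2 => hne ?_
    have hloc : IsLocallyFiniteMeasure (M ω) :=
      isLocallyFiniteMeasure_of_insertGap (by positivity) h1.1
    exact h1.2.2.eq_of_insertGap hv hh hδ hK hac hcb
      (Nat.lt_succ_iff.1 (Finset.mem_range.1 hk₁)) (Nat.lt_succ_iff.1 (Finset.mem_range.1 hk₂))
      h2.2.2
  calc ((K + 1 : ℕ) : ENNReal) * P {ω | M ω ∈ R}
      = ∑ k ∈ Finset.range (K + 1), P {ω | M ω ∈ R} := by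
        rw [Finset.sum_const, Finset.card_range, nsmul_eq_mul]
    _ ≤ ∑ k ∈ Finset.range (K + 1), P {ω | insertGap c (k * h) (M ω) ∈ R} := Finset.sum_le_sum h1
    _ = P (⋃ k ∈ Finset.range (K + 1), {ω | insertGap c (k * h) (M ω) ∈ R}) :=
        (measure_biUnion_finset hdisj fun k _ =>
          ((measurable_insertGap c (k * h)).comp hM.measurable) hRm).symm
    _ ≤ P {ω | ∀ j ∈ Finset.Ico s (s + m),
          M ω (Icc (a + (j - 1) * r + d) (a + j * r - 2 * d)) = 0} := by
        refine measure_mono fun ω hω j hj => ?_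
        simp only [mem_iUnion, exists_prop] at hω
        obtain ⟨k, hk, hω⟩ := hω
        have h2 := hω.2.1 j hj
        have h3 := insertGap_Icc (x := c) (t := k * h) (by positivity)
          (α := a + ((j : ℝ) - 1) * r + d) (β := a + (j : ℝ) * r - d) (M ω)
        rw [← core, h2] at h3
        refine measure_mono_null (Icc_subset_Icc_right ?_) (nonpos_iff_eq_zero.1 h3)
        linarith [hkK k hk]
    _ ≤ ENNReal.ofReal (Real.exp (-(ν * ((Finset.Ico s (s + m)).card * (r - 3 * d))))) := by
        refine hM.measure_forall_eq_zero_le hν _ (fun _ => measurableSet_Icc)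
          (fun _ => Metric.isBounded_Icc _ _) (disjoint_Icc_blocks hr hd (by linarith)) fun i => ?_
        rw [measureReal_def, Real.volume_Icc, ENNReal.toReal_ofReal']
        refine le_of_eq_of_le ?_ (le_max_left _ _)
        ring
    _ = _ := by rw [Nat.card_Ico, Nat.add_sub_cancel_left]

end

/-! ### The gap at finite length -/

theorem le_ofReal_div_of_mul_le {k : ℕ} {p : ENNReal} {x : ℝ}
    (h : ((k + 1 : ℕ) : ENNReal) * p ≤ ENNReal.ofReal x) : p ≤ ENNReal.ofReal (x / (k + 1)) := by
  rw [ENNReal.ofReal_div_of_pos (by positivity), ENNReal.le_div_iff_mul_le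
    (Or.inl (by simp; positivity)) (Or.inl ENNReal.ofReal_ne_top), mul_comm]
  convert h using 2
  rw [← Nat.cast_succ, ENNReal.ofReal_natCast]

section

variable {Ω : Type*} [MeasurableSpace Ω] {P : Measure Ω} [IsProbabilityMeasure P] {ν : ℝ}
  {M : Ω → Measure ℝ}

/-- There are few runs, and hence few pairs of a run and one of its blocks, at which a resonance can
occur. -/
theorem IsPoissonRandomMeasure.measure_exists_resonant_le (hM : IsPoissonRandomMeasure P ν M)
    (hν : 0 < ν) {v : ℝ → ℝ} {a b r d h δ : ℝ} {K n m : ℕ} (hv : IsSite v d) (hr : 6 * d ≤ r)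
    (hb : b = a + n * r) (hh : 0 < h) (hδ : 0 < δ) (hK : K * h ≤ d) :
    P {ω | ∃ s j, 1 ≤ s ∧ s + m ≤ n + 1 ∧ s ≤ j ∧ j < s + m ∧
      M ω ∈ resonantSet v a b r d h δ K s m (a + (j - 1 / 2) * r)} ≤
    ENNReal.ofReal ((n + 1) * m * Real.exp (-(ν * (m * (r - 3 * d)))) / (K + 1)) := by
  have hd := hv.pos
  have hr0 : 0 < r := by linarith
  set x := Real.exp (-(ν * (m * (r - 3 * d)))) with hx
  have hx0 : 0 < x := Real.exp_pos _
  set T : Finset (ℕ × ℕ) := (Finset.Icc 1 (n + 1) ×ˢ Finset.range m).filter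
    (fun p => p.1 + m ≤ n + 1) with hT
  have hsub : {ω | ∃ s j, 1 ≤ s ∧ s + m ≤ n + 1 ∧ s ≤ j ∧ j < s + m ∧
      M ω ∈ resonantSet v a b r d h δ K s m (a + (j - 1 / 2) * r)} ⊆
      ⋃ p ∈ T, {ω | M ω ∈ resonantSet v a b r d h δ K p.1 m
        (a + (((p.1 + p.2 : ℕ) : ℝ) - 1 / 2) * r)} := by
    rintro ω ⟨s, j, h1, h2, h3, h4, h5⟩
    simp only [mem_iUnion]
    refine ⟨(s, j - s), ?_, ?_⟩
    · simp only [hT, Finset.mem_filter, Finset.mem_product, Finset.mem_Icc, Finset.mem_range]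
      omega
    · simp only [mem_ofPred_eq]
      rwa [Nat.add_sub_cancel' h3]
  refine (measure_mono hsub).trans ((measure_biUnion_finset_le _ _).trans ?_)
  have hterm : ∀ p ∈ T, P {ω | M ω ∈ resonantSet v a b r d h δ K p.1 m
        (a + (((p.1 + p.2 : ℕ) : ℝ) - 1 / 2) * r)} ≤ ENNReal.ofReal (x / (K + 1)) := by
    intro p hp
    simp only [hT, Finset.mem_filter, Finset.mem_product, Finset.mem_Icc, Finset.mem_range] at hp
    have h1 : (1 : ℝ) ≤ ((p.1 + p.2 : ℕ) : ℝ) := by exact_mod_cast (by omega : 1 ≤ p.1 + p.2)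
    have h2 : ((p.1 + p.2 : ℕ) : ℝ) ≤ n := by exact_mod_cast (by omega : p.1 + p.2 ≤ n)
    have h3 : r ≤ ((p.1 + p.2 : ℕ) : ℝ) * r := le_mul_of_one_le_left hr0.le h1
    have h4 : ((p.1 + p.2 : ℕ) : ℝ) * r ≤ n * r := by gcongr
    refine le_ofReal_div_of_mul_le (hM.measure_resonantSet_le hν hv hr0 ?_ ?_ hh hδ hK)
    · linarith
    · rw [hb]; linarith
  refine (Finset.sum_le_sum hterm).trans ?_
  rw [Finset.sum_const, nsmul_eq_mul, ← ENNReal.ofReal_natCast,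
    ← ENNReal.ofReal_mul (Nat.cast_nonneg _)]
  refine ENNReal.ofReal_le_ofReal ?_
  have hc : (T.card : ℝ) ≤ (n + 1) * m := by
    have : T.card ≤ (n + 1) * m := by
      refine (Finset.card_filter_le _ _).trans ?_
      rw [Finset.card_product, Nat.card_Icc, Finset.card_range, Nat.add_sub_cancel]
    exact_mod_cast this
  rw [mul_div_assoc]
  gcongr

/-- The probability that the spectral gap is smaller than `δ` or that the lowest eigenvalue exceeds
`Q₁`, in terms of the parameters of the block decomposition. The five summands bound the
probabilities that there is no empty interval of length `w`, that there are more than `D` runs of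
length `m`, that one of them meets the last part of length `A` of the interval, that there is a run
of length `m'`, and that there is a resonance. `Kc` is the constant of `exists_localization_const`. -/
theorem IsPoissonRandomMeasure.measure_gap_compl_le (hM : IsPoissonRandomMeasure P ν M)
    (hν : 0 < ν) {Kc : ℝ}
    (hKc : ∀ {a b A k : ℝ} {V f g : ℝ → ℝ}, 0 < A →
      IsPot V → IsTrial a b f g → ∫ x, f x ^ 2 = 1 →
      (∀ h h', IsTrial (b - A) b h h' → k ^ 2 * ∫ x, h x ^ 2 ≤ formEnergy V h h') →
      a ≤ b - A → formEnergy V f g + Kc / A ^ 2 < k ^ 2 →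
      groundEnergy a (b - A / 2) V ≤ formEnergy V f g + Kc / A ^ 2)
    {v : ℝ → ℝ} {d : ℝ} (hv : IsSite v d)
    {L r c₀ k k' Q Q₁ κ A e₀ δ h w : ℝ} {n m m' D K k₁ : ℕ} (hL0 : 0 < L) (hr : 6 * d ≤ r)
    (hL : L = n * r) (hc₀ : c₀ ≤ ∫ x, v x)
    (hk : 0 < k) (hkπ : k * ((m + 1) * r) < Real.pi)
    (hkc : k * Real.tan (k * ((m + 1) * r) / 2) ≤ c₀ / 2)
    (hk' : 0 ≤ k') (hkπ' : k' * ((m' + 1) * r) < Real.pi)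
    (hkc' : k' * Real.tan (k' * ((m' + 1) * r) / 2) ≤ c₀ / 2) (he₀ : e₀ ≤ k' ^ 2)
    (hm : 1 ≤ m) (hκ : 0 < κ) (hAL : A ≤ L) (hdA : 2 * d ≤ A) (hδ : 0 < δ)
    (hKA : Kc / A ^ 2 ≤ δ) (hQk : Q < k ^ 2)
    (hcond : 2 * r * κ * (D * (m + 2)) + 12 * r ^ 2 * Q < 1 - Q / k ^ 2)
    (heδ : 4 * δ ≤ e₀) (hh : 8 * δ ≤ h * κ * e₀) (hh0 : 0 < h) (hK : K * h ≤ d)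
    (hw : 2 * d < w) (hk₁ : k₁ * w ≤ L) (hQ₁ : (Real.pi / (w - 2 * d)) ^ 2 ≤ Q₁)
    (hQ : Q₁ + 2 * δ ≤ Q) :
    P {ω | ¬ (δ ≤ eigenvalue L (pot v (M ω)) 2 - eigenvalue L (pot v (M ω)) 1 ∧
        eigenvalue L (pot v (M ω)) 1 ≤ Q₁)} ≤
      ENNReal.ofReal (Real.exp (-(k₁ * Real.exp (-(ν * w))))) +
      (ENNReal.ofReal ((n + 2) * Real.exp (-(ν * (m * (r - 2 * d)))) / (D + 1)) +
      (ENNReal.ofReal ((A / r + 2) * Real.exp (-(ν * (m * (r - 2 * d))))) +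
      (ENNReal.ofReal ((n + 2) * Real.exp (-(ν * (m' * (r - 2 * d))))) +
      ENNReal.ofReal ((n + 1) * m * Real.exp (-(ν * (m * (r - 3 * d)))) / (K + 1))))) := by
  have hd := hv.pos
  have hr0 : 0 < r := by linarith
  set a : ℝ := -L / 2 with ha
  have hb : L / 2 = a + n * r := by rw [ha, ← hL]; ring
  have hab : a < L / 2 := by rw [ha]; linarith
  set occ : Ω → ℕ → Prop := fun ω j => M ω (core a r d j) ≠ 0 with hocc
  set c := ⌈A / r⌉₊ with hc
  set B₁ : Set Ω := {ω | ∀ i < k₁, M ω (block a w (i + 1)) ≠ 0}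
  set B₂ : Set Ω := {ω | D < (runStarts (fun j => M ω (core a r d j) ≠ 0) n m).card}
  set B₃ : Set Ω := {ω | ∃ s ∈ Finset.Icc (n + 1 - m - c) (n + 1 - m),
    IsRun (fun j => M ω (core a r d j) ≠ 0) n m s}
  set B₄ : Set Ω := {ω | ∃ s ∈ Finset.range (n + 2),
    IsRun (fun j => M ω (core a r d j) ≠ 0) n m' s}
  set B₅ : Set Ω := {ω | ∃ s j, 1 ≤ s ∧ s + m ≤ n + 1 ∧ s ≤ j ∧ j < s + m ∧
      M ω ∈ resonantSet v a (L / 2) r d h δ K s m (a + (j - 1 / 2) * r)}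
  have h1 : P B₁ ≤ ENNReal.ofReal (Real.exp (-(k₁ * Real.exp (-(ν * w))))) :=
    hM.measure_forall_block_ne_zero_le a (by linarith) k₁
  have h2 : P B₂ ≤
      ENNReal.ofReal ((n + 2) * Real.exp (-(ν * (m * (r - 2 * d)))) / (D + 1)) := by
    refine le_ofReal_div_of_mul_le ((hM.measure_lt_card_runStarts_le hν hr0 hd n m D).trans ?_)
    rw [← ENNReal.ofReal_natCast, ← ENNReal.ofReal_mul (Nat.cast_nonneg _)]
    push_cast
    exact le_rfl
  have h3 : P B₃ ≤ ENNReal.ofReal ((A / r + 2) * Real.exp (-(ν * (m * (r - 2 * d))))) := by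
    refine (hM.measure_exists_isRun_le hν hr0 hd n m _).trans ?_
    rw [← ENNReal.ofReal_natCast, ← ENNReal.ofReal_mul (Nat.cast_nonneg _)]
    refine ENNReal.ofReal_le_ofReal ?_
    gcongr
    have h5 : (Finset.Icc (n + 1 - m - c) (n + 1 - m)).card ≤ c + 1 := by
      rw [Nat.card_Icc]; omega
    have h6 : (c : ℝ) < A / r + 1 := Nat.ceil_lt_add_one (div_nonneg (by linarith) hr0.le)
    have h7 : ((Finset.Icc (n + 1 - m - c) (n + 1 - m)).card : ℝ) ≤ c + 1 := by exact_mod_cast h5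
    linarith
  have h4 : P B₄ ≤ ENNReal.ofReal ((n + 2) * Real.exp (-(ν * (m' * (r - 2 * d))))) := by
    refine (hM.measure_exists_isRun_le hν hr0 hd n m' _).trans ?_
    rw [← ENNReal.ofReal_natCast, ← ENNReal.ofReal_mul (Nat.cast_nonneg _), Finset.card_range]
    push_cast
    exact le_rfl
  have h5 : P B₅ ≤
      ENNReal.ofReal ((n + 1) * m * Real.exp (-(ν * (m * (r - 3 * d)))) / (K + 1)) :=
    hM.measure_exists_resonant_le hν hv hr hb hh0 hδ hK
  have hae : ∀ᵐ ω ∂P, ¬ (δ ≤ eigenvalue L (pot v (M ω)) 2 - eigenvalue L (pot v (M ω)) 1 ∧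
        eigenvalue L (pot v (M ω)) 1 ≤ Q₁) → ω ∈ B₁ ∪ (B₂ ∪ (B₃ ∪ (B₄ ∪ B₅))) := by
    have hint : ∀ᵐ ω ∂P, ∀ j : ℕ, ∃ i : ℕ, M ω (core a r d j) = i := ae_all_iff.2 fun j =>
      hM.ae_mem_range hν measurableSet_Icc (Metric.isBounded_Icc _ _)
    filter_upwards [hM.ae_isLocallyFiniteMeasure hν, hint] with ω hloc hintω hgap
    by_contra hbad
    simp only [mem_union, not_or] at hbad
    obtain ⟨b1, b2, b3, b4, b5⟩ := hbad
    have hpot := hv.isPot (M ω)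
    have hμ : ∀ j, M ω (core a r d j) ≠ 0 → 1 ≤ M ω (core a r d j) := by
      intro j hj
      obtain ⟨i, hi⟩ := hintω j
      rw [hi] at hj ⊢
      have : i ≠ 0 := by rintro rfl; simp at hj
      exact_mod_cast Nat.one_le_iff_ne_zero.2 this
    -- an upper bound for the ground state energy from an empty interval
    have hup : groundEnergy a (L / 2) (pot v (M ω)) ≤ Q₁ := by
      have : ∃ i < k₁, M ω (block a w (i + 1)) = 0 := by
        by_contra! hcon
        exact b1 hcon
      obtain ⟨i, hi, hi0⟩ := this
      refine (hv.groundEnergy_le_of_block hw (Nat.le_add_left 1 i) ?_ hi0).trans hQ₁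
      have : ((i + 1 : ℕ) : ℝ) * w ≤ k₁ * w := by
        have : ((i + 1 : ℕ) : ℝ) ≤ k₁ := by exact_mod_cast hi
        gcongr
        linarith
      rw [ha]
      linarith
    -- a lower bound from the absence of very long runs
    have hlow : e₀ ≤ groundEnergy a (L / 2) (pot v (M ω)) := by
      refine he₀.trans (sq_le_groundEnergy hr0 hb hab hpot (occ := fun j => M ω (core a r d j) ≠ 0)
        (fun j _ _ hj => hc₀.trans (hv.le_setIntegral_pot (M ω) (hμ j hj))) hk' hkπ' hkc'
        fun s hs => b4 ⟨s, ?_, hs⟩)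
      have := hs.2.1
      exact Finset.mem_range.2 (by omega)
    have hone := eigenvalue_one_le hL0 hpot
    have hgap' : eigenvalue L (pot v (M ω)) 2 - eigenvalue L (pot v (M ω)) 1 < δ := by
      by_contra! hcon
      exact hgap ⟨hcon, hone.trans hup⟩
    have hright : ∀ s, IsRun (fun j => M ω (core a r d j) ≠ 0) n m s →
        a + (s + m) * r ≤ L / 2 - A := by
      intro s hs
      by_contra! hcon
      refine b3 ⟨s, Finset.mem_Icc.2 ?_, hs⟩
      have h6 : A / r ≤ c := Nat.le_ceil _
      rw [div_le_iff₀ hr0] at h6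
      have h7 : (n : ℝ) * r < (s + m + c) * r := by linarith
      have h8 : (n : ℝ) < s + m + c := lt_of_mul_lt_mul_right h7 hr0.le
      have h9 : n < s + m + c := by exact_mod_cast h8
      have := hs.2.1
      omega
    have hsplit : ∀ y ∈ Ioo a (L / 2), min (groundEnergy a y (pot v (M ω)))
        (groundEnergy y (L / 2) (pot v (M ω))) ≤ groundEnergy a (L / 2) (pot v (M ω)) + δ := by
      intro y hy
      have := min_groundEnergy_le_eigenvalue_two hL0 hpot (y := y) hy
      linarith
    obtain ⟨s, j, hs, hsj, hjm, hres⟩ := exists_isResonant hv hKc hr hb hc₀ hμ hk hkπ hkc hm hκ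
      (by rw [ha]; linarith) hdA hδ hKA hQk hcond heδ hh hh0 hK (by linarith) hlow (not_lt.1 b2)
      hright hsplit
    refine b5 ⟨s, j, hs.1, hs.2.1, hsj, hjm, hloc, fun i hi => ?_, hres⟩
    rw [Finset.mem_Ico] at hi
    exact not_not.1 (hs.2.2 i hi.1 hi.2)
  calc _ ≤ P (B₁ ∪ (B₂ ∪ (B₃ ∪ (B₄ ∪ B₅)))) := measure_mono_ae hae
    _ ≤ _ := (measure_union_le _ _).trans (add_le_add h1 ((measure_union_le _ _).trans (add_le_add h2
        ((measure_union_le _ _).trans (add_le_add h3 ((measure_union_le _ _).trans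
        (add_le_add h4 h5)))))))

end

/-! ### Asymptotics -/

theorem eventually_mul_pow_le_exp (c : ℝ) (p : ℕ) {s : ℝ} (hs : 0 < s) :
    ∀ᶠ x : ℝ in atTop, c * x ^ p ≤ Real.exp (s * x) := by
  have h := (tendsto_rpow_mul_exp_neg_mul_atTop_nhds_zero (p : ℝ) s hs).const_mul c
  rw [mul_zero] at h
  filter_upwards [h.eventually (gt_mem_nhds one_pos)] with x hx
  rw [Real.rpow_natCast, neg_mul, Real.exp_neg, ← mul_assoc, ← div_eq_mul_inv,
    div_lt_one (Real.exp_pos _)] at hx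
  exact hx.le

theorem exists_blocks {L r₀ : ℝ} (hr₀ : 0 < r₀) (hL : r₀ ≤ L) :
    ∃ (n : ℕ) (r : ℝ), L = n * r ∧ r₀ ≤ r ∧ r ≤ 2 * r₀ ∧ (n : ℝ) ≤ L / r₀ := by
  have hL0 : 0 < L := by linarith
  have hLr : 1 ≤ L / r₀ := by rwa [le_div_iff₀ hr₀, one_mul]
  have hn1 : 1 ≤ ⌊L / r₀⌋₊ := by rwa [Nat.one_le_floor_iff]
  have hn1' : (1 : ℝ) ≤ ⌊L / r₀⌋₊ := by exact_mod_cast hn1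
  have hnL : (⌊L / r₀⌋₊ : ℝ) ≤ L / r₀ := Nat.floor_le (by positivity)
  have hn0 : (0 : ℝ) < ⌊L / r₀⌋₊ := by linarith
  refine ⟨⌊L / r₀⌋₊, L / ⌊L / r₀⌋₊, by field_simp, ?_, ?_, hnL⟩
  · rw [le_div_iff₀ hn0]
    rw [le_div_iff₀ hr₀] at hnL
    linarith
  · have := Nat.lt_floor_add_one (L / r₀)
    rw [div_lt_iff₀ hr₀] at this
    rw [div_le_iff₀ hn0]
    nlinarith

/-- The length `m` of the runs and the wave number `k` that belongs to a free interval slightly longer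
than such a run. -/
theorem exists_run_length {ν θ ℓ r τ c₀ : ℝ} (hν : 0 < ν) (hθ : 0 < θ) (hθ1 : θ ≤ 1 / 20)
    (hℓ : 0 < ℓ) (hr : 0 < r) (hνr : ν * r ≤ θ * ℓ) (hc₀ : 4 * |τ| * Real.pi * ν ≤ ℓ * c₀) :
    ∃ (m : ℕ) (k : ℝ), 1 ≤ m ∧ m * (ν * r) ≤ ℓ ∧ 0 < k ∧ k * ((m + 1) * r) = (1 - θ) * Real.pi ∧
      k * τ ≤ c₀ / 2 ∧ ((1 + θ) * (ν * Real.pi / ℓ)) ^ 2 ≤ (1 - θ) ^ 2 * k ^ 2 ∧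
      ∀ d', d' ≤ θ * r → (1 - 6 * θ) * ℓ ≤ ν * (m * (r - d')) := by
  have hπ := Real.pi_pos
  have hνr0 : 0 < ν * r := by positivity
  have hm0 : 0 ≤ (1 - 4 * θ) * ℓ / (ν * r) := div_nonneg (mul_nonneg (by linarith) hℓ.le) hνr0.le
  have hθℓ : 0 < θ * ℓ := by positivity
  have hθℓ1 : θ * ℓ ≤ 1 / 20 * ℓ := by gcongr
  have F0 : 1 ≤ ⌊(1 - 4 * θ) * ℓ / (ν * r)⌋₊ := by
    rw [Nat.one_le_floor_iff, le_div_iff₀ hνr0]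
    linarith
  have F1 := Nat.floor_le hm0
  have F2 := Nat.lt_floor_add_one ((1 - 4 * θ) * ℓ / (ν * r))
  set m := ⌊(1 - 4 * θ) * ℓ / (ν * r)⌋₊ with hm
  rw [le_div_iff₀ hνr0] at F1
  rw [div_lt_iff₀ hνr0] at F2
  have hmr0 : 0 < ((m : ℝ) + 1) * r := by positivity
  have F3 : ((m : ℝ) + 1) * r ≤ (1 - 3 * θ) * ℓ / ν := by
    rw [le_div_iff₀ hν]; linarith
  have h1θ : 0 < 1 - θ := by linarith
  have hkm : (1 - θ) * Real.pi / ((m + 1) * r) * ((m + 1) * r) = (1 - θ) * Real.pi := by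
    field_simp
  refine ⟨m, (1 - θ) * Real.pi / ((m + 1) * r), F0, by linarith, by positivity, hkm, ?_, ?_,
    fun d' hd' => ?_⟩
  · have g1 : (1 - θ) * Real.pi / ((m + 1) * r) ≤ Real.pi * ν * 2 / ℓ := by
      rw [div_le_div_iff₀ hmr0 hℓ]
      have : ℓ ≤ 2 * (((m : ℝ) + 1) * (ν * r)) := by linarith
      calc (1 - θ) * Real.pi * ℓ ≤ 1 * Real.pi * (2 * (((m : ℝ) + 1) * (ν * r))) := by
            gcongr
            linarith
        _ = _ := by ring
    calc _ ≤ (1 - θ) * Real.pi / ((m + 1) * r) * |τ| := by gcongr; exact le_abs_self τ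
      _ ≤ Real.pi * ν * 2 / ℓ * |τ| := by gcongr
      _ ≤ c₀ / 2 := by
        rw [div_mul_eq_mul_div, div_le_div_iff₀ hℓ two_pos]
        linarith
  · rw [← mul_pow]
    refine pow_le_pow_left₀ (by positivity) ?_ 2
    have g1 : ν * Real.pi / ℓ * (((m : ℝ) + 1) * r) ≤ (1 - 3 * θ) * Real.pi := by
      calc _ ≤ ν * Real.pi / ℓ * ((1 - 3 * θ) * ℓ / ν) := by gcongr
        _ = _ := by field_simp
    refine le_of_mul_le_mul_right ?_ hmr0
    rw [mul_assoc (1 - θ), hkm, mul_assoc]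
    calc (1 + θ) * (ν * Real.pi / ℓ * ((m + 1) * r)) ≤ (1 + θ) * ((1 - 3 * θ) * Real.pi) := by
          gcongr
      _ = ((1 + θ) * (1 - 3 * θ)) * Real.pi := by ring
      _ ≤ ((1 - θ) * (1 - θ)) * Real.pi :=
          mul_le_mul_of_nonneg_right (by nlinarith only [sq_nonneg θ]) hπ.le
      _ = _ := by ring
  · have g1 : (1 - θ) * r ≤ r - d' := by linarith
    have g2 : (1 - 5 * θ) * ℓ ≤ m * (ν * r) := by linarith
    calc (1 - 6 * θ) * ℓ ≤ ((1 - θ) * (1 - 5 * θ)) * ℓ := by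
          gcongr
          nlinarith
      _ = (1 - θ) * ((1 - 5 * θ) * ℓ) := by ring
      _ ≤ (1 - θ) * (m * (ν * r)) := mul_le_mul_of_nonneg_left g2 h1θ.le
      _ = ν * (m * ((1 - θ) * r)) := by ring
      _ ≤ _ := by gcongr

/-- The length `m` of runs so long that with high probability there is none, and the corresponding
wave number `k`. -/
theorem exists_long_run_length {ν θ ℓ r c₀ : ℝ} (hν : 0 < ν) (hθ : 0 < θ) (hθ1 : θ ≤ 1 / 20)
    (hℓ : 0 < ℓ) (hr : 0 < r) (hνr : ν * r ≤ θ * ℓ) (hc₀ : Real.pi * ν ≤ ℓ * (2 * c₀)) :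
    ∃ (m : ℕ) (k : ℝ), 0 < k ∧ k * ((m + 1) * r) = Real.pi / 2 ∧ k ≤ c₀ / 2 ∧
      Real.pi * ν / (12 * ℓ) ≤ k ∧ ∀ d', d' ≤ θ * r → 2 * ℓ ≤ ν * (m * (r - d')) := by
  have hπ := Real.pi_pos
  have h1θ : 0 < 1 - θ := by linarith
  have hνr' : 0 < ν * (1 - θ) * r := by positivity
  have hνr0 : 0 < ν * r := by positivity
  have hθℓ1 : θ * ℓ ≤ 1 / 20 * ℓ := by gcongr
  have G1 := Nat.le_ceil (2 * ℓ / (ν * (1 - θ) * r))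
  have G2 := Nat.ceil_lt_add_one (show 0 ≤ 2 * ℓ / (ν * (1 - θ) * r) by positivity)
  set m := ⌈2 * ℓ / (ν * (1 - θ) * r)⌉₊ with hm
  rw [div_le_iff₀ hνr'] at G1
  rw [← sub_lt_iff_lt_add, lt_div_iff₀ hνr'] at G2
  have hmr0 : 0 < ((m : ℝ) + 1) * r := by positivity
  have hX : 0 ≤ (m : ℝ) * (ν * r) := by positivity
  have G3 : 2 * ℓ ≤ ((m : ℝ) + 1) * r * ν := by
    have : 0 ≤ θ * ((m : ℝ) * (ν * r)) := by positivity
    linarith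
  have G4 : ((m : ℝ) + 1) * r * ν ≤ 6 * ℓ := by
    have g1 : θ * ((m : ℝ) * (ν * r)) ≤ 1 / 20 * ((m : ℝ) * (ν * r)) := by gcongr
    have g2 : 0 ≤ θ * (ν * r) := by positivity
    linarith
  refine ⟨m, Real.pi / (2 * ((m + 1) * r)), by positivity, by field_simp, ?_, ?_, fun d' hd' => ?_⟩
  · rw [div_le_div_iff₀ (by positivity) two_pos]
    have hc : 0 < c₀ := by
      have : 0 < ℓ * (2 * c₀) := lt_of_lt_of_le (by positivity) hc₀
      have := pos_of_mul_pos_right this hℓ.le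
      linarith
    refine le_of_mul_le_mul_right ?_ hν
    calc Real.pi * 2 * ν ≤ 2 * (ℓ * (2 * c₀)) := by linarith
      _ = 2 * c₀ * (2 * ℓ) := by ring
      _ ≤ 2 * c₀ * (((m : ℝ) + 1) * r * ν) := by gcongr
      _ = _ := by ring
  · rw [div_le_div_iff₀ (by positivity) (by positivity)]
    calc Real.pi * ν * (2 * ((m + 1) * r)) = 2 * Real.pi * (((m : ℝ) + 1) * r * ν) := by ring
      _ ≤ 2 * Real.pi * (6 * ℓ) := by gcongr
      _ = _ := by ring
  · calc 2 * ℓ ≤ (m : ℝ) * (ν * (1 - θ) * r) := G1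
      _ = ν * (m * ((1 - θ) * r)) := by ring
      _ ≤ _ := by gcongr; linarith

/-- Among the disjoint intervals of length `w`, some are empty with high probability. -/
theorem mul_le_floor_mul_exp {ν d θ ℓ : ℝ} (hν : 0 < ν) (hd : 0 < d) (hθ : 0 < θ) (hℓ : 1 ≤ ℓ)
    (h : (1 / ν + 2 * d) * (θ + 1) * Real.exp (2 * d * ν) * ℓ ^ 2 ≤
      Real.exp ((1 - 1 / (1 + θ / 2)) * ℓ)) :
    θ * ℓ ≤ ⌊Real.exp ℓ / (ℓ / (ν * (1 + θ / 2)) + 2 * d)⌋₊ *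
      Real.exp (-(ν * (ℓ / (ν * (1 + θ / 2)) + 2 * d))) := by
  have hℓ0 : 0 < ℓ := by linarith
  set w := ℓ / (ν * (1 + θ / 2)) + 2 * d with hw
  have hw1 : 0 < w := by positivity
  have g1 : Real.exp ℓ / w - 1 ≤ ⌊Real.exp ℓ / w⌋₊ := by
    linarith [Nat.lt_floor_add_one (Real.exp ℓ / w)]
  have g2 : Real.exp (-(ν * w)) ≤ 1 := Real.exp_le_one_iff.2 (neg_nonpos.2 (by positivity))
  have g3 : Real.exp ℓ * Real.exp (-(ν * w)) =
      Real.exp ((1 - 1 / (1 + θ / 2)) * ℓ) / Real.exp (2 * d * ν) := by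
    rw [← Real.exp_add, ← Real.exp_sub, hw]
    congr 1
    field_simp
    ring
  have g4 : w ≤ (1 / ν + 2 * d) * ℓ := by
    have h1 : ℓ / (ν * (1 + θ / 2)) ≤ ℓ / ν := by
      gcongr
      nlinarith
    have h2 : 2 * d * 1 ≤ 2 * d * ℓ := by gcongr
    rw [hw, add_mul, one_div_mul_eq_div]
    linarith
  have g5 : (θ + 1) * ℓ ≤ Real.exp ℓ * Real.exp (-(ν * w)) / w := by
    rw [g3, le_div_iff₀ hw1, le_div_iff₀ (Real.exp_pos _)]
    refine le_trans ?_ h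
    calc (θ + 1) * ℓ * w * Real.exp (2 * d * ν)
        ≤ (θ + 1) * ℓ * ((1 / ν + 2 * d) * ℓ) * Real.exp (2 * d * ν) := by gcongr
      _ = _ := by ring
  calc θ * ℓ ≤ (θ + 1) * ℓ - 1 := by linarith
    _ ≤ Real.exp ℓ * Real.exp (-(ν * w)) / w - Real.exp (-(ν * w)) := by linarith
    _ = (Real.exp ℓ / w - 1) * Real.exp (-(ν * w)) := by ring
    _ ≤ _ := by gcongr

/-- The parameters satisfy the smallness condition of `exists_le_sq_of_formEnergy_le` for large `ℓ`. -/
theorem localization_condition {ν θ ℓ r r₀ Q k : ℝ} {m D : ℕ} (hν : 0 < ν) (hθ : 0 < θ)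
    (hℓ : 1 ≤ ℓ) (hr₀ : 0 < r₀) (hr : 0 < r) (hr2 : r ≤ 2 * r₀) (hm : (m : ℝ) ≤ ℓ / (ν * r₀))
    (hQ : Q = ((1 + θ) * (ν * Real.pi / ℓ)) ^ 2)
    (hD : (D : ℝ) ≤ Real.exp (8 * θ * ℓ)) (hQk : Q / k ^ 2 ≤ 1 - θ)
    (h1 : 96 * r₀ ^ 2 * ((1 + θ) * (ν * Real.pi)) ^ 2 < ℓ * θ)
    (h2 : (4 / ν + 8 * r₀) * (4 / θ) * ℓ ≤ Real.exp (2 * θ * ℓ)) :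
    2 * r * Real.exp (-(10 * θ * ℓ)) * (D * (m + 2)) + 12 * r ^ 2 * Q < 1 - Q / k ^ 2 := by
  have hℓ0 : 0 < ℓ := by linarith
  have g1 : 12 * r ^ 2 * Q < θ / 2 := by
    have hQ0 : 0 ≤ Q := by rw [hQ]; positivity
    calc 12 * r ^ 2 * Q ≤ 12 * (2 * r₀) ^ 2 * Q := by gcongr
      _ = 48 * r₀ ^ 2 * ((1 + θ) * (ν * Real.pi)) ^ 2 / ℓ ^ 2 := by rw [hQ]; ring
      _ < θ / 2 := by
        rw [div_lt_iff₀ (by positivity)]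
        have h3 : ℓ * θ ≤ ℓ ^ 2 * θ := by
          gcongr
          exact le_self_pow₀ hℓ two_ne_zero
        linarith
  have hκD : Real.exp (-(10 * θ * ℓ)) * Real.exp (8 * θ * ℓ) = (Real.exp (2 * θ * ℓ))⁻¹ := by
    rw [← Real.exp_add, ← Real.exp_neg]; ring_nf
  have hm2 : 4 * r₀ * ((m : ℝ) + 2) ≤ (4 / ν + 8 * r₀) * ℓ := by
    have : 8 * r₀ * 1 ≤ 8 * r₀ * ℓ := by gcongr
    calc 4 * r₀ * ((m : ℝ) + 2) ≤ 4 * r₀ * (ℓ / (ν * r₀) + 2) := by gcongr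
      _ = 4 / ν * ℓ + 8 * r₀ := by field_simp; ring
      _ ≤ _ := by linarith
  have g2 : 2 * r * Real.exp (-(10 * θ * ℓ)) * (D * (m + 2)) ≤ θ / 2 := by
    calc 2 * r * Real.exp (-(10 * θ * ℓ)) * (D * (m + 2))
        ≤ 2 * (2 * r₀) * Real.exp (-(10 * θ * ℓ)) * (Real.exp (8 * θ * ℓ) * (m + 2)) := by gcongr
      _ = Real.exp (-(10 * θ * ℓ)) * Real.exp (8 * θ * ℓ) * (4 * r₀ * (m + 2)) := by ring
      _ ≤ (Real.exp (2 * θ * ℓ))⁻¹ * ((4 / ν + 8 * r₀) * ℓ) := by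
          rw [hκD]; gcongr
      _ ≤ θ / 2 := by
          rw [inv_mul_le_iff₀ (Real.exp_pos _)]
          have e13' : (4 / ν + 8 * r₀) * ℓ * 4 ≤ Real.exp (2 * θ * ℓ) * θ := by
            have := mul_le_mul_of_nonneg_right h2 hθ.le
            refine le_of_eq_of_le ?_ this
            field_simp
          have : 0 < (4 / ν + 8 * r₀) * ℓ := by positivity
          linarith
  linarith

section

variable {Ω : Type*} [MeasurableSpace Ω] {P : Measure Ω} [IsProbabilityMeasure P] {ν : ℝ}
  {M : Ω → Measure ℝ}

/-- On an interval of length `exp ℓ`, the gap exceeds `δ₀ exp (-ε ℓ)` and the lowest eigenvalue is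
almost as small as that of the longest empty interval, up to a probability that decays
exponentially in `ℓ`. -/
theorem IsPoissonRandomMeasure.eventually_measure_gap_compl_le (hM : IsPoissonRandomMeasure P ν M)
    (hν : 0 < ν) {d c₀ δ₀ ε θ : ℝ} (hd : 0 < d) (hc₀ : 0 < c₀) (hδ₀ : 0 < δ₀) (hε : ε < 1)
    (hθ : 0 < θ) (hθ1 : θ ≤ 1 / 20) (hθε : 20 * θ ≤ ε) :
    ∀ᶠ ℓ : ℝ in atTop, ∀ v : ℝ → ℝ, IsSite v d → c₀ ≤ ∫ x, v x →
      P {ω | ¬ (δ₀ * Real.exp (-(ε * ℓ)) ≤ eigenvalue (Real.exp ℓ) (pot v (M ω)) 2 -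
          eigenvalue (Real.exp ℓ) (pot v (M ω)) 1 ∧
        eigenvalue (Real.exp ℓ) (pot v (M ω)) 1 ≤ ((1 + θ / 2) * (ν * Real.pi / ℓ)) ^ 2)} ≤
      5 * ENNReal.ofReal (Real.exp (-(θ * ℓ))) := by
  obtain ⟨Kc, hKc0, hKc⟩ := exists_localization_const
  have hπ := Real.pi_pos
  set r₀ : ℝ := 6 * d / θ with hr₀
  have hr₀0 : 0 < r₀ := by positivity
  have hr₀d : θ * r₀ = 6 * d := by rw [hr₀]; field_simp
  set τ : ℝ := Real.tan ((1 - θ) * Real.pi / 2) with hτ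
  set q : ℝ := 1 - 1 / (1 + θ / 2) with hq
  have hq0 : 0 < q := by
    have : 1 / (1 + θ / 2) < 1 := by rw [div_lt_one (by positivity)]; linarith
    linarith
  filter_upwards [eventually_ge_atTop 1, eventually_ge_atTop (2 * r₀ * ν / θ),
    eventually_ge_atTop (4 * |τ| * Real.pi * ν / c₀),
    eventually_gt_atTop (96 * r₀ ^ 2 * ((1 + θ) * (ν * Real.pi)) ^ 2 / θ),
    eventually_ge_atTop (Real.pi * ν / (2 * c₀)),
    eventually_mul_pow_le_exp r₀ 0 one_pos, eventually_mul_pow_le_exp (1 / r₀ + 2) 0 hθ,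
    eventually_mul_pow_le_exp (2 * d) 0 (one_half_pos (α := ℝ)),
    eventually_mul_pow_le_exp (Kc / δ₀) 0 (sub_pos.2 hε),
    eventually_mul_pow_le_exp ((12 / (Real.pi * ν)) ^ 2) 2 hθ,
    eventually_mul_pow_le_exp (4 * δ₀) 0 (show 0 < ε - θ by linarith),
    eventually_mul_pow_le_exp ((4 / ν + 8 * r₀) * (4 / θ)) 1 (show 0 < 2 * θ by linarith),
    eventually_mul_pow_le_exp (8 * δ₀ / (d * ν * r₀)) 1 hθ,
    eventually_mul_pow_le_exp (2 * δ₀ / (θ * (ν * Real.pi) ^ 2)) 2 (show 0 < ε by linarith),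
    eventually_mul_pow_le_exp ((1 / ν + 2 * d) * (θ + 1) * Real.exp (2 * d * ν)) 2 hq0]
    with ℓ h1 h3 h4 h5 h6 e1 e6 e8 e9 e11 e12 e13 e14 e15 e16
  intro v hv hcv
  simp only [pow_zero, mul_one, pow_one, one_mul] at e1 e6 e8 e9 e12 e13 e14
  have hℓ : 0 < ℓ := by linarith
  rw [div_le_iff₀ hθ] at h3
  set L := Real.exp ℓ with hL
  have hL0 : 0 < L := Real.exp_pos _
  obtain ⟨n, r, hnr, hr₀r, hr2, hnL⟩ := exists_blocks hr₀0 e1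
  have hr0 : 0 < r := by linarith
  have hn2 : (n : ℝ) + 2 ≤ Real.exp ((1 + θ) * ℓ) := by
    have : Real.exp ((1 + θ) * ℓ) = L * Real.exp (θ * ℓ) := by rw [hL, ← Real.exp_add]; ring_nf
    rw [this]
    have h1L : 1 ≤ L := Real.one_le_exp hℓ.le
    calc (n : ℝ) + 2 ≤ L / r₀ + 2 := by linarith
      _ ≤ L * (1 / r₀ + 2) := by
        rw [mul_add, mul_one_div]; linarith
      _ ≤ _ := by gcongr
  have hdr : 6 * d ≤ θ * r := by
    rw [← hr₀d]
    gcongr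
  have hνr : ν * r ≤ θ * ℓ := by
    calc ν * r ≤ ν * (2 * r₀) := by gcongr
      _ ≤ _ := by linarith
  obtain ⟨m, k, hm1, hmr, hk0, hkm, hksmall, hQk, hmexp⟩ := exists_run_length (τ := τ) (c₀ := c₀)
    hν hθ hθ1 hℓ hr0 hνr (by rw [div_le_iff₀ hc₀] at h4; linarith)
  obtain ⟨m', k', hk0', hkm', hksmall', hklow, hmexp'⟩ := exists_long_run_length (c₀ := c₀)
    hν hθ hθ1 hℓ hr0 hνr (by rw [div_le_iff₀ (by linarith)] at h6; linarith)
  have hmr' : (m : ℝ) ≤ ℓ / (ν * r₀) := by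
    rw [le_div_iff₀ (by positivity)]
    refine le_trans ?_ hmr
    gcongr
  have hexp : ∀ d', d' ≤ 3 * d → Real.exp (-(ν * (m * (r - d')))) ≤
      Real.exp (-((1 - 6 * θ) * ℓ)) := fun d' hd' =>
    Real.exp_le_exp.2 (neg_le_neg (hmexp d' (by linarith)))
  set Q := ((1 + θ) * (ν * Real.pi / ℓ)) ^ 2 with hQ
  have hk2 : 0 < k ^ 2 := by positivity
  have hQk' : Q / k ^ 2 ≤ 1 - θ := by
    rw [div_le_iff₀ hk2]
    refine hQk.trans ?_
    gcongr
    nlinarith only [hθ, hθ1]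
  have hQlt : Q < k ^ 2 := by
    rw [div_le_iff₀ hk2] at hQk'
    refine hQk'.trans_lt ?_
    rw [sub_mul, one_mul]
    have : 0 < θ * k ^ 2 := by positivity
    linarith
  have he₀ : Real.exp (-(θ * ℓ)) ≤ k' ^ 2 := by
    refine le_trans ?_ (pow_le_pow_left₀ (by positivity) hklow 2)
    rw [Real.exp_neg, inv_le_comm₀ (Real.exp_pos _) (by positivity)]
    refine le_of_eq_of_le ?_ e11
    field_simp
  -- `D` bounds the number of runs and `κ` is the amplitude, both powers of `L` to multiples of `θ`
  -- chosen so that `κ D` is small; `h` is the least step for which `K` gaps lower the energy enough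
  set δ := δ₀ * Real.exp (-(ε * ℓ)) with hδ
  have hδ0 : 0 < δ := by positivity
  set D := ⌊Real.exp (8 * θ * ℓ)⌋₊ with hD
  set κ := Real.exp (-(10 * θ * ℓ)) with hκ
  have hκ0 : 0 < κ := Real.exp_pos _
  set e₀ := Real.exp (-(θ * ℓ)) with he₀def
  have he₀0 : 0 < e₀ := Real.exp_pos _
  set h := 8 * δ / (κ * e₀) with hh
  have hh0 : 0 < h := by positivity
  set K := ⌊d / h⌋₊ with hK
  set A := Real.exp (1 / 2 * ℓ) with hA
  have hA0 : 0 < A := Real.exp_pos _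
  have hA2 : A ^ 2 = L := by rw [hA, hL, ← Real.exp_nat_mul]; push_cast; ring_nf
  set w := ℓ / (ν * (1 + θ / 2)) + 2 * d with hw
  have hw0 : 0 < ℓ / (ν * (1 + θ / 2)) := by positivity
  have hw1 : 0 < w := by positivity
  set k₁ := ⌊L / w⌋₊ with hk₁
  have hKA : Kc / A ^ 2 ≤ δ := by
    rw [hA2, div_le_iff₀ hL0, hδ]
    rw [div_le_iff₀ hδ₀] at e9
    refine e9.trans_eq ?_
    rw [hL, mul_assoc, ← Real.exp_add, mul_comm]
    ring_nf
  have hcond : 2 * r * κ * (D * (m + 2)) + 12 * r ^ 2 * Q < 1 - Q / k ^ 2 :=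
    localization_condition hν hθ h1 hr₀0 hr0 hr2 hmr' hQ (Nat.floor_le (Real.exp_pos _).le) hQk'
      (by rwa [div_lt_iff₀ hθ] at h5) e13
  have heδ : 4 * δ ≤ e₀ := by
    have g1 : Real.exp ((ε - θ) * ℓ) * Real.exp (-(ε * ℓ)) = e₀ := by
      rw [← Real.exp_add, he₀def]; ring_nf
    rw [← g1, hδ, ← mul_assoc]
    gcongr
  have hwπ : (Real.pi / (w - 2 * d)) ^ 2 ≤ ((1 + θ / 2) * (ν * Real.pi / ℓ)) ^ 2 := by
    refine le_of_eq ?_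
    rw [hw, add_sub_cancel_right]
    field_simp
  have hQ₁ : ((1 + θ / 2) * (ν * Real.pi / ℓ)) ^ 2 + 2 * δ ≤ Q := by
    have g1 : 2 * δ ≤ θ * (ν * Real.pi / ℓ) ^ 2 := by
      rw [div_mul_eq_mul_div, div_le_iff₀ (by positivity)] at e15
      rw [hδ, Real.exp_neg, div_pow, ← mul_div_assoc, le_div_iff₀ (by positivity),
        ← div_eq_mul_inv, ← mul_div_assoc, div_mul_eq_mul_div, div_le_iff₀ (Real.exp_pos _)]
      linarith
    have g2 : 0 ≤ (ν * Real.pi / ℓ) ^ 2 := sq_nonneg _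
    rw [hQ, mul_pow, mul_pow]
    nlinarith only [mul_nonneg (sq_nonneg θ) g2, g1]
  have h6d : 6 * d ≤ r := by
    have : θ * r ≤ 1 * r := by gcongr; linarith
    linarith
  have hkπ : k * ((m + 1) * r) < Real.pi := by
    rw [hkm, sub_mul, one_mul]
    have : 0 < θ * Real.pi := by positivity
    linarith
  have hfin := hM.measure_gap_compl_le hν hKc hv (L := L) (r := r) (c₀ := c₀) (k := k) (k' := k')
    (Q := Q) (Q₁ := ((1 + θ / 2) * (ν * Real.pi / ℓ)) ^ 2) (κ := κ) (A := A) (e₀ := e₀) (δ := δ)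
    (h := h) (w := w) (n := n) (m := m) (m' := m') (D := D) (K := K) (k₁ := k₁) hL0 h6d
    hnr hcv hk0 hkπ (by rw [hkm]; exact hksmall) hk0'.le (by rw [hkm']; linarith)
    (by rw [hkm', div_div, show (2 : ℝ) * 2 = 4 by norm_num, Real.tan_pi_div_four, mul_one]
        exact hksmall') he₀ hm1 hκ0 (Real.exp_le_exp.2 (by linarith)) e8 hδ0 hKA hQlt hcond heδ
    (by rw [hh, mul_assoc]; field_simp; exact le_rfl) hh0
    (by rw [← le_div_iff₀ hh0]; exact Nat.floor_le (by positivity)) (by linarith)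
    (by rw [← le_div_iff₀ hw1]; exact Nat.floor_le (by positivity)) hwπ hQ₁
  have hE2 := hexp (2 * d) (by linarith)
  have hE3 := hexp (3 * d) le_rfl
  have T1 : Real.exp (-(k₁ * Real.exp (-(ν * w)))) ≤ e₀ :=
    Real.exp_le_exp.2 (neg_le_neg (mul_le_floor_mul_exp hν hd hθ h1 e16))
  have T2 : ((n : ℝ) + 2) * Real.exp (-(ν * (m * (r - 2 * d)))) / (D + 1) ≤ e₀ := by
    have hD1 : Real.exp (8 * θ * ℓ) ≤ D + 1 := (Nat.lt_floor_add_one _).le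
    calc _ ≤ Real.exp ((1 + θ) * ℓ) * Real.exp (-((1 - 6 * θ) * ℓ)) / Real.exp (8 * θ * ℓ) := by
          gcongr
      _ = e₀ := by
          rw [← Real.exp_add, ← Real.exp_sub, he₀def]
          ring_nf
  have T3 : (A / r + 2) * Real.exp (-(ν * (m * (r - 2 * d)))) ≤ e₀ := by
    have g1 : A / r + 2 ≤ A * Real.exp (θ * ℓ) := by
      have h1A : 1 ≤ A := Real.one_le_exp (by linarith)
      calc A / r + 2 ≤ A / r₀ + 2 := by gcongr
        _ ≤ A * (1 / r₀ + 2) := by rw [mul_add, mul_one_div]; linarith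
        _ ≤ _ := by gcongr
    calc _ ≤ A * Real.exp (θ * ℓ) * Real.exp (-((1 - 6 * θ) * ℓ)) := by
          gcongr
      _ ≤ e₀ := by
          rw [hA, ← Real.exp_add, ← Real.exp_add, he₀def]
          refine Real.exp_le_exp.2 ?_
          nlinarith only [hθ, hθ1, hθε, hℓ]
  have T4 : ((n : ℝ) + 2) * Real.exp (-(ν * (m' * (r - 2 * d)))) ≤ e₀ := by
    have g1 : Real.exp (-(ν * (m' * (r - 2 * d)))) ≤ Real.exp (-(2 * ℓ)) :=
      Real.exp_le_exp.2 (neg_le_neg (hmexp' _ (by linarith)))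
    calc _ ≤ Real.exp ((1 + θ) * ℓ) * Real.exp (-(2 * ℓ)) := by gcongr
      _ ≤ e₀ := by
          rw [← Real.exp_add, he₀def]
          refine Real.exp_le_exp.2 ?_
          nlinarith only [hθ, hθ1, hθε, hℓ]
  have T5 : ((n : ℝ) + 1) * m * Real.exp (-(ν * (m * (r - 3 * d)))) / (K + 1) ≤ e₀ := by
    have hK1 : d / h ≤ K + 1 := (Nat.lt_floor_add_one _).le
    have hhe : h = 8 * δ₀ * Real.exp (-(ε * ℓ) + 11 * θ * ℓ) := by
      rw [hh, hδ, hκ, he₀def, ← Real.exp_add, div_eq_iff (Real.exp_pos _).ne',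
        mul_assoc (8 * δ₀), ← Real.exp_add, ← mul_assoc]
      congr 2
      ring
    calc _ ≤ Real.exp ((1 + θ) * ℓ) * (ℓ / (ν * r₀)) * Real.exp (-((1 - 6 * θ) * ℓ)) / (d / h) := by
          have : (n : ℝ) + 1 ≤ Real.exp ((1 + θ) * ℓ) := by linarith
          gcongr
      _ = Real.exp ((1 + θ) * ℓ) * Real.exp (-((1 - 6 * θ) * ℓ)) *
            (8 * δ₀ / (d * ν * r₀) * ℓ) * Real.exp (-(ε * ℓ) + 11 * θ * ℓ) := by
          rw [hhe]; field_simp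
      _ ≤ Real.exp ((1 + θ) * ℓ) * Real.exp (-((1 - 6 * θ) * ℓ)) * Real.exp (θ * ℓ) *
            Real.exp (-(ε * ℓ) + 11 * θ * ℓ) := by gcongr
      _ ≤ e₀ := by
          rw [← Real.exp_add, ← Real.exp_add, ← Real.exp_add, he₀def]
          refine Real.exp_le_exp.2 ?_
          nlinarith only [hθ, hθ1, hθε, hℓ]
  refine hfin.trans ?_
  have hsum : (5 : ENNReal) * ENNReal.ofReal e₀ = ENNReal.ofReal e₀ + (ENNReal.ofReal e₀ +
      (ENNReal.ofReal e₀ + (ENNReal.ofReal e₀ + ENNReal.ofReal e₀))) := by ring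
  rw [hsum]
  gcongr

end

/-! ### The limit of growing strength -/

/-- A nonnegative, bounded, compactly supported function that is not almost everywhere zero is a
single-site potential of positive mass. -/
theorem exists_isSite {u : ℝ → ℝ} (hu_meas : Measurable u) (hu_nonneg : ∀ x, 0 ≤ u x)
    (hu_bdd : ∃ C : ℝ, ∀ x, u x ≤ C) (hu_supp : HasCompactSupport u) (hu_ne : ¬ u =ᵐ[volume] 0) :
    (∃ d, IsSite u d) ∧ 0 < ∫ x, u x := by
  obtain ⟨C, hC⟩ := hu_bdd
  obtain ⟨R, hR⟩ := hu_supp.isCompact.isBounded.subset_closedBall 0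
  constructor
  · refine ⟨max R 0 + 1, hu_meas, hu_nonneg, ⟨C, hC⟩, fun x hx => ?_, by positivity⟩
    by_contra h
    have := hR (subset_tsupport u h)
    rw [mem_closedBall_zero_iff, Real.norm_eq_abs] at this
    linarith [le_max_left R 0]
  · have hint : Integrable u := by
      refine (integrableOn_iff_integrable_of_support_subset (subset_tsupport u)).1 ?_
      refine IntegrableOn.of_bound hu_supp.isCompact.measure_lt_top
        hu_meas.aestronglyMeasurable C (ae_of_all _ fun x => ?_)
      rw [Real.norm_eq_abs, abs_of_nonneg (hu_nonneg x)]
      exact hC x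
    refine (integral_nonneg hu_nonneg).lt_of_ne' fun h => hu_ne ?_
    exact (integral_eq_zero_iff_of_nonneg hu_nonneg hint).1 h

theorem IsSite.const_mul {v : ℝ → ℝ} {d s : ℝ} (hv : IsSite v d) (hs : 0 ≤ s) :
    IsSite (fun x => s * v x) d where
  meas := hv.meas.const_mul s
  nonneg x := mul_nonneg hs (hv.nonneg x)
  bdd := by
    obtain ⟨C, hC⟩ := hv.bdd
    exact ⟨s * C, fun x => mul_le_mul_of_nonneg_left (hC x) hs⟩
  supp x hx := by rw [hv.supp x hx, mul_zero]
  pos := hv.pos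

end KacLuttinger

theorem theorem5p5 {Ω : Type*} [MeasurableSpace Ω] (P : Measure Ω) [IsProbabilityMeasure P]
    (ν : ℝ) (hν : 0 < ν) (M : Ω → Measure ℝ)
    (hM : KacLuttinger.IsPoissonRandomMeasure P ν M)
    -- the single-site potential
    (u : ℝ → ℝ) (hu_meas : Measurable u) (hu_nonneg : ∀ x, 0 ≤ u x)
    (hu_bdd : ∃ C : ℝ, ∀ x, u x ≤ C) (hu_supp : HasCompactSupport u)
    (hu_ne : ¬ u =ᵐ[volume] 0)
    -- the strength, converging to infinity
    (S : ℕ → ℝ) (hS_pos : ∀ N, 0 < S N) (hS_mono : Monotone S) (hS_top : Tendsto S atTop atTop)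
    -- the particle density
    (ρ : ℝ) (hρ : 0 < ρ)
    (ζ₁ ζ₂ : ℝ) (hζ₂ : 0 < ζ₂) (hζ : ζ₂ < ζ₁) (hζ₁ : ζ₁ < 1) :
    Tendsto (fun N => P (KacLuttinger.gapEvent M ν u S ρ ζ₁ ζ₂ N 2)) atTop (𝓝 1) ∧
    -- the complement has outer probability tending to zero (so no measurability is needed)
    Tendsto (fun N => P (KacLuttinger.gapEvent M ν u S ρ ζ₁ ζ₂ N 2)ᶜ) atTop (𝓝 0) := by
  obtain ⟨⟨d, hu⟩, hu0⟩ := KacLuttinger.exists_isSite hu_meas hu_nonneg hu_bdd hu_supp hu_ne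
  -- with `ℓ = log (N / ρ)` the threshold `N ^ (-1 + ζ₁)` is `ρ ^ (-ε) * exp (-(ε * ℓ))`
  set ε := 1 - ζ₁ with hε
  have hε0 : 0 < ε := by linarith
  obtain ⟨θ, hθ, hθ1, hθζ, hθε⟩ : ∃ θ : ℝ, 0 < θ ∧ θ ≤ 1 / 20 ∧ θ ≤ ζ₂ ∧ 20 * θ ≤ ε := by
    refine ⟨min (1 / 20) (min ζ₂ (ε / 20)), by positivity, min_le_left _ _,
      (min_le_right _ _).trans (min_le_left _ _), ?_⟩
    linarith [(min_le_right (1 / 20) (min ζ₂ (ε / 20))).trans (min_le_right _ _)]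
  have hδ₀ : 0 < ρ ^ (-ε) := Real.rpow_pos_of_pos hρ _
  have hℓ : Tendsto (fun N : ℕ => Real.log ((N : ℝ) / ρ)) atTop atTop :=
    Real.tendsto_log_atTop.comp (tendsto_natCast_atTop_atTop.atTop_div_const hρ)
  have hbound : ∀ᶠ N : ℕ in atTop, P (KacLuttinger.gapEvent M ν u S ρ ζ₁ ζ₂ N 2)ᶜ ≤
      5 * ENNReal.ofReal (Real.exp (-(θ * Real.log ((N : ℝ) / ρ)))) := by
    have hmain := hℓ.eventually (hM.eventually_measure_gap_compl_le hν hu.pos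
      (mul_pos (hS_pos 0) hu0) hδ₀ (show ε < 1 by linarith) hθ hθ1 hθε)
    filter_upwards [hmain, hℓ.eventually_ge_atTop 1, eventually_gt_atTop 0] with N hN hN1 hN0
    have hNr : (0 : ℝ) < N := Nat.cast_pos.2 hN0
    refine le_trans (measure_mono fun ω hω => ?_) (hN (fun x => S N * u x)
      (hu.const_mul (hS_pos N).le) ?_)
    · refine fun hgap => hω ?_
      rw [Real.exp_log (div_pos hNr hρ)] at hgap
      refine ⟨le_of_eq_of_le ?_ hgap.1, hgap.2.trans ?_⟩
      · rw [mul_comm ε, ← mul_neg, ← Real.rpow_def_of_pos (div_pos hNr hρ),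
          Real.div_rpow hNr.le hρ.le, mul_div_cancel₀ _ hδ₀.ne', hε, neg_sub', sub_neg_eq_add]
      · have : 0 ≤ ν * Real.pi / Real.log ((N : ℝ) / ρ) := by positivity
        gcongr
        linarith
    · rw [integral_const_mul]
      exact mul_le_mul_of_nonneg_right (hS_mono (Nat.zero_le N)) hu0.le
  have hlim : Tendsto (fun N : ℕ =>
      5 * ENNReal.ofReal (Real.exp (-(θ * Real.log ((N : ℝ) / ρ))))) atTop (𝓝 0) := by
    have h1 : Tendsto (fun N : ℕ => Real.exp (-(θ * Real.log ((N : ℝ) / ρ)))) atTop (𝓝 0) :=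
      Real.tendsto_exp_neg_atTop_nhds_zero.comp (hℓ.const_mul_atTop hθ)
    have h2 := ENNReal.Tendsto.const_mul (a := 5) (ENNReal.tendsto_ofReal h1)
      (Or.inr (by norm_num))
    rwa [ENNReal.ofReal_zero, mul_zero] at h2
  have hcompl : Tendsto (fun N => P (KacLuttinger.gapEvent M ν u S ρ ζ₁ ζ₂ N 2)ᶜ) atTop (𝓝 0) :=
    tendsto_of_tendsto_of_tendsto_of_le_of_le' tendsto_const_nhds hlim
      (Eventually.of_forall fun _ => zero_le) hbound
  refine ⟨?_, hcompl⟩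
  have hsub := ENNReal.Tendsto.sub (tendsto_const_nhds (x := (1 : ENNReal))) hcompl
    (Or.inl ENNReal.one_ne_top)
  rw [tsub_zero] at hsub
  refine tendsto_of_tendsto_of_tendsto_of_le_of_le hsub tendsto_const_nhds (fun N => ?_)
    fun N => prob_le_one
  -- subadditivity alone bounds the probability from below, as the event need not be measurable
  refine tsub_le_iff_right.2 ?_
  rw [← measure_univ (μ := P), ← union_compl_self (KacLuttinger.gapEvent M ν u S ρ ζ₁ ζ₂ N 2)]
  exact measure_union_le _ _
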